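/- Let $k$ be a field, let $d\ge 2$ and $n\ge 1$ be integers, and let $r_d,\dots,r_0,s_d,\dots,s_0,t$ be independent transcendentals over $k$. Put $K^{\mathrm{poly}}=k(r_d,\dots,r_0)$ and $K^{\mathrm{rat}}=k(r_d,\dots,r_0,s_d,\dots,s_0)$, and let $$\pi(X)=r_dX^d+\cdots+r_0\in K^{\mathrm{poly}}[X],\qquad \rho(X)=\frac{r_dX^d+\cdots+r_0}{s_dX^d+\cdots+s_0}\in K^{\mathrm{rat}}(X)$$ be the generic polynomial and the generic rational function of degree $d$. Write $\pi^n,\rho^n$ for the $n$-fold compositional iterates, and let $L^{\mathrm{rat}}$ be the splitting field of (the numerator, in lowest terms, of) $\rho^n(X)-t$ over $K^{\mathrm{rat}}(t)$ and $L^{\mathrm{poly}}$ the splitting field of $\pi^n(X)-t$ over $K^{\mathrm{poly}}(t)$. Let $\mathrm{fix}(\rho^n(X)-t)$ denote the proportion of elements of $\mathrm{Gal}(L^{\mathrm{rat}}/K^{\mathrm{rat}}(t))$ that fix at least one root of $\rho^n(X)-t$ in $L^{\mathrm{rat}}$, and define $\mathrm{fix}(\pi^n(X)-t)$ likewise. Let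 $S_d$ be the symmetric group acting on $\{1,\dots,d\}$, and define $[S_d]^1=S_d$ and, for $n\ge2$, $[S_d]^n=\left([S_d]^{n-1}\right)^{d}\rtimes S_d$, where $S_d$ permutes the $d$ coordinates. Then $L^{\mathrm{rat}}/K^{\mathrm{rat}}(t)$ is Galois, $$\mathrm{Gal}(L^{\mathrm{rat}}/K^{\mathrm{rat}}(t))\simeq[S_d]^n\qquad\text{and}\qquad \mathrm{fix}(\rho^n(X)-t)\le\frac{2}{n+2},$$ and the inequality is strict unless $(d,n)=(3,1)$. If $(d,\operatorname{char} k)\neq(2,2)$, then $L^{\mathrm{poly}}/K^{\mathrm{poly}}(t)$ is Galois, $$\mathrm{Gal}(L^{\mathrm{poly}}/K^{\mathrm{poly}}(t))\simeq[S_d]^n\qquad\text{and}\qquad \mathrm{fix}(\pi^n(X)-t)\le\frac{2}{n+2},$$ and the inequality is strict unless $(d,n)=(3,1)$. -/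

import Mathlib

universe u v

/-- The wreath product `G ≀ H` with respect to an action of `H` on `T`: the semidirect product
`G^T ⋊ H` in which `H` permutes the coordinates, `(h • f) t = f (h⁻¹ • t)`. -/
abbrev WreathProd (G H T : Type*) [Group G] [Group H] [MulAction H T] :=
  (T → G) ⋊[(mulAutArrow : H →* MulAut (T → G))] H

/-- The iterated wreath product `[G]ⁿ` of a group `G` acting on `S`: `[G]¹ = G` and
`[G]ⁿ = [G]ⁿ⁻¹ ≀ G` with respect to the action on `S`. (The value at `0` is a convention.) -/
def iterWreath (G S : Type u) [Group G] [MulAction G S] : ℕ → GrpCat.{u}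
  | 0 => GrpCat.of PUnit
  | 1 => GrpCat.of G
  | n + 2 => GrpCat.of (WreathProd (iterWreath G S (n + 1)) G S)

/-- The field `k(r_d, …, r_0)` of coefficients of the generic polynomial of degree `d`. -/
abbrev PolyCoeffField (k : Type u) [Field k] (d : ℕ) : Type u :=
  FractionRing (MvPolynomial (Fin (d + 1)) k)

/-- The field `k(r_d, …, r_0, s_d, …, s_0)` of coefficients of the generic rational function of
degree `d`; `Sum.inl i` indexes `r_i` and `Sum.inr i` indexes `s_i`. -/
abbrev RatCoeffField (k : Type u) [Field k] (d : ℕ) : Type u :=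
  FractionRing (MvPolynomial (Fin (d + 1) ⊕ Fin (d + 1)) k)

noncomputable section

/-- The polynomial `c_d X^d + ⋯ + c_1 X + c_0`. -/
def polyOfCoeffs {K : Type u} [Field K] {d : ℕ} (c : Fin (d + 1) → K) : Polynomial K :=
  ∑ i : Fin (d + 1), Polynomial.C (c i) * Polynomial.X ^ (i : ℕ)

/-- The generic polynomial `r_d X^d + ⋯ + r_0`. -/
def genericPoly (k : Type u) [Field k] (d : ℕ) : Polynomial (PolyCoeffField k d) :=
  polyOfCoeffs fun i =>
    algebraMap (MvPolynomial (Fin (d + 1)) k) (PolyCoeffField k d) (MvPolynomial.X i)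

/-- The generic rational function `(r_d X^d + ⋯ + r_0) / (s_d X^d + ⋯ + s_0)`. -/
def genericRat (k : Type u) [Field k] (d : ℕ) : RatFunc (RatCoeffField k d) :=
  algebraMap (Polynomial (RatCoeffField k d)) (RatFunc (RatCoeffField k d))
      (polyOfCoeffs fun i =>
        algebraMap (MvPolynomial (Fin (d + 1) ⊕ Fin (d + 1)) k) (RatCoeffField k d)
          (MvPolynomial.X (Sum.inl i))) /
    algebraMap (Polynomial (RatCoeffField k d)) (RatFunc (RatCoeffField k d))
      (polyOfCoeffs fun i =>
        algebraMap (MvPolynomial (Fin (d + 1) ⊕ Fin (d + 1)) k) (RatCoeffField k d)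
          (MvPolynomial.X (Sum.inr i)))

/-- The composition `φ ∘ ψ` of rational functions, obtained by substituting `ψ` for `X` in `φ`
(meaningful for nonconstant `ψ`, where no denominator vanishes). -/
def ratComp {K : Type u} [Field K] (φ ψ : RatFunc K) : RatFunc K :=
  φ.eval (RatFunc.C : K →+* RatFunc K) ψ

/-- The `n`-th compositional iterate `φⁿ` of a rational function. -/
def ratIter {K : Type u} [Field K] (φ : RatFunc K) (n : ℕ) : RatFunc K :=
  (ratComp φ)^[n] RatFunc.X

/-- The rational function `φⁿ(X) - t` over the rational function field `K(t)`. The indeterminate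
`t` is `RatFunc.X : RatFunc K`, and `φⁿ` is viewed in `K(t)(X)` through its coefficients. -/
def ratIterSubT {K : Type u} [Field K] (φ : RatFunc K) (n : ℕ) : RatFunc (RatFunc K) :=
  (ratIter φ n).eval
      ((RatFunc.C : RatFunc K →+* RatFunc (RatFunc K)).comp (RatFunc.C : K →+* RatFunc K))
      (RatFunc.X : RatFunc (RatFunc K))
    - RatFunc.C (RatFunc.X : RatFunc K)

/-- The polynomial `fⁿ(X) - t` over the rational function field `K(t)`, with `fⁿ` the `n`-th
compositional iterate of `f`. -/
def polyIterSubT {K : Type u} [Field K] (f : Polynomial K) (n : ℕ) : Polynomial (RatFunc K) :=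
  (f.comp^[n] Polynomial.X).map (RatFunc.C : K →+* RatFunc K) - Polynomial.C (RatFunc.X : RatFunc K)

/-- The proportion of elements of the Galois group of the splitting field of `p` over `F` that fix
at least one root of `p`. -/
def fixProp {F : Type u} [Field F] (p : Polynomial F) : ℚ :=
  (Nat.card {σ : p.SplittingField ≃ₐ[F] p.SplittingField //
      ∃ a ∈ p.rootSet p.SplittingField, σ a = a} : ℚ) /
    Nat.card (p.SplittingField ≃ₐ[F] p.SplittingField)

/-- The splitting field over `F` of a rational function `ψ`: that of its numerator in lowest
terms, whose roots are the zeros of `ψ`. -/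
abbrev RatSplittingField {F : Type u} [Field F] (ψ : RatFunc F) : Type u :=
  ψ.num.SplittingField

/-- The proportion of elements of the Galois group of the splitting field of `ψ` over `F` that fix
at least one zero of `ψ`. -/
def ratFixProp {F : Type u} [Field F] (ψ : RatFunc F) : ℚ := fixProp ψ.num

end

/-! Write `f` for the generic map `P / Q` over its coefficient field `K`, and let `Ω` be an
algebraic closure of `K(t)`. The zeros of `f^n(X) - t` are the vertices of depth `n` in the tree of
iterated preimages of `t`. Galois automorphisms commute with `f`, so they act through the iterated
wreath product. It remains to see that every element of the wreath product occurs, and to count the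
elements with a fixed vertex.

Fullness. The permutations of a level that act trivially on the previous level are generated by
transpositions of siblings, so by induction it suffices to induce all of these on every level
(`levelStabilizer_eq_range`). One per level is enough. If `a ≠ b` lie over `w`, then `P(a) = w Q(a)`
and `P(b) = w Q(b)` are linear equations for the two lowest coefficients of `P`, with determinant `a
- b` up to sign. Hence `w`, `a`, `b` and the other coefficients form a transcendence basis of `Ω`
over `k`, and any two sibling pairs of a level are conjugate over `K(t)`
(`IsGenericMap.exists_algEquiv`, `IsRatMap.exists_swap_of_exists`).

One transposition comes from ramification (`HasSimpleCriticalOrbit.exists_swap`). Embed `K(t)` in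
Laurent series over an algebraically closed `E` by `t ↦ x₀ + X`, each coefficient going to its value
in a special map plus `X²` times a new transcendental. Suppose that the backward orbit of `x₀` up to
depth `n` meets just one critical value, `x_n` at depth `n`, with one simple critical point above
it. By Hensel's lemma all preimages of `t` up to depth `n + 1` are power series, except two siblings
over the lift of `x_n`. Those two are separable but not Laurent series, so an automorphism exchanges
them. Tameness plays no role.

The special map is `l (1 + m X² ∏ (X - e))` with `l` transcendental: forward orbits of critical
values are polynomials in `l`, told apart by degree and leading coefficient. A quadratic polynomial
in characteristic two has constant derivative, hence the excluded case; for rational functions `l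
(X² + X + 1) / (X + 1)` takes its place.

Count. If `x` is the proportion of elements with a fixed vertex on one level, the next proportion is
the mean of `1 - (1 - x)^fix(h)` over `h` in `S_d`. Bonferroni's inequality and the binomial moments
of the number of fixed points bound it by `x - x²/2 + x³/6` (`one_sub_avg_le_fixStep`), and this
recursion preserves the bound `2 / (n + 2)`, strictly after the first step. -/

/-! ### Wreath products acting on the levels of a rooted tree -/

/-- The vertices at depth `n + 1` of the regular rooted tree in which the children of every vertex
are indexed by `S`. -/
def TreeLevel (S : Type u) : ℕ → Type u
  | 0 => S
  | n + 1 => S × TreeLevel S n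

instance TreeLevel.instFinite (S : Type u) [Finite S] : ∀ n, Finite (TreeLevel S n)
  | 0 => inferInstanceAs (Finite S)
  | n + 1 => by
    have := TreeLevel.instFinite S n
    exact inferInstanceAs (Finite (S × TreeLevel S n))

instance TreeLevel.instNonempty (S : Type u) [Nonempty S] : ∀ n, Nonempty (TreeLevel S n)
  | 0 => inferInstanceAs (Nonempty S)
  | n + 1 => by
    have := TreeLevel.instNonempty S n
    exact inferInstanceAs (Nonempty (S × TreeLevel S n))

/-- The imprimitive action of a wreath product. -/
def wreathHom (S : Type u) {V G : Type*} [Group G] (ρ : G →* Equiv.Perm V) :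
    WreathProd G (Equiv.Perm S) S →* Equiv.Perm (S × V) :=
  SemidirectProduct.lift
    { toFun := fun g => Equiv.sigmaEquivProd S V |>.permCongr
        (Equiv.sigmaCongrRight fun i => ρ (g i))
      map_one' := by ext ⟨i, v⟩ <;> simp
      map_mul' := fun a b => by ext ⟨i, v⟩ <;> simp }
    { toFun := fun h => Equiv.prodCongr h (Equiv.refl V)
      map_one' := by ext ⟨i, v⟩ <;> simp
      map_mul' := fun a b => by ext ⟨i, v⟩ <;> simp }
    (fun h => by
      ext g ⟨i, v⟩
      · simp [MulAut.conj_apply]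
      · simp only [MonoidHom.comp_apply, MulEquiv.coe_toMonoidHom, MonoidHom.coe_mk, OneHom.coe_mk,
          MulAut.conj_apply, Equiv.Perm.coe_mul, Function.comp_apply]
        rfl)

@[simp]
theorem wreathHom_apply (S : Type u) {V G : Type*} [Group G] (ρ : G →* Equiv.Perm V)
    (w : WreathProd G (Equiv.Perm S) S) (i : S) (v : V) :
    wreathHom S ρ w (i, v) = (w.right i, ρ (w.left (w.right i)) v) := by
  simp [wreathHom, SemidirectProduct.lift]

theorem wreathHom_injective (S : Type u) {V G : Type*} [Group G] [Nonempty V]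
    {ρ : G →* Equiv.Perm V} (hρ : Function.Injective ρ) :
    Function.Injective (wreathHom S ρ) := by
  intro a b hab
  have h (i : S) (v : V) : (a.right i, ρ (a.left (a.right i)) v) =
      (b.right i, ρ (b.left (b.right i)) v) := by
    simpa using DFunLike.congr_fun hab (i, v)
  obtain ⟨v₀⟩ := ‹Nonempty V›
  have hr : a.right = b.right := Equiv.ext fun i => congrArg Prod.fst (h i v₀)
  refine SemidirectProduct.ext (funext fun i => hρ (Equiv.ext fun v => ?_)) hr
  have := congrArg Prod.snd (h (a.right⁻¹ i) v)
  simpa [← hr] using this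

/-- The action of the iterated wreath product of `Perm S` on a level of the tree. -/
def iterWreathHom (S : Type u) :
    (n : ℕ) → iterWreath (Equiv.Perm S) S (n + 1) →* Equiv.Perm (TreeLevel S n)
  | 0 => MonoidHom.id (Equiv.Perm S)
  | n + 1 => wreathHom S (iterWreathHom S n)

theorem iterWreathHom_injective (S : Type u) [Nonempty S] :
    ∀ n, Function.Injective (iterWreathHom S n)
  | 0 => fun _ _ h => h
  | n + 1 => wreathHom_injective S (iterWreathHom_injective S n)

instance iterWreath.instFinite (S : Type u) [Finite S] [Nonempty S] (n : ℕ) :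
    Finite (iterWreath (Equiv.Perm S) S (n + 1)) :=
  Finite.of_injective _ (iterWreathHom_injective S n)

/-! ### The proportion of elements with a fixed vertex -/

/-- The proportion of elements of a group acting without fixed points. -/
noncomputable def derangeProp {V G : Type*} [Group G] (ρ : G →* Equiv.Perm V) : ℚ :=
  (Nat.card {g : G // ∀ v, ρ g v ≠ v} : ℚ) / Nat.card G

theorem derangeProp_nonneg {V G : Type*} [Group G] (ρ : G →* Equiv.Perm V) :
    0 ≤ derangeProp ρ := by unfold derangeProp; positivity

theorem derangeProp_le_one {V G : Type*} [Group G] [Finite G] (ρ : G →* Equiv.Perm V) :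
    derangeProp ρ ≤ 1 := by
  unfold derangeProp
  refine div_le_one_of_le₀ ?_ (by positivity)
  exact_mod_cast Nat.card_le_card_of_injective _ Subtype.val_injective

-- A pair `(g, h)` is fixed-point-free exactly when `g i` is fixed-point-free for each `i` fixed by
-- `h`. These conditions are independent over `i`, and coordinates moved by `h` are unconstrained.
open Finset in
theorem derangeProp_wreathHom {S V G : Type*} [Fintype S] [DecidableEq S] [Group G]
    [Finite G] (ρ : G →* Equiv.Perm V) :
    derangeProp (wreathHom S ρ) =
      (∑ h : Equiv.Perm S, derangeProp ρ ^ #{i | h i = i}) / (Fintype.card S).factorial := by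
  classical
  have := Fintype.ofFinite G
  have hG : (Nat.card G : ℚ) ≠ 0 := by exact_mod_cast Nat.card_pos.ne'
  have hcard : Nat.card (WreathProd G (Equiv.Perm S) S) =
      Nat.card G ^ Fintype.card S * (Fintype.card S).factorial := by
    rw [Nat.card_congr SemidirectProduct.equivProd, Nat.card_prod, Nat.card_fun,
      Nat.card_perm, Nat.card_eq_fintype_card (α := S)]
  let D : Type _ := {g : G // ∀ v, ρ g v ≠ v}
  let e : {w : WreathProd G (Equiv.Perm S) S // ∀ x, wreathHom S ρ w x ≠ x} ≃
      (Σ h : Equiv.Perm S, ∀ i : S, {g : G // h i = i → ∀ v, ρ g v ≠ v}) :=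
    { toFun := fun w => ⟨w.1.right, fun i => ⟨w.1.left i, fun hi v hv => by
        have := w.2 (i, v)
        rw [wreathHom_apply, hi, hv] at this
        exact this rfl⟩⟩
      invFun := fun p => ⟨⟨fun i => (p.2 i).1, p.1⟩, by
        rintro ⟨i, v⟩ h
        rw [wreathHom_apply] at h
        have h1 : p.1 i = i := congrArg Prod.fst h
        have h2 : ρ ((p.2 (p.1 i)).1) v = v := congrArg Prod.snd h
        rw [h1] at h2
        exact (p.2 i).2 h1 v h2⟩
      left_inv := fun w => rfl
      right_inv := fun p => rfl }
  have key : (Nat.card {w : WreathProd G (Equiv.Perm S) S // ∀ x, wreathHom S ρ w x ≠ x} : ℚ) =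
      ∑ h : Equiv.Perm S, ∏ i : S, (if h i = i then (Nat.card D : ℚ) else Nat.card G) := by
    rw [Nat.card_congr e, Nat.card_sigma]
    push_cast
    refine Finset.sum_congr rfl fun h _ => ?_
    rw [Nat.card_pi]
    push_cast
    refine Finset.prod_congr rfl fun i _ => ?_
    split_ifs with hi
    · exact congrArg _ (Nat.card_congr (Equiv.subtypeEquivRight fun g => by simp [hi]))
    · exact congrArg _ (Nat.card_congr (Equiv.subtypeUnivEquiv fun g h => absurd h hi))
  rw [derangeProp, key, hcard]
  push_cast
  rw [← div_div, Finset.sum_div]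
  congr 1
  refine Finset.sum_congr rfl fun h _ => ?_
  rw [← Finset.card_univ, ← Finset.prod_const, ← Finset.prod_div_distrib, derangeProp,
    ← Finset.prod_const, Finset.prod_filter]
  refine Finset.prod_congr rfl fun i _ => ?_
  split_ifs with hi
  · rfl
  · exact div_self hG

/-- This puts the first level in the shape of the recursion, with proportion `0` below it; `0 ^ 0 =
1` singles out the derangements. -/
theorem derangeProp_id {S : Type*} [Fintype S] [DecidableEq S] :
    derangeProp (MonoidHom.id (Equiv.Perm S)) =
      (∑ h : Equiv.Perm S, (0 : ℚ) ^ (Finset.card {i | h i = i})) /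
        (Fintype.card S).factorial := by
  classical
  rw [derangeProp, Nat.card_perm, Nat.card_eq_fintype_card (α := S), Nat.card_eq_fintype_card,
    Fintype.card_subtype]
  congr 1
  rw [Finset.card_filter]
  push_cast
  refine Finset.sum_congr rfl fun h _ => ?_
  by_cases hh : ∀ v, h v ≠ v
  · rw [if_pos (by simpa using hh), Finset.filter_eq_empty_iff.mpr (by simpa using hh)]
    simp
  · rw [if_neg (by simpa using hh), zero_pow]
    push Not at hh
    obtain ⟨v, hv⟩ := hh
    exact Finset.card_ne_zero_of_mem (a := v) (by simpa using hv)

-- Multiplying the bound for `m` by `1 - x ≥ 0` gives the bound for `m + 1` plus the nonnegative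
-- term `(m choose 3) x⁴`.
open Finset in
theorem one_sub_pow_ge_bonferroni {x : ℚ} (h1 : x ≤ 1) (m : ℕ) :
    1 - m * x + (m.choose 2 : ℚ) * x ^ 2 - (m.choose 3 : ℚ) * x ^ 3 ≤ (1 - x) ^ m := by
  induction m with
  | zero => simp
  | succ m ih =>
    have h2 : ((m + 1).choose 2 : ℚ) = m + m.choose 2 := by
      rw [Nat.choose_succ_succ' m 1]; push_cast; simp
    have h3 : ((m + 1).choose 3 : ℚ) = m.choose 2 + m.choose 3 := by
      rw [Nat.choose_succ_succ' m 2]; push_cast; simp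
    rw [pow_succ (1 - x), h2, h3]
    have := mul_le_mul_of_nonneg_right ih (sub_nonneg.mpr h1)
    have h4 : (0 : ℚ) ≤ (m.choose 3 : ℚ) * x ^ 4 := by positivity
    push_cast
    linarith [this, h4]

-- Burnside's lemma for the action on injective `j`-tuples: it is transitive, and `h` fixes
-- precisely the tuples of fixed points of `h`.
open Finset in
theorem sum_choose_card_fixed {S : Type*} [Fintype S] [DecidableEq S] (j : ℕ)
    (hj : j ≤ Fintype.card S) :
    (∑ h : Equiv.Perm S, ((#{i | h i = i}).choose j : ℚ)) =
      (Fintype.card S).factorial / j.factorial := by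
  classical
  have hb := MulAction.sum_card_fixedBy_eq_card_orbits_mul_card_group
    (Equiv.Perm S) (Fin j ↪ S)
  have htr : MulAction.IsPretransitive (Equiv.Perm S) (Fin j ↪ S) := by
    exact Equiv.Perm.isMultiplyPretransitive S j
  have hne : Nonempty (Fin j ↪ S) := by
    rw [Function.Embedding.nonempty_iff_card_le]; simpa
  have horb : Fintype.card (Quotient (MulAction.orbitRel (Equiv.Perm S) (Fin j ↪ S))) = 1 := by
    rw [Fintype.card_eq_one_iff_nonempty_unique]
    obtain ⟨x⟩ := hne
    refine ⟨⟨⟨Quotient.mk _ x⟩, fun q => ?_⟩⟩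
    induction q using Quotient.inductionOn with
    | h y => exact Quotient.sound (MulAction.exists_smul_eq _ x y)
  rw [horb, one_mul, Fintype.card_perm] at hb
  have hfix (h : Equiv.Perm S) :
      Fintype.card (MulAction.fixedBy (Fin j ↪ S) h) = (#{i | h i = i}).descFactorial j := by
    rw [← Fintype.card_subtype, ← Fintype.card_fin j, ← Fintype.card_embedding_eq,
      Fintype.card_fin]
    refine Fintype.card_congr
      { toFun := fun x => ⟨fun a => ⟨x.1 a, ?_⟩, fun a b hab => ?_⟩
        invFun := fun y => ⟨y.trans (Function.Embedding.subtype _), ?_⟩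
        left_inv := fun x => ?_
        right_inv := fun y => ?_ }
    · exact DFunLike.congr_fun x.2 a
    · exact x.1.injective (congrArg Subtype.val hab)
    · ext a; exact (y a).2
    · rfl
    · rfl
  simp_rw [hfix, Nat.descFactorial_eq_factorial_mul_choose] at hb
  rw [← Finset.mul_sum] at hb
  rw [eq_div_iff (by positivity), mul_comm]
  exact_mod_cast hb

/-- The upper bound `x - x²/2 + x³/6` on the proportion of fixing elements at the next level. -/
def fixStep (x : ℚ) : ℚ := x - x ^ 2 / 2 + x ^ 3 / 6

-- Averaging Bonferroni's inequality uses the binomial moments `1`, `1`, `1/2` and at most `1/6` of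
-- the number of fixed points. At `x = 1` there is slack on either side of three letters: on two
-- letters the third moment is `0`, and on four or more the inequality is strict at the identity.
open Finset in
theorem one_sub_avg_le_fixStep {S : Type*} [Fintype S] [DecidableEq S]
    (hS : 2 ≤ Fintype.card S) {x : ℚ} (h0 : 0 ≤ x) (h1 : x ≤ 1) :
    1 - (∑ h : Equiv.Perm S, (1 - x) ^ #{i | h i = i}) / (Fintype.card S).factorial ≤
      fixStep x ∧
    (x = 1 → Fintype.card S ≠ 3 →
      1 - (∑ h : Equiv.Perm S, (1 - x) ^ #{i | h i = i}) / (Fintype.card S).factorial <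
        fixStep x) := by
  have hN : (0 : ℚ) < (Fintype.card S).factorial := by positivity
  set N : ℚ := (((Fintype.card S).factorial : ℕ) : ℚ) with hNdef
  have s0 : (∑ h : Equiv.Perm S, (1 : ℚ)) = N := by
    simp [Fintype.card_perm, hNdef]
  have s1 : (∑ h : Equiv.Perm S, ((#{i | h i = i} : ℕ) : ℚ)) = N := by
    simpa using sum_choose_card_fixed (S := S) 1 (by omega)
  have s2 : (∑ h : Equiv.Perm S, ((#{i | h i = i}).choose 2 : ℚ)) = N / 2 := by
    simpa using sum_choose_card_fixed (S := S) 2 hS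
  have s3 : (∑ h : Equiv.Perm S, ((#{i | h i = i}).choose 3 : ℚ)) ≤ N / 6 ∧
      (Fintype.card S < 3 →
        (∑ h : Equiv.Perm S, ((#{i | h i = i}).choose 3 : ℚ)) = 0) := by
    have hz : (Fintype.card S < 3 →
        (∑ h : Equiv.Perm S, ((#{i | h i = i}).choose 3 : ℚ)) = 0) := by
      intro h3
      refine Finset.sum_eq_zero fun h _ => ?_
      rw [Nat.choose_eq_zero_of_lt, Nat.cast_zero]
      exact (card_filter_le _ _).trans_lt h3
    refine ⟨?_, hz⟩
    rcases lt_or_ge (Fintype.card S) 3 with h3 | h3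
    · rw [hz h3]; positivity
    · have := sum_choose_card_fixed (S := S) 3 h3
      rw [this]; norm_num [Nat.factorial, hNdef]
  have hsum : ∑ h : Equiv.Perm S, (1 - ((#{i | h i = i} : ℕ) : ℚ) * x +
      ((#{i | h i = i}).choose 2 : ℚ) * x ^ 2 - ((#{i | h i = i}).choose 3 : ℚ) * x ^ 3) =
      N - N * x + N / 2 * x ^ 2 -
        (∑ h : Equiv.Perm S, ((#{i | h i = i}).choose 3 : ℚ)) * x ^ 3 := by
    rw [sum_sub_distrib, sum_add_distrib, sum_sub_distrib, ← sum_mul, ← sum_mul, ← sum_mul,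
      s0, s1, s2]
  have hle := Finset.sum_le_sum fun (h : Equiv.Perm S) (_ : h ∈ univ) =>
    one_sub_pow_ge_bonferroni h1 (#{i | h i = i})
  have hx3 : 0 ≤ x ^ 3 := by positivity
  have hmain := mul_le_mul_of_nonneg_right s3.1 hx3
  rw [hsum] at hle
  unfold fixStep
  constructor
  · rw [sub_le_comm, le_div_iff₀ hN]
    linarith
  · rintro rfl h3
    rw [sub_lt_comm, lt_div_iff₀ hN]
    rcases lt_or_ge (Fintype.card S) 3 with h | h
    · rw [s3.2 h] at hle
      linarith
    · have h4 : 4 ≤ Fintype.card S := by omega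
      have hlt : ∑ h : Equiv.Perm S, (1 - ((#{i | h i = i} : ℕ) : ℚ) * 1 +
          ((#{i | h i = i}).choose 2 : ℚ) * 1 ^ 2 - ((#{i | h i = i}).choose 3 : ℚ) * 1 ^ 3) <
          ∑ h : Equiv.Perm S, (1 - 1 : ℚ) ^ #{i | h i = i} := by
        -- At the identity on `m` letters the Bonferroni sum is `-((m - 1) choose 3)`, negative for
        -- `m ≥ 4`, while `0 ^ m = 0`.
        refine Finset.sum_lt_sum (fun h _ => one_sub_pow_ge_bonferroni h1 _)
          ⟨1, mem_univ _, ?_⟩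
        have hc : #{i : S | (1 : Equiv.Perm S) i = i} = Fintype.card S := by simp
        rw [hc]
        obtain ⟨m, hm⟩ := Nat.exists_eq_add_of_le h4
        rw [hm, sub_self, zero_pow (by omega)]
        have hq : ∀ m : ℕ, (1 : ℚ) - ((4 + m : ℕ) : ℚ) + ((4 + m).choose 2 : ℚ) -
            ((4 + m).choose 3 : ℚ) < 0 := by
          intro m
          induction m with
          | zero => norm_num [Nat.choose]
          | succ m ih =>
            have h2 : ((4 + (m + 1)).choose 2 : ℚ) = (4 + m : ℕ) + (4 + m).choose 2 := by
              rw [← add_assoc, Nat.choose_succ_succ' (4 + m) 1]; push_cast; simp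
            have h3 : ((4 + (m + 1)).choose 3 : ℚ) = (4 + m).choose 2 + (4 + m).choose 3 := by
              rw [← add_assoc, Nat.choose_succ_succ' (4 + m) 2]; push_cast; simp
            have hpos : (0 : ℚ) < ((4 + m).choose 3 : ℕ) := by
              exact_mod_cast Nat.choose_pos (by omega)
            rw [h2, h3]
            push_cast
            linarith
        simpa using hq m
      rw [hsum] at hlt
      linarith

/-- The derivative `1 - x + x²/2` is positive. -/
theorem fixStep_mono {x y : ℚ} (h0 : 0 ≤ x) (hxy : x ≤ y) (hy : y ≤ 1) :
    fixStep x ≤ fixStep y := by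
  unfold fixStep
  nlinarith [mul_nonneg (sub_nonneg.mpr hxy) (sub_nonneg.mpr hy),
    mul_nonneg (sub_nonneg.mpr hxy) h0, sq_nonneg (x + y), sq_nonneg x, sq_nonneg y,
    mul_nonneg (sub_nonneg.mpr hxy) (add_nonneg (sq_nonneg x) (sq_nonneg y)),
    mul_nonneg (sub_nonneg.mpr hxy) (mul_nonneg h0 (h0.trans hxy)),
    mul_nonneg (sub_nonneg.mpr hxy) (sub_nonneg.mpr (hxy.trans hy))]

/-- The gap is exactly `2 (m - 2) / (3 m³ (m + 1))`, which is why bounds of the form `2 / m` pass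
through the recursion. -/
theorem fixStep_two_div_lt {m : ℚ} (hm : 2 < m) : fixStep (2 / m) < 2 / (m + 1) := by
  unfold fixStep
  have h0 : 0 < m := by linarith
  rw [← sub_pos]
  have : 2 / (m + 1) - (2 / m - (2 / m) ^ 2 / 2 + (2 / m) ^ 3 / 6) =
      2 * (m - 2) / (3 * m ^ 3 * (m + 1)) := by
    field_simp
    ring
  rw [this]
  have : 0 < m - 2 := by linarith
  positivity

/-- Index `n` stands for the `(n + 1)`-fold wreath product, hence `n + 3` in place of `n + 2`. The
recursion starts at `x = 1`, where `fixStep 1 = 2/3`; from the second level on, strictness is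
automatic. -/
theorem one_sub_derangeProp_iterWreathHom {S : Type u} [Fintype S] [DecidableEq S]
    (hS : 2 ≤ Fintype.card S) (n : ℕ) :
    1 - derangeProp (iterWreathHom S n) ≤ 2 / ((n : ℚ) + 3) ∧
    ((Fintype.card S, n) ≠ (3, 0) →
      1 - derangeProp (iterWreathHom S n) < 2 / ((n : ℚ) + 3)) := by
  have : Nonempty S := Fintype.card_pos_iff.mp (by omega)
  induction n with
  | zero =>
    have h := one_sub_avg_le_fixStep (S := S) hS zero_le_one le_rfl
    have hid : derangeProp (iterWreathHom S 0) =
      (∑ h : Equiv.Perm S, (1 - 1 : ℚ) ^ (Finset.card {i | h i = i})) /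
        (Fintype.card S).factorial := by rw [sub_self]; exact derangeProp_id (S := S)
    have h23 : fixStep 1 = 2 / ((0 : ℕ) + 3 : ℚ) := by norm_num [fixStep]
    rw [← hid, h23] at h
    exact ⟨h.1, fun hne => h.2 rfl fun h3 => hne (by rw [h3])⟩
  | succ n ih =>
    have hw : derangeProp (iterWreathHom S (n + 1)) =
        (∑ h : Equiv.Perm S, (1 - (1 - derangeProp (iterWreathHom S n))) ^
          (Finset.card {i | h i = i})) / (Fintype.card S).factorial := by
      rw [sub_sub_cancel]
      exact derangeProp_wreathHom (iterWreathHom S n)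
    have h0 : 0 ≤ 1 - derangeProp (iterWreathHom S n) :=
      sub_nonneg.mpr (derangeProp_le_one _)
    have h := (one_sub_avg_le_fixStep (S := S) hS h0
      (by linarith [derangeProp_nonneg (iterWreathHom S n)])).1
    rw [← hw] at h
    have hn : (0 : ℚ) ≤ n := by positivity
    have hm := fixStep_mono h0 ih.1 (by rw [div_le_one (by linarith)]; linarith)
    have hlt := fixStep_two_div_lt (m := (n : ℚ) + 3) (by linarith)
    have : (2 : ℚ) / (((n + 1 : ℕ) : ℚ) + 3) = 2 / ((n : ℚ) + 3 + 1) := by push_cast; ring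
    rw [this]
    have := (h.trans hm).trans_lt hlt
    exact ⟨this.le, fun _ => this⟩

/-! ### Trees of preimages and sibling transpositions -/

/-- The parent of a vertex. -/
def TreeLevel.parent {S : Type u} : (n : ℕ) → TreeLevel S (n + 1) → TreeLevel S n
  | 0, u => u.1
  | n + 1, u => (u.1, TreeLevel.parent n u.2)

/-- The element `(g, h)` of the next iterated wreath product. -/
def iterWreathMk {S : Type u} (n : ℕ) (g : S → iterWreath (Equiv.Perm S) S (n + 1))
    (h : Equiv.Perm S) : iterWreath (Equiv.Perm S) S (n + 1 + 1) :=
  (⟨g, h⟩ : WreathProd _ _ _)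

theorem exists_eq_iterWreathMk {S : Type u} (n : ℕ)
    (w : iterWreath (Equiv.Perm S) S (n + 1 + 1)) : ∃ g h, w = iterWreathMk n g h :=
  ⟨SemidirectProduct.left w, SemidirectProduct.right w, rfl⟩

theorem iterWreathHom_mk {S : Type u} (n : ℕ) (g : S → iterWreath (Equiv.Perm S) S (n + 1))
    (h : Equiv.Perm S) (u : TreeLevel S (n + 1)) :
    iterWreathHom S (n + 1) (iterWreathMk n g h) u =
      (h u.1, iterWreathHom S n (g (h u.1)) u.2) :=
  wreathHom_apply S (iterWreathHom S n) ⟨g, h⟩ u.1 u.2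

theorem iterWreathHom_parent {S : Type u} : ∀ (n : ℕ)
    (w : iterWreath (Equiv.Perm S) S (n + 1 + 1)), ∃ w' : iterWreath (Equiv.Perm S) S (n + 1),
      ∀ u, iterWreathHom S n w' (TreeLevel.parent n u) =
        TreeLevel.parent n (iterWreathHom S (n + 1) w u)
  | 0, w => by
    obtain ⟨g, h, rfl⟩ := exists_eq_iterWreathMk 0 w
    exact ⟨h, fun u => by rw [iterWreathHom_mk]; rfl⟩
  | n + 1, w => by
    obtain ⟨g, h, rfl⟩ := exists_eq_iterWreathMk (n + 1) w
    choose g' hg using fun i => iterWreathHom_parent n (g i)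
    refine ⟨iterWreathMk n g' h, fun u => ?_⟩
    rw [iterWreathHom_mk, iterWreathHom_mk]
    exact congrArg (Prod.mk (h u.1)) (hg (h u.1) u.2)

section Labelling

variable {S : Type u} {T : Type v} {f : T → T} (e : ∀ x, S ≃ {y // f y = x})

/-- A labelling of the iterated preimages of `x` under a map all of whose fibres are labelled
by `S`. -/
def treeLabel : (n : ℕ) → T → TreeLevel S n → T
  | 0, x, i => e x i
  | n + 1, x, u => treeLabel n (e x u.1) u.2

theorem treeLabel_injective : ∀ (n : ℕ) (x : T), Function.Injective (treeLabel e n x) ∧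
    ∀ v, f^[n + 1] (treeLabel e n x v) = x
  | 0, x => ⟨fun _ _ h => (e x).injective (Subtype.ext h), fun v => (e x v).2⟩
  | n + 1, x => by
    have h2 (u : TreeLevel S (n + 1)) : f^[n + 1 + 1] (treeLabel e (n + 1) x u) = x := by
      rw [Function.iterate_succ_apply']
      exact (congrArg f ((treeLabel_injective n (e x u.1)).2 u.2)).trans (e x u.1).2
    refine ⟨?_, h2⟩
    rintro ⟨i, v⟩ ⟨j, w⟩ h
    change treeLabel e n (e x i) v = treeLabel e n (e x j) w at h
    have h1 := congrArg (f^[n + 1]) h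
    rw [(treeLabel_injective n _).2, (treeLabel_injective n _).2] at h1
    obtain rfl : i = j := (e x).injective (Subtype.ext h1)
    rw [(treeLabel_injective n _).1 h]

theorem exists_treeLabel_eq : ∀ (n : ℕ) (x y : T), f^[n + 1] y = x → ∃ v, treeLabel e n x v = y
  | 0, x, y, h => ⟨(e x).symm ⟨y, h⟩, by
      change ((e x ((e x).symm ⟨y, h⟩)) : T) = y
      simp⟩
  | n + 1, x, y, h => by
    have h1 : f (f^[n + 1] y) = x := by rwa [← Function.iterate_succ_apply' f]
    obtain ⟨v, hv⟩ := exists_treeLabel_eq n (f^[n + 1] y) y rfl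
    refine ⟨((e x).symm ⟨_, h1⟩, v), ?_⟩
    change treeLabel e n (e x ((e x).symm ⟨_, h1⟩)) v = y
    rw [Equiv.apply_symm_apply]
    exact hv

/-- The first coordinate of a vertex is the step nearest the root, so `f` forgets the last one. -/
theorem apply_treeLabel_succ : ∀ (n : ℕ) (x : T) (u : TreeLevel S (n + 1)),
    f (treeLabel e (n + 1) x u) = treeLabel e n x (TreeLevel.parent n u)
  | 0, x, (i, v) => (e (e x i) v).2
  | n + 1, x, (i, v) => apply_treeLabel_succ n (e x i) v

variable {G : Type*} [Group G] [MulAction G T]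

/-- A map commuting with `f` carries the tree above `x` to the tree above `g • x`. The base point
has to be allowed to move, because the induction applies this to the subtrees above the children of
`x`. -/
theorem exists_iterWreathHom_eq (hf : ∀ (g : G) y, f (g • y) = g • f y) (g : G) :
    ∀ (n : ℕ) (x : T), ∃ w : iterWreath (Equiv.Perm S) S (n + 1), ∀ v,
      g • treeLabel e n x v = treeLabel e n (g • x) (iterWreathHom S n w v) := by
  have h0 (x : T) : ∃ h : Equiv.Perm S, ∀ i, g • (e x i : T) = e (g • x) (h i) := by
    let E : {y // f y = x} ≃ {y // f y = g • x} :=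
      (MulAction.toPerm g).subtypeEquiv fun y => by
        rw [MulAction.toPerm_apply, hf, smul_left_cancel_iff]
    refine ⟨((e x).trans E).trans (e (g • x)).symm, fun i => ?_⟩
    simp [E]
  intro n
  induction n with
  | zero => exact h0
  | succ n ih =>
    intro x
    obtain ⟨h, hh⟩ := h0 x
    choose w hw using fun i => ih (e x i)
    -- The wreath action reads its coordinate at the image `h i`, hence the shift by `h⁻¹`.
    refine ⟨iterWreathMk n (fun i => w (h⁻¹ i)) h, fun u => ?_⟩
    rw [iterWreathHom_mk]
    change g • treeLabel e n (e x u.1) u.2 = treeLabel e n (e (g • x) (h u.1)) _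
    rw [hw, hh]
    simp

/-- The permutations of a level of the tree above `t` that are induced by the group `G`. -/
def levelStabilizer (G : Type*) [Group G] [MulAction G T] (n : ℕ) (t : T) :
    Subgroup (Equiv.Perm (TreeLevel S n)) where
  carrier := {π | ∃ g : G, ∀ v, g • treeLabel e n t v = treeLabel e n t (π v)}
  one_mem' := ⟨1, fun v => by simp⟩
  mul_mem' := by
    rintro a b ⟨g, hg⟩ ⟨h, hh⟩
    exact ⟨g * h, fun v => by rw [mul_smul, hh, hg]; rfl⟩
  inv_mem' := by
    rintro a ⟨g, hg⟩
    exact ⟨g⁻¹, fun v => by rw [inv_smul_eq_iff, hg]; simp⟩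

/-- If the sibling transpositions at all levels above `t` are induced by a group fixing `t`, then
this group induces the full iterated wreath product on every level. -/
theorem levelStabilizer_eq_range [Finite S] [DecidableEq T]
    (hf : ∀ (g : G) y, f (g • y) = g • f y) {t : T} (ht : ∀ g : G, g • t = t)
    (hswap : ∀ n a b, a ≠ b → f a = f b → f^[n + 1] a = t →
      ∃ g : G, ∀ y, f^[n + 1] y = t → g • y = Equiv.swap a b y) (n : ℕ) :
    levelStabilizer e G n t = (iterWreathHom S n).range := by
  classical
  have hle (m) : levelStabilizer e G m t ≤ (iterWreathHom S m).range := by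
    rintro π ⟨g, hg⟩
    obtain ⟨w, hw⟩ := exists_iterWreathHom_eq e hf g m t
    refine ⟨w, Equiv.ext fun v => (treeLabel_injective e m t).1 ?_⟩
    rw [← hg, hw, ht]
  -- Every permutation preserving the sibling classes is induced, since sibling transpositions
  -- generate them.
  have hsib (m) (π : Equiv.Perm (TreeLevel S m))
      (hπ : ∀ u, f (treeLabel e m t (π u)) = f (treeLabel e m t u)) :
      π ∈ levelStabilizer e G m t := by
    have hsw (u u') (huu : f (treeLabel e m t u) = f (treeLabel e m t u')) :
        Equiv.swap u u' ∈ levelStabilizer e G m t := by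
      by_cases hne : u = u'
      · rw [hne, Equiv.swap_self]; exact one_mem _
      · obtain ⟨g, hg⟩ := hswap m _ _ ((treeLabel_injective e m t).1.ne hne) huu
          ((treeLabel_injective e m t).2 u)
        refine ⟨g, fun v => ?_⟩
        rw [hg _ ((treeLabel_injective e m t).2 v),
          (treeLabel_injective e m t).1.swap_apply]
    let A : Set (Equiv.Perm (TreeLevel S m)) :=
      {σ | ∃ u u', u ≠ u' ∧ f (treeLabel e m t u) = f (treeLabel e m t u') ∧ σ = Equiv.swap u u'}
    have hA : ∀ σ ∈ A, σ.IsSwap := by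
      rintro σ ⟨u, u', hne, _, rfl⟩
      exact ⟨u, u', hne, rfl⟩
    have hcl : Subgroup.closure A ≤ levelStabilizer e G m t := by
      rw [Subgroup.closure_le]
      rintro σ ⟨u, u', _, h, rfl⟩
      exact hsw u u' h
    -- A group generated by transpositions contains each finitely supported permutation that keeps
    -- every point in its orbit.
    refine hcl ((mem_closure_isSwap hA).mpr ⟨Set.toFinite _, fun u => ?_⟩)
    by_cases hu : u = π u
    · rw [← hu]; exact MulAction.mem_orbit_self u
    · exact ⟨⟨Equiv.swap u (π u), Subgroup.subset_closure ⟨u, π u, hu, (hπ u).symm, rfl⟩⟩,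
        Equiv.swap_apply_left u (π u)⟩
  induction n with
  | zero =>
    refine le_antisymm (hle 0) fun π _ => hsib 0 π fun u => ?_
    exact ((treeLabel_injective e 0 t).2 _).trans ((treeLabel_injective e 0 t).2 u).symm
  | succ n ih =>
    refine le_antisymm (hle _) ?_
    rintro _ ⟨w, rfl⟩
    -- By induction some `g` acts like `w` on the previous level. If `γ` is the action of `g` on the
    -- present level, then `w γ⁻¹` preserves sibling classes.
    obtain ⟨w', hw'⟩ := iterWreathHom_parent n w
    obtain ⟨g, hg⟩ : iterWreathHom S n w' ∈ levelStabilizer e G n t := ih ▸ ⟨w', rfl⟩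
    obtain ⟨γ, hγ⟩ := exists_iterWreathHom_eq e hf g (n + 1) t
    have hγmem : iterWreathHom S (n + 1) γ ∈ levelStabilizer e G (n + 1) t :=
      ⟨g, fun v => by rw [hγ, ht]⟩
    have hγ' (u) : f (treeLabel e (n + 1) t (iterWreathHom S (n + 1) γ u)) =
        f (treeLabel e (n + 1) t (iterWreathHom S (n + 1) w u)) := by
      have h1 := hγ u
      rw [ht] at h1
      rw [← h1, hf, apply_treeLabel_succ e, hg, hw', ← apply_treeLabel_succ e]
    have key := hsib (n + 1) (iterWreathHom S (n + 1) w * (iterWreathHom S (n + 1) γ)⁻¹)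
      fun u => by
        rw [Equiv.Perm.mul_apply, ← hγ']; simp
    simpa using mul_mem key hγmem

end Labelling

/-! ### Exchange and extension for transcendence bases -/

open IntermediateField IntermediateField.algebraAdjoinAdjoin in
/-- Exchange: a finite family whose generated field contains an algebraically independent family
with the same index set is algebraically independent. -/
theorem AlgebraicIndependent.of_mem_adjoin {ι k Ω : Type*} [Finite ι] [Field k] [Field Ω]
    [Algebra k Ω] {x y : ι → Ω} (hx : AlgebraicIndependent k x)
    (h : ∀ i, x i ∈ adjoin k (Set.range y)) : AlgebraicIndependent k y := by
  let L := adjoin k (Set.range y)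
  let x' : ι → L := fun i => ⟨x i, h i⟩
  let y' : ι → L := fun i => ⟨y i, subset_adjoin k _ ⟨i, rfl⟩⟩
  have hx' : AlgebraicIndependent k x' := AlgebraicIndependent.of_comp L.val hx
  have htop : adjoin k (Set.range y') = ⊤ := by
    have hr : Set.range y = L.val '' Set.range y' := by rw [← Set.range_comp]; rfl
    apply map_injective L.val
    rw [adjoin_map, ← hr, ← AlgHom.fieldRange_eq_map, fieldRange_val]
  have halg : Algebra.IsAlgebraic (Algebra.adjoin k (Set.range y')) L := by
    refine ⟨fun z => ?_⟩
    have hz : z ∈ adjoin k (Set.range y') := htop ▸ mem_top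
    exact (Algebra.IsAlgebraic.isAlgebraic (R := Algebra.adjoin k (Set.range y'))
      (⟨z, hz⟩ : adjoin k (Set.range y'))).algebraMap (A := L)
  -- The family `x'` bounds the transcendence degree below by the size of the index set, and `L` is
  -- algebraic over what `y'` generates, so a finite `y'` has no room for a relation.
  have hy' := Algebra.IsAlgebraic.isTranscendenceBasis_of_lift_le_trdeg_of_finite k y'
    (hx'.lift_cardinalMk_le_trdeg)
  exact hy'.1.map' (f := L.val) L.val.injective

/-- `Ω` is an algebraic closure over the polynomial ring on either basis, so uniqueness of algebraic
closures extends the isomorphism matching the variables. -/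
theorem IsTranscendenceBasis.exists_algEquiv {ι k Ω : Type*} [Field k] [Field Ω] [Algebra k Ω]
    [IsAlgClosed Ω] {x y : ι → Ω} (hx : IsTranscendenceBasis k x)
    (hy : IsTranscendenceBasis k y) : ∃ Φ : Ω ≃ₐ[k] Ω, ∀ i, Φ (x i) = y i := by
  let := IsAlgClosed.isAlgClosure_of_transcendence_basis x hx
  let := IsAlgClosed.isAlgClosure_of_transcendence_basis y hy
  let e : Algebra.adjoin k (Set.range x) ≃ₐ[k] Algebra.adjoin k (Set.range y) :=
    hx.1.aevalEquiv.symm.trans hy.1.aevalEquiv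
  let Φ := IsAlgClosure.equivOfEquiv Ω Ω e.toRingEquiv
  have hΦ (z) : Φ (algebraMap _ Ω z) = algebraMap _ Ω (e z) :=
    IsAlgClosure.equivOfEquiv_algebraMap Ω Ω e.toRingEquiv z
  refine ⟨AlgEquiv.ofRingEquiv (f := Φ) fun c => ?_, fun i => ?_⟩
  · have := hΦ (algebraMap k _ c)
    rwa [AlgEquiv.commutes, ← IsScalarTower.algebraMap_apply,
      ← IsScalarTower.algebraMap_apply] at this
  · have := hΦ (hx.1.aevalEquiv (MvPolynomial.X i))
    simpa [e] using this

theorem AlgebraicIndependent.isTranscendenceBasis_of_finite {ι k Ω : Type*} [Finite ι] [Field k]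
    [Field Ω] [Algebra k Ω] {x y : ι → Ω} (hx : IsTranscendenceBasis k x)
    (hy : AlgebraicIndependent k y) : IsTranscendenceBasis k y := by
  have h := hx.lift_cardinalMk_eq_trdeg
  refine hy.isTranscendenceBasis_of_lift_trdeg_le ?_ h.ge
  have := Cardinal.mk_lt_aleph0_iff.mpr ‹Finite ι›
  rw [← Cardinal.lift_lt_aleph0, ← h, Cardinal.lift_lt_aleph0]
  exact this

/-! ### Fibres of a separable rational function over transcendental points -/

open Polynomial

/-- The fraction `P / Q` is a separable rational function of degree `d` without a pole of order
at least `d` at infinity. -/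
structure IsRatMap {K : Type*} [Field K] (P Q : K[X]) (d : ℕ) : Prop where
  pos : 0 < d
  natDegree_num : P.natDegree = d
  natDegree_den : Q.natDegree ≤ d
  isCoprime : IsCoprime P Q
  wronskian_ne_zero : derivative P * Q - P * derivative Q ≠ 0

section Fibre

variable {K Ω : Type*} [Field K] [Field Ω] [Algebra K Ω] {P Q : K[X]} {d : ℕ}

/-- The polynomial `P - w Q`, whose roots are the preimages of `w` under `P / Q`. -/
noncomputable def fibrePoly (P Q : K[X]) (w : Ω) : Polynomial Ω :=
  P.map (algebraMap K Ω) - C w * Q.map (algebraMap K Ω)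

theorem eval_fibrePoly (P Q : K[X]) (w y : Ω) :
    (fibrePoly P Q w).eval y = aeval y P - w * aeval y Q := by
  simp [fibrePoly]

theorem eval_derivative_fibrePoly (P Q : K[X]) (w y : Ω) :
    (derivative (fibrePoly P Q w)).eval y =
      aeval y (derivative P) - w * aeval y (derivative Q) := by
  simp [fibrePoly, derivative_map]

theorem isAlgebraic_aeval {y : Ω} (hy : IsAlgebraic K y) (P : K[X]) :
    IsAlgebraic K (aeval y P) := by
  rw [isAlgebraic_iff_isIntegral] at *
  exact IsIntegral.of_mem_of_fg _ hy.fg_adjoin_singleton _ (aeval_mem_adjoin_singleton K y)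

namespace IsRatMap

theorem den_ne_zero (h : IsRatMap P Q d) : Q ≠ 0 := by
  rintro rfl
  exact h.wronskian_ne_zero (by simp)

theorem aeval_den_ne_zero (h : IsRatMap P Q d) {y w : Ω}
    (hy : aeval y P = w * aeval y Q) : aeval y Q ≠ 0 := by
  intro h0
  obtain ⟨a, b, hab⟩ := h.isCoprime
  have := congrArg (aeval y) hab
  rw [h0, mul_zero] at hy
  simp [hy, h0] at this

theorem transcendental_of_eq (h : IsRatMap P Q d) {y w : Ω} (hw : Transcendental K w)
    (hy : aeval y P = w * aeval y Q) : Transcendental K y := by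
  intro hy'
  refine hw ?_
  rw [← div_eq_iff (h.aeval_den_ne_zero hy)] at hy
  rw [← hy, div_eq_mul_inv]
  exact (isAlgebraic_aeval hy' P).mul (isAlgebraic_aeval hy' Q).inv

/-- If the value `w` were algebraic, `y` would be a root of `P - w Q` over the algebraic closure of
`K` in `Ω`. That polynomial is nonzero, because `P = w Q` with constant `w` kills the Wronskian. -/
theorem transcendental_div (h : IsRatMap P Q d) {y : Ω} (hy : Transcendental K y) :
    Transcendental K (aeval y P / aeval y Q) := by
  intro hw
  set w := aeval y P / aeval y Q with hwdef
  have hQ : aeval y Q ≠ 0 := fun h0 => h.den_ne_zero ((transcendental_iff.mp hy) Q h0)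
  let A := algebraicClosure K Ω
  let w' : A := ⟨w, mem_algebraicClosure_iff.mpr hw⟩
  let g : A[X] := P.map (algebraMap K A) - C w' * Q.map (algebraMap K A)
  have hg : aeval y g = 0 := by
    have hw'' : algebraMap A Ω w' = w := rfl
    simp only [g, map_sub, map_mul, aeval_map_algebraMap, aeval_C, hw'']
    rw [hwdef, div_mul_cancel₀ _ hQ, sub_self]
  have hg0 : g ≠ 0 := by
    intro hg0
    have h1 : P.map (algebraMap K A) = C w' * Q.map (algebraMap K A) := sub_eq_zero.mp hg0
    have h2 := congrArg derivative h1
    rw [derivative_C_mul, derivative_map, derivative_map] at h2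
    apply h.wronskian_ne_zero
    apply Polynomial.map_injective (algebraMap K A) (algebraMap K A).injective
    rw [Polynomial.map_sub, Polynomial.map_mul, Polynomial.map_mul, h1, h2, Polynomial.map_zero]
    ring
  have : IsAlgebraic A y := ⟨g, hg0, hg⟩
  exact hy (this.restrictScalars K)

/-- A double root `y` of `P - w Q` would be a root of the Wronskian, which has coefficients in `K`,
whereas `y` is transcendental. -/
theorem eval_derivative_ne_zero (h : IsRatMap P Q d) {y w : Ω} (hw : Transcendental K w)
    (hy : aeval y P = w * aeval y Q) :
    aeval y (derivative P) ≠ w * aeval y (derivative Q) := by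
  intro hd
  have hyt := h.transcendental_of_eq hw hy
  refine h.wronskian_ne_zero ((transcendental_iff.mp hyt) _ ?_)
  simp only [map_sub, map_mul, hd, hy]
  ring

/-- The coefficient of degree `d` could vanish only if `w` were a quotient of elements of `K`. -/
theorem natDegree_fibrePoly (h : IsRatMap P Q d) {w : Ω} (hw : Transcendental K w) :
    (fibrePoly P Q w).natDegree = d := by
  refine natDegree_eq_of_le_of_coeff_ne_zero ?_ ?_
  · refine (natDegree_sub_le _ _).trans (max_le ?_ ?_)
    · exact natDegree_map_le.trans h.natDegree_num.le
    · exact (natDegree_C_mul_le _ _).trans (natDegree_map_le.trans h.natDegree_den)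
  · have hp : P.coeff d ≠ 0 := by
      rw [← h.natDegree_num]
      exact leadingCoeff_ne_zero.mpr fun h0 => by
        have := h.natDegree_num
        rw [h0, natDegree_zero] at this
        exact h.pos.ne this
    simp only [fibrePoly, coeff_sub, coeff_map, coeff_C_mul]
    intro h0
    by_cases hq : Q.coeff d = 0
    · simp [hq, hp] at h0
    · refine hw ?_
      have hq' : algebraMap K Ω (Q.coeff d) ≠ 0 := by simpa using hq
      rw [eq_div_of_mul_eq hq' (sub_eq_zero.mp h0).symm, ← map_div₀]
      exact isAlgebraic_algebraMap _

theorem nodup_roots_fibrePoly (h : IsRatMap P Q d) {w : Ω} (hw : Transcendental K w) :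
    (fibrePoly P Q w).roots.Nodup := by
  classical
  rw [Multiset.nodup_iff_count_le_one]
  intro y
  rw [count_roots]
  by_contra! hlt
  have h0 : fibrePoly P Q w ≠ 0 := fun h0 => by
    have := h.natDegree_fibrePoly hw
    rw [h0, natDegree_zero] at this
    exact h.pos.ne this
  obtain ⟨h1, h2⟩ := (one_lt_rootMultiplicity_iff_isRoot h0).mp hlt
  rw [IsRoot.def, eval_fibrePoly, sub_eq_zero] at h1
  rw [IsRoot.def, eval_derivative_fibrePoly, sub_eq_zero] at h2
  exact h.eval_derivative_ne_zero hw h1 h2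

theorem mem_roots_fibrePoly (h : IsRatMap P Q d) {w : Ω} (hw : Transcendental K w) {y : Ω} :
    y ∈ (fibrePoly P Q w).roots ↔ aeval y P = w * aeval y Q := by
  have h0 : fibrePoly P Q w ≠ 0 := fun h0 => by
    have := h.natDegree_fibrePoly hw
    rw [h0, natDegree_zero] at this
    exact h.pos.ne this
  rw [mem_roots h0, IsRoot.def, eval_fibrePoly, sub_eq_zero]

/-- The preimages of a transcendental point. -/
noncomputable def fibre [DecidableEq Ω] (P Q : K[X]) (w : Ω) : Finset Ω :=
  (fibrePoly P Q w).roots.toFinset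

theorem mem_fibre [DecidableEq Ω] (h : IsRatMap P Q d) {w : Ω} (hw : Transcendental K w) {y : Ω} :
    y ∈ fibre P Q w ↔ aeval y P = w * aeval y Q := by
  rw [fibre, Multiset.mem_toFinset, h.mem_roots_fibrePoly hw]

theorem card_fibre [DecidableEq Ω] [IsAlgClosed Ω] (h : IsRatMap P Q d) {w : Ω}
    (hw : Transcendental K w) : (fibre P Q w).card = d := by
  rw [fibre, Multiset.toFinset_card_of_nodup (h.nodup_roots_fibrePoly hw),
    ← (IsAlgClosed.splits (fibrePoly P Q w)).natDegree_eq_card_roots, h.natDegree_fibrePoly hw]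

end IsRatMap

end Fibre

/-- The elements of `Ω` that are transcendental over `K`. -/
abbrev TransPt (K Ω : Type*) [Field K] [Field Ω] [Algebra K Ω] := {y : Ω // Transcendental K y}

namespace IsRatMap

variable {K Ω : Type*} [Field K] [Field Ω] [Algebra K Ω] {P Q : K[X]} {d : ℕ}

/-- The map `P / Q` on transcendental elements. -/
noncomputable def toFun (h : IsRatMap P Q d) (y : TransPt K Ω) : TransPt K Ω :=
  ⟨aeval y.1 P / aeval y.1 Q, h.transcendental_div y.2⟩

theorem toFun_eq_iff (h : IsRatMap P Q d) (y w : TransPt K Ω) :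
    h.toFun y = w ↔ aeval y.1 P = w.1 * aeval y.1 Q := by
  have hQ : aeval y.1 Q ≠ 0 := fun h0 => h.den_ne_zero ((transcendental_iff.mp y.2) Q h0)
  rw [Subtype.ext_iff, toFun, div_eq_iff hQ]

theorem nonempty_fibre_equiv [IsAlgClosed Ω] (h : IsRatMap P Q d) (w : TransPt K Ω) :
    Nonempty (Fin d ≃ {y // h.toFun y = w}) := by
  classical
  let e : {y // h.toFun y = w} ≃ fibre P Q w.1 :=
    { toFun := fun y => ⟨y.1.1, (h.mem_fibre w.2).mpr ((h.toFun_eq_iff _ _).mp y.2)⟩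
      invFun := fun y => ⟨⟨y.1, h.transcendental_of_eq w.2 ((h.mem_fibre w.2).mp y.2)⟩,
        (h.toFun_eq_iff _ _).mpr ((h.mem_fibre w.2).mp y.2)⟩
      left_inv := fun y => rfl
      right_inv := fun y => rfl }
  exact ⟨(Finset.equivFinOfCardEq (h.card_fibre w.2)).symm.trans e.symm⟩

instance {F : Type*} [Field F] [Algebra F Ω] [Algebra K F] [IsScalarTower K F Ω] :
    MulAction (Ω ≃ₐ[F] Ω) (TransPt K Ω) where
  smul g y := ⟨g y.1, fun hy => y.2 (by
    have := hy.algHom ((g.symm : Ω →ₐ[F] Ω).restrictScalars K)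
    simpa using this)⟩
  one_smul _ := rfl
  mul_smul _ _ _ := rfl

theorem coe_smul {F : Type*} [Field F] [Algebra F Ω] [Algebra K F] [IsScalarTower K F Ω]
    (g : Ω ≃ₐ[F] Ω) (y : TransPt K Ω) : (g • y).1 = g y.1 := rfl

theorem toFun_smul {F : Type*} [Field F] [Algebra F Ω] [Algebra K F] [IsScalarTower K F Ω]
    (h : IsRatMap P Q d) (g : Ω ≃ₐ[F] Ω) (y : TransPt K Ω) :
    h.toFun (g • y) = g • h.toFun y := by
  apply Subtype.ext
  have (R : K[X]) : aeval (g y.1) R = g (aeval y.1 R) :=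
    aeval_algHom_apply ((g : Ω →ₐ[F] Ω).restrictScalars K) y.1 R
  simp [toFun, coe_smul, this]

end IsRatMap

/-! ### Generic maps: all sibling pairs are alike -/

/-- `P / Q` is generic in its two lowest coefficients: `P = c₀ + c₁ X + ⋯`, all other coefficients
of `P` and `Q` are polynomials in the remaining members of the family `c` of independent
transcendentals generating `K`. -/
structure IsGenericMap (k : Type*) {K σ : Type*} [Field k] [Field K] [Algebra k K]
    (P Q : K[X]) (c : σ → K) (i₀ i₁ : σ) : Prop where
  ne : i₀ ≠ i₁
  isTranscendenceBasis : IsTranscendenceBasis k c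
  adjoin_eq_top : IntermediateField.adjoin k (Set.range c) = ⊤
  coeff_num : ∀ n, (P - C (c i₁) * X - C (c i₀)).coeff n ∈ Algebra.adjoin k (c '' {i₀, i₁}ᶜ)
  coeff_den : ∀ n, Q.coeff n ∈ Algebra.adjoin k (c '' {i₀, i₁}ᶜ)

section

variable {k K Ω : Type*} [Field k] [Field K] [Field Ω] [Algebra k K] [Algebra K Ω] [Algebra k Ω]
  [IsScalarTower k K Ω]

theorem algebraMap_mem_adjoin {s : Set K} {L : IntermediateField k Ω}
    (hs : ∀ z ∈ s, algebraMap K Ω z ∈ L) {z : K} (hz : z ∈ IntermediateField.adjoin k s) :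
    algebraMap K Ω z ∈ L := by
  induction hz using IntermediateField.adjoin_induction with
  | mem x hx => exact hs x hx
  | algebraMap x => rw [← IsScalarTower.algebraMap_apply]; exact L.algebraMap_mem x
  | add x y _ _ hx hy => rw [map_add]; exact add_mem hx hy
  | inv x _ hx => rw [map_inv₀]; exact inv_mem hx
  | mul x y _ _ hx hy => rw [map_mul]; exact mul_mem hx hy

omit [Algebra k K] [IsScalarTower k K Ω] in
theorem aeval_mem_of_coeff {R : K[X]} {L : IntermediateField k Ω}
    (hR : ∀ n, algebraMap K Ω (R.coeff n) ∈ L) {a : Ω} (ha : a ∈ L) : aeval a R ∈ L := by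
  rw [aeval_eq_sum_range]
  refine sum_mem fun i _ => ?_
  rw [Algebra.smul_def]
  exact mul_mem (hR i) (pow_mem ha i)

omit [Algebra k K] [IsScalarTower k K Ω] in
theorem map_aeval_of_coeff {R : K[X]} (Φ : Ω ≃ₐ[k] Ω)
    (hR : ∀ n, Φ (algebraMap K Ω (R.coeff n)) = algebraMap K Ω (R.coeff n)) (a : Ω) :
    Φ (aeval a R) = aeval (Φ a) R := by
  rw [aeval_eq_sum_range, aeval_eq_sum_range, map_sum]
  refine Finset.sum_congr rfl fun i _ => ?_
  rw [Algebra.smul_def, Algebra.smul_def, map_mul, hR, map_pow]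

theorem algEquiv_algebraMap_eq_of_mem_adjoin (Φ : Ω ≃ₐ[k] Ω) {s : Set K}
    (hs : ∀ z ∈ s, Φ (algebraMap K Ω z) = algebraMap K Ω z) {z : K}
    (hz : z ∈ IntermediateField.adjoin k s) : Φ (algebraMap K Ω z) = algebraMap K Ω z := by
  induction hz using IntermediateField.adjoin_induction with
  | mem x hx => exact hs x hx
  | algebraMap x => rw [← IsScalarTower.algebraMap_apply, Φ.commutes]
  | add x y _ _ hx hy => rw [map_add, map_add, hx, hy]
  | inv x _ hx => rw [map_inv₀, map_inv₀, hx]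
  | mul x y _ _ hx hy => rw [map_mul, map_mul, hx, hy]

end

namespace IsGenericMap

variable {k K Ω σ : Type*} [Field k] [Field K] [Field Ω] [Algebra k K] [Algebra K Ω] [Algebra k Ω]
  [IsScalarTower k K Ω] {P Q : K[X]} {c : σ → K} {i₀ i₁ : σ} {d : ℕ}

/-- The part of the numerator not involving the two lowest coefficients. -/
noncomputable def rest (P : K[X]) (c : σ → K) (i₀ i₁ : σ) : K[X] :=
  P - C (c i₁) * X - C (c i₀)

theorem aeval_num (P : K[X]) (c : σ → K) (i₀ i₁ : σ) (a : Ω) :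
    aeval a P = aeval a (rest P c i₀ i₁) + algebraMap K Ω (c i₁) * a +
      algebraMap K Ω (c i₀) := by
  simp only [rest, map_sub, map_mul, aeval_C, aeval_X]
  ring

open Classical in
/-- The family in which the two lowest coefficients are replaced by two points `a`, `b` and the
base point by `w`. -/
noncomputable def exchange (Ω : Type*) [Field Ω] [Algebra K Ω] (c : σ → K) (i₀ i₁ : σ)
    (w a b : Ω) : Unit ⊕ σ → Ω :=
  Sum.elim (fun _ => w) fun i => if i = i₀ then a else if i = i₁ then b else algebraMap K Ω (c i)

/-- The equations at `a` and `b` solve linearly for `c i₁` (dividing by `a - b`) and then for `c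
i₀`. So the new family generates `K`, and with `w` also `t`; the exchange lemma applies as the index
sets agree. -/
theorem isTranscendenceBasis_exchange [Finite σ] (hg : IsGenericMap k P Q c i₀ i₁) {t : Ω}
    (ht : IsTranscendenceBasis K fun _ : Unit => t) {w a b : Ω} (hab : a ≠ b)
    (ha : aeval a P = w * aeval a Q) (hb : aeval b P = w * aeval b Q)
    (hw : ∀ L : IntermediateField k Ω, (∀ z, algebraMap K Ω z ∈ L) → w ∈ L → t ∈ L) :
    IsTranscendenceBasis k (exchange Ω c i₀ i₁ w a b) := by
  classical
  have hx := hg.isTranscendenceBasis.sumElim_comp ht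
  refine AlgebraicIndependent.isTranscendenceBasis_of_finite hx (hx.1.of_mem_adjoin ?_)
  set L := IntermediateField.adjoin k (Set.range (exchange Ω c i₀ i₁ w a b)) with hL
  have hmem (j) : exchange Ω c i₀ i₁ w a b j ∈ L := IntermediateField.subset_adjoin k _ ⟨j, rfl⟩
  have hwL : w ∈ L := hmem (Sum.inl ())
  have haL : a ∈ L := by simpa [exchange] using hmem (Sum.inr i₀)
  have hbL : b ∈ L := by simpa [exchange, hg.ne.symm] using hmem (Sum.inr i₁)
  have hcL (i) (h0 : i ≠ i₀) (h1 : i ≠ i₁) : algebraMap K Ω (c i) ∈ L := by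
    simpa [exchange, h0, h1] using hmem (Sum.inr i)
  have hs : ∀ z ∈ c '' {i₀, i₁}ᶜ, algebraMap K Ω z ∈ L := by
    rintro _ ⟨i, hi, rfl⟩
    simp only [Set.mem_compl_iff, Set.mem_insert_iff, Set.mem_singleton_iff, not_or] at hi
    exact hcL i hi.1 hi.2
  have hR (R : K[X]) (hR : ∀ n, R.coeff n ∈ Algebra.adjoin k (c '' {i₀, i₁}ᶜ)) {x : Ω}
      (hx : x ∈ L) : aeval x R ∈ L :=
    aeval_mem_of_coeff (fun n => algebraMap_mem_adjoin hs
      (IntermediateField.algebra_adjoin_le_adjoin k _ (hR n))) hx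
  have hRa := hR _ hg.coeff_num haL
  have hRb := hR _ hg.coeff_num hbL
  have hQa := hR _ hg.coeff_den haL
  have hQb := hR _ hg.coeff_den hbL
  rw [aeval_num P c i₀ i₁] at ha hb
  rw [← rest] at hRa hRb
  have hne : a - b ≠ 0 := sub_ne_zero.mpr hab
  have h1 : algebraMap K Ω (c i₁) ∈ L := by
    have : algebraMap K Ω (c i₁) = ((w * aeval a Q - aeval a (rest P c i₀ i₁)) -
        (w * aeval b Q - aeval b (rest P c i₀ i₁))) / (a - b) := by
      rw [eq_div_iff hne]; linear_combination ha - hb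
    rw [this]
    exact div_mem (sub_mem (sub_mem (mul_mem hwL hQa) hRa) (sub_mem (mul_mem hwL hQb) hRb))
      (sub_mem haL hbL)
  have h0 : algebraMap K Ω (c i₀) ∈ L := by
    have : algebraMap K Ω (c i₀) = w * aeval a Q - aeval a (rest P c i₀ i₁) -
        algebraMap K Ω (c i₁) * a := by linear_combination ha
    rw [this]
    exact sub_mem (sub_mem (mul_mem hwL hQa) hRa) (mul_mem h1 haL)
  have hc (i) : algebraMap K Ω (c i) ∈ L := by
    by_cases hi0 : i = i₀
    · rwa [hi0]
    by_cases hi1 : i = i₁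
    · rwa [hi1]
    exact hcL i hi0 hi1
  rintro (_ | i)
  · refine hw L (fun z => algebraMap_mem_adjoin (s := Set.range c) ?_ ?_) hwL
    · rintro _ ⟨i, rfl⟩; exact hc i
    · rw [hg.adjoin_eq_top]; trivial
  · exact hc i

/-- The automorphism matching the two transcendence bases fixes the other coefficients by
construction. It also fixes `c i₀` and `c i₁`, since their images solve the same linear system at
`a'`, `b'`, `w'`; hence it is the identity on `K`. -/
theorem exists_algEquiv [Finite σ] [IsAlgClosed Ω] (hg : IsGenericMap k P Q c i₀ i₁) {t : Ω}
    (ht : IsTranscendenceBasis K fun _ : Unit => t) {w a b w' a' b' : Ω} (hab : a ≠ b)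
    (ha : aeval a P = w * aeval a Q) (hb : aeval b P = w * aeval b Q)
    (hw : ∀ L : IntermediateField k Ω, (∀ z, algebraMap K Ω z ∈ L) → w ∈ L → t ∈ L)
    (hab' : a' ≠ b')
    (ha' : aeval a' P = w' * aeval a' Q) (hb' : aeval b' P = w' * aeval b' Q)
    (hw' : ∀ L : IntermediateField k Ω, (∀ z, algebraMap K Ω z ∈ L) → w' ∈ L → t ∈ L) :
    ∃ Φ : Ω ≃ₐ[K] Ω, Φ a = a' ∧ Φ b = b' ∧ Φ w = w' := by
  classical
  obtain ⟨Φ, hΦ⟩ := (hg.isTranscendenceBasis_exchange ht hab ha hb hw).exists_algEquiv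
    (hg.isTranscendenceBasis_exchange ht hab' ha' hb' hw')
  have hΦw : Φ w = w' := hΦ (Sum.inl ())
  have hΦa : Φ a = a' := by simpa [exchange] using hΦ (Sum.inr i₀)
  have hΦb : Φ b = b' := by simpa [exchange, hg.ne.symm] using hΦ (Sum.inr i₁)
  have hs : ∀ z ∈ c '' {i₀, i₁}ᶜ, Φ (algebraMap K Ω z) = algebraMap K Ω z := by
    rintro _ ⟨i, hi, rfl⟩
    simp only [Set.mem_compl_iff, Set.mem_insert_iff, Set.mem_singleton_iff, not_or] at hi
    simpa [exchange, hi.1, hi.2] using hΦ (Sum.inr i)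
  have hR (R : K[X]) (hR : ∀ n, R.coeff n ∈ Algebra.adjoin k (c '' {i₀, i₁}ᶜ)) (x : Ω) :
      Φ (aeval x R) = aeval (Φ x) R :=
    map_aeval_of_coeff Φ (fun n => algEquiv_algebraMap_eq_of_mem_adjoin Φ hs
      (IntermediateField.algebra_adjoin_le_adjoin k _ (hR n))) x
  have hRa := hR (rest P c i₀ i₁) hg.coeff_num a
  have hRb := hR (rest P c i₀ i₁) hg.coeff_num b
  have hQa := hR _ hg.coeff_den a
  have hQb := hR _ hg.coeff_den b
  have hne : a' - b' ≠ 0 := sub_ne_zero.mpr hab'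
  rw [aeval_num P c i₀ i₁] at ha hb ha' hb'
  have ha2 := congrArg Φ ha
  have hb2 := congrArg Φ hb
  simp only [map_add, map_mul, hRa, hRb, hQa, hQb, hΦa, hΦb, hΦw] at ha2 hb2
  have h1 : Φ (algebraMap K Ω (c i₁)) = algebraMap K Ω (c i₁) := by
    refine mul_right_cancel₀ hne ?_
    linear_combination ha2 - hb2 - ha' + hb'
  have h0 : Φ (algebraMap K Ω (c i₀)) = algebraMap K Ω (c i₀) := by
    rw [h1] at ha2
    linear_combination ha2 - ha'
  have hK (z : K) : Φ (algebraMap K Ω z) = algebraMap K Ω z := by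
    refine algEquiv_algebraMap_eq_of_mem_adjoin Φ (s := Set.range c) ?_ ?_
    · rintro _ ⟨i, rfl⟩
      by_cases hi0 : i = i₀
      · rwa [hi0]
      by_cases hi1 : i = i₁
      · rwa [hi1]
      refine hs _ ⟨i, ?_, rfl⟩
      simp [hi0, hi1]
    · rw [hg.adjoin_eq_top]; trivial
  exact ⟨AlgEquiv.ofRingEquiv (f := Φ.toRingEquiv) hK, hΦa, hΦb, hΦw⟩

/-- At a common root `a`, the equation `P(a) = 0` expresses `c i₀` through `a` and the other
coefficients. Exchange then makes `a` transcendental over those, although it is a root of `Q`, whose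
coefficients do not involve `c i₀`. -/
theorem isCoprime [Finite σ] (hg : IsGenericMap k P Q c i₀ i₁) (hQ : Q ≠ 0) : IsCoprime P Q := by
  classical
  let Ω := AlgebraicClosure K
  by_contra hcop
  obtain ⟨a, haP, haQ⟩ : ∃ a : Ω, aeval a P = 0 ∧ aeval a Q = 0 := by
    by_contra! hno
    exact hcop ((Polynomial.isCoprime_iff_aeval_ne_zero_of_isAlgClosed K Ω P Q).mpr fun a => by
      by_cases h : aeval a P = 0
      · exact Or.inr (hno a h)
      · exact Or.inl h)
  let y : σ → Ω := fun i => if i = i₀ then a else algebraMap K Ω (c i)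
  have hx : AlgebraicIndependent k (algebraMap K Ω ∘ c) :=
    hg.isTranscendenceBasis.1.map' (f := IsScalarTower.toAlgHom k K Ω) (algebraMap K Ω).injective
  have hy : AlgebraicIndependent k y := by
    refine hx.of_mem_adjoin ?_
    set L := IntermediateField.adjoin k (Set.range y)
    have hmem (j) : y j ∈ L := IntermediateField.subset_adjoin k _ ⟨j, rfl⟩
    have haL : a ∈ L := by simpa [y] using hmem i₀
    have hcL (i) (h0 : i ≠ i₀) : algebraMap K Ω (c i) ∈ L := by
      simpa [y, h0] using hmem i
    intro i
    by_cases hi : i = i₀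
    · have hr : aeval a (rest P c i₀ i₁) ∈ L := by
        refine aeval_mem_of_coeff (fun n => algebraMap_mem_adjoin (s := c '' {i₀, i₁}ᶜ) ?_
          (IntermediateField.algebra_adjoin_le_adjoin k _ (hg.coeff_num n))) haL
        rintro _ ⟨i, hi, rfl⟩
        exact hcL i fun h => hi (by simp [h])
      rw [aeval_num P c i₀ i₁] at haP
      have : algebraMap K Ω (c i₀) = -(aeval a (rest P c i₀ i₁) + algebraMap K Ω (c i₁) * a) := by
        linear_combination haP
      rw [Function.comp_apply, hi, this]
      exact neg_mem (add_mem hr (mul_mem (hcL i₁ hg.ne.symm) haL))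
    · exact hcL i hi
  have htr := hy.transcendental_adjoin (s := {i₀}ᶜ) (i := i₀) (by simp)
  have hya : y i₀ = a := by simp [y]
  rw [hya] at htr
  let A := Algebra.adjoin k (y '' {i₀}ᶜ)
  have hlift : Q.map (algebraMap K Ω) ∈ Polynomial.lifts (algebraMap A Ω) := by
    rw [Polynomial.lifts_iff_coeff_lifts]
    intro n
    rw [coeff_map]
    have h1 : algebraMap K Ω (Q.coeff n) ∈ A := by
      have h2 : algebraMap K Ω (Q.coeff n) ∈
          (Algebra.adjoin k (c '' {i₀, i₁}ᶜ)).map (IsScalarTower.toAlgHom k K Ω) :=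
        ⟨_, hg.coeff_den n, rfl⟩
      rw [AlgHom.map_adjoin] at h2
      refine Algebra.adjoin_mono ?_ h2
      rintro _ ⟨_, ⟨i, hi, rfl⟩, rfl⟩
      have hi0 : i ≠ i₀ := fun h => hi (by simp [h])
      exact ⟨i, hi0, by simp [y, hi0]⟩
    exact ⟨⟨_, h1⟩, rfl⟩
  obtain ⟨q, hq⟩ := (Polynomial.mem_lifts _).mp hlift
  refine htr ⟨q, ?_, ?_⟩
  · rintro rfl
    rw [Polynomial.map_zero] at hq
    exact hQ ((Polynomial.map_eq_zero _).mp hq.symm)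
  · rw [← eval_map_algebraMap, hq, eval_map_algebraMap, haQ]

end IsGenericMap

/-! ### Separability and the Galois group of the splitting field -/

namespace IsRatMap

variable {K F Ω : Type*} [Field K] [Field F] [Field Ω] [Algebra K Ω] [Algebra F Ω] [Algebra K F]
  [IsScalarTower K F Ω] [IsAlgClosed Ω] {P Q : K[X]} {d : ℕ}

theorem separable_fibrePoly (h : IsRatMap P Q d) {w : Ω} (hw : Transcendental K w) :
    (fibrePoly P Q w).Separable := by
  have h0 : fibrePoly P Q w ≠ 0 := fun h0 => by
    have := h.natDegree_fibrePoly hw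
    rw [h0, natDegree_zero] at this
    exact h.pos.ne this
  exact (nodup_roots_iff_of_splits h0 (IsAlgClosed.splits _)).mp (h.nodup_roots_fibrePoly hw)

/-- A point is separable over every field containing its image. -/
theorem isSeparable_of_mem_range (h : IsRatMap P Q d) {y w : TransPt K Ω}
    (hyw : h.toFun y = w) {w₀ : F} (hw : algebraMap F Ω w₀ = w) : IsSeparable F y.1 := by
  let g : F[X] := P.map (algebraMap K F) - C w₀ * Q.map (algebraMap K F)
  have hg : g.map (algebraMap F Ω) = fibrePoly P Q w.1 := by
    simp [g, fibrePoly, Polynomial.map_map, ← IsScalarTower.algebraMap_eq, hw]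
  have hsep : g.Separable := by
    rw [← separable_map (algebraMap F Ω), hg]
    exact h.separable_fibrePoly w.2
  refine hsep.of_dvd (minpoly.dvd F y.1 ?_)
  rw [← eval_map_algebraMap, hg, eval_fibrePoly, sub_eq_zero]
  exact (h.toFun_eq_iff y w).mp hyw

/-- Separability climbs the tower one preimage at a time: `y` is separable over `F(f(y))`, and
`f(y)` over `F` by induction. -/
theorem isSeparable_of_iterate (h : IsRatMap P Q d) {t : TransPt K Ω}
    (ht : ∃ t₀ : F, algebraMap F Ω t₀ = t.1) : ∀ (n : ℕ) (y : TransPt K Ω),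
      h.toFun^[n] y = t → IsSeparable F y.1
  | 0, y, hy => by
    obtain ⟨t₀, ht₀⟩ := ht
    rw [Function.iterate_zero, id] at hy
    rw [hy, ← ht₀]
    exact isSeparable_algebraMap t₀
  | n + 1, y, hy => by
    have hw := isSeparable_of_iterate h ht n (h.toFun y) hy
    let E := IntermediateField.adjoin F {(h.toFun y).1}
    have : Algebra.IsSeparable F E :=
      (IntermediateField.isSeparable_adjoin_simple_iff_isSeparable F Ω).mpr hw
    have : IsScalarTower K E Ω := .of_algebraMap_eq fun x => by
      rw [IsScalarTower.algebraMap_apply K F E, ← IsScalarTower.algebraMap_apply F E Ω,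
        ← IsScalarTower.algebraMap_apply K F Ω]
    refine IsSeparable.of_algebra_isSeparable_of_isSeparable F (E := E) ?_
    exact h.isSeparable_of_mem_range (F := E) rfl
      (w₀ := ⟨_, IntermediateField.mem_adjoin_simple_self F _⟩) rfl

end IsRatMap

/-- The roots generate the splitting field, so separability of each root suffices; `p` itself may
have repeated roots. -/
theorem Polynomial.isGalois_splittingField_of_isSeparable {F Ω : Type*} [Field F] [Field Ω]
    [Algebra F Ω] [IsAlgClosed Ω] (p : F[X]) (hp : ∀ y ∈ p.rootSet Ω, IsSeparable F y) :
    IsGalois F p.SplittingField := by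
  have : Fact ((p.map (algebraMap F Ω)).Splits) := ⟨IsAlgClosed.splits _⟩
  have htop : IntermediateField.adjoin F (p.rootSet p.SplittingField) = ⊤ :=
    IntermediateField.adjoin_eq_top_of_algebra F _
      (IsSplittingField.adjoin_rootSet p.SplittingField p)
  have hs : Algebra.IsSeparable F (IntermediateField.adjoin F (p.rootSet p.SplittingField)) := by
    rw [IntermediateField.isSeparable_adjoin_iff_isSeparable]
    intro x hx
    have := hp _ (Gal.rootsEquivRoots p Ω ⟨x, hx⟩).2
    exact (isSeparable_map_iff (IsScalarTower.toAlgHom F p.SplittingField Ω)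
      (algebraMap p.SplittingField Ω).injective).mp this
  rw [htop] at hs
  have : Algebra.IsSeparable F p.SplittingField :=
    Algebra.IsSeparable.of_algHom F _ (IntermediateField.topEquiv (F := F)).symm.toAlgHom
  exact { }

/-- If the roots of `p` are labelled by a level of the tree and the permutations induced by the
Galois group are those of the iterated wreath product, then the Galois group of `p` is the iterated
wreath product, acting on the roots as on the level of the tree. -/
theorem galois_of_range_eq {F Ω : Type u} {S : Type v} [Field F] [Field Ω] [Algebra F Ω] [IsAlgClosed Ω]
    [Normal F Ω] [Nonempty S] [Finite S] (p : F[X]) (n : ℕ)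
    (label : TreeLevel S n → Ω) (hinj : Function.Injective label)
    (hlabel : ∀ y, y ∈ p.rootSet Ω ↔ ∃ v, label v = y)
    (hrange : ∀ π : Equiv.Perm (TreeLevel S n),
      (∃ g : Ω ≃ₐ[F] Ω, ∀ v, g (label v) = label (π v)) ↔ π ∈ (iterWreathHom S n).range) :
    Nonempty ((p.SplittingField ≃ₐ[F] p.SplittingField) ≃*
      iterWreath (Equiv.Perm S) S (n + 1)) ∧
    fixProp p = 1 - derangeProp (iterWreathHom S n) := by
  have : Fact ((p.map (algebraMap F Ω)).Splits) := ⟨IsAlgClosed.splits _⟩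
  let ℓ : TreeLevel S n ≃ p.rootSet Ω :=
    Equiv.ofBijective (fun v => ⟨label v, (hlabel _).mpr ⟨v, rfl⟩⟩)
      ⟨fun v w h => hinj (congrArg Subtype.val h), fun y => by
        obtain ⟨v, hv⟩ := (hlabel y).mp y.2
        exact ⟨v, Subtype.ext hv⟩⟩
  let Ψ : p.Gal →* Equiv.Perm (TreeLevel S n) :=
    ℓ.symm.permCongrHom.toMonoidHom.comp (Gal.galActionHom p Ω)
  have hΨ (σ : p.Gal) (v) : ℓ (Ψ σ v) = σ • ℓ v := by
    change ℓ (ℓ.symm (Gal.galActionHom p Ω σ (ℓ.symm.symm v))) = _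
    rw [Equiv.apply_symm_apply]
    rfl
  have hΨinj : Function.Injective Ψ :=
    ℓ.symm.permCongrHom.injective.comp (Gal.galActionHom_injective p Ω)
  have hΨrange : Ψ.range = (iterWreathHom S n).range := by
    ext π
    rw [← hrange]
    constructor
    · rintro ⟨σ, rfl⟩
      obtain ⟨g, rfl⟩ := Gal.restrict_surjective p Ω σ
      refine ⟨g, fun v => ?_⟩
      have := congrArg Subtype.val (hΨ (Gal.restrict p Ω g) v)
      rw [Gal.restrict_smul] at this
      exact this.symm
    · rintro ⟨g, hg⟩
      refine ⟨Gal.restrict p Ω g, Equiv.ext fun v => ℓ.injective (Subtype.ext ?_)⟩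
      rw [hΨ, Gal.restrict_smul]
      exact hg v
  let e : p.Gal ≃* iterWreath (Equiv.Perm S) S (n + 1) :=
    (MonoidHom.ofInjective hΨinj).trans ((MulEquiv.subgroupCongr hΨrange).trans
      (MonoidHom.ofInjective (iterWreathHom_injective S n)).symm)
  have he (σ : p.Gal) : iterWreathHom S n (e σ) = Ψ σ := by
    have : (MonoidHom.ofInjective (iterWreathHom_injective S n) (e σ)).1 = Ψ σ := by
      simp only [e, MulEquiv.trans_apply, MulEquiv.apply_symm_apply]
      rfl
    exact this
  refine ⟨⟨e⟩, ?_⟩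
  classical
  have hfix (σ : p.Gal) : (∃ a ∈ p.rootSet p.SplittingField, σ a = a) ↔
      ∃ v, iterWreathHom S n (e σ) v = v := by
    rw [he]
    let r := Gal.rootsEquivRoots p Ω
    constructor
    · rintro ⟨a, ha, hσ⟩
      refine ⟨ℓ.symm (r ⟨a, ha⟩), ℓ.injective ?_⟩
      rw [hΨ, Equiv.apply_symm_apply, Gal.smul_def, Equiv.symm_apply_apply]
      exact congrArg r (Subtype.ext hσ)
    · rintro ⟨v, hv⟩
      have h1 := hΨ σ v
      rw [hv, Gal.smul_def, ← Equiv.symm_apply_eq] at h1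
      exact ⟨(r.symm (ℓ v)).1, (r.symm (ℓ v)).2, (congrArg Subtype.val h1).symm⟩
  have hGfin : Finite p.Gal := Finite.of_equiv _ e.symm.toEquiv
  have hpos : (Nat.card p.Gal : ℚ) ≠ 0 := by exact_mod_cast Nat.card_pos.ne'
  have hcompl := Nat.card_congr (Equiv.sumCompl fun σ : p.Gal =>
    ∃ a ∈ p.rootSet p.SplittingField, σ a = a)
  rw [Nat.card_sum] at hcompl
  have hder : derangeProp (iterWreathHom S n) = (Nat.card {σ : p.Gal //
      ¬ ∃ a ∈ p.rootSet p.SplittingField, σ a = a} : ℚ) / Nat.card p.Gal := by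
    unfold derangeProp
    congr 2
    · refine Nat.card_congr (e.toEquiv.symm.subtypeEquiv fun w => ?_)
      rw [hfix]
      simp
    · exact Nat.card_congr e.toEquiv.symm
  rw [hder, eq_sub_iff_add_eq]
  change ((Nat.card {σ : p.Gal // ∃ a ∈ p.rootSet p.SplittingField, σ a = a} : ℚ)) /
    Nat.card p.Gal + _ = 1
  rw [← add_div, div_eq_one_iff_eq hpos]
  exact_mod_cast hcompl

/-! ### Simple roots over power series rings -/

section PowerSeriesRoots

variable {E : Type*} [Field E]

theorem constantCoeff_eval_map_C (p : E[X]) (y : PowerSeries E) :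
    PowerSeries.constantCoeff ((p.map (PowerSeries.C (R := E))).eval y) =
      p.eval (PowerSeries.constantCoeff y) := by
  rw [eval_map, hom_eval₂]
  simp [eval₂_eq_eval_map]

theorem coeff_one_mul_powerSeries (a b : PowerSeries E) :
    PowerSeries.coeff 1 (a * b) =
      PowerSeries.constantCoeff a * PowerSeries.coeff 1 b +
        PowerSeries.coeff 1 a * PowerSeries.constantCoeff b := by
  rw [PowerSeries.coeff_mul, Finset.Nat.sum_antidiagonal_eq_sum_range_succ_mk]
  simp [Finset.sum_range_succ]

theorem coeff_one_eval_map_C (p : E[X]) (y : PowerSeries E) :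
    PowerSeries.coeff 1 ((p.map (PowerSeries.C (R := E))).eval y) =
      (derivative p).eval (PowerSeries.constantCoeff y) * PowerSeries.coeff 1 y := by
  induction p using Polynomial.induction_on' with
  | add p q hp hq => simp [hp, hq, add_mul]
  | monomial n a =>
    rw [map_monomial, eval_monomial, PowerSeries.coeff_C_mul, PowerSeries.coeff_one_pow,
      derivative_monomial, eval_monomial]
    ring

theorem isUnit_powerSeries_of_ne_zero {y : PowerSeries E}
    (hy : PowerSeries.constantCoeff y ≠ 0) : IsUnit y :=
  PowerSeries.isUnit_iff_constantCoeff.mpr (isUnit_iff_ne_zero.mpr hy)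

/-- Hensel's lemma for simple roots of the reduction of a polynomial over a power series ring with
invertible leading coefficient. -/
theorem exists_powerSeries_root_of_simple_root {g : (PowerSeries E)[X]}
    (hg : IsUnit g.leadingCoeff) {c : E}
    (hc : (g.map PowerSeries.constantCoeff).eval c = 0)
    (hc' : (derivative (g.map PowerSeries.constantCoeff)).eval c ≠ 0) :
    ∃ y : PowerSeries E, g.eval y = 0 ∧ PowerSeries.constantCoeff y = c := by
  obtain ⟨u, hu⟩ := hg
  let f := Polynomial.C (↑u⁻¹ : PowerSeries E) * g
  have hf : f.Monic := by
    rw [Monic.def, leadingCoeff_mul, leadingCoeff_C, ← hu, Units.inv_mul]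
  have hev (p : (PowerSeries E)[X]) : PowerSeries.constantCoeff (p.eval (PowerSeries.C c)) =
      (p.map PowerSeries.constantCoeff).eval c := by
    rw [eval_map, ← eval₂_hom]; simp
  obtain ⟨y, hy, hyc⟩ := HenselianRing.is_henselian
    (I := Ideal.span {(PowerSeries.X : PowerSeries E)}) f hf (PowerSeries.C c)
    (by
      rw [Ideal.mem_span_singleton, PowerSeries.X_dvd_iff]
      simp only [f, eval_mul, map_mul, hev, hc, mul_zero])
    (by
      refine IsUnit.map _ (isUnit_powerSeries_of_ne_zero ?_)
      simp only [f, derivative_C_mul, eval_mul, map_mul, hev]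
      rw [← derivative_map]
      refine mul_ne_zero ?_ hc'
      rw [map_C, eval_C]
      exact ((Units.isUnit u⁻¹).map PowerSeries.constantCoeff).ne_zero)
  refine ⟨y, ?_, ?_⟩
  · rw [IsRoot.def, eval_mul, eval_C] at hy
    exact (mul_eq_zero.mp hy).resolve_left (Units.ne_zero u⁻¹)
  · rw [Ideal.mem_span_singleton, PowerSeries.X_dvd_iff, map_sub, sub_eq_zero] at hyc
    simpa using hyc

/-- Expanding `g` at `z` gives `(y - z) (g'(z) + k (y - z)) = 0`, and the second factor has nonzero
constant coefficient. -/
theorem powerSeries_eq_of_simple_root {g : (PowerSeries E)[X]} {y z : PowerSeries E}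
    (hy : g.eval y = 0) (hz : g.eval z = 0)
    (hyz : PowerSeries.constantCoeff y = PowerSeries.constantCoeff z)
    (h : (derivative (g.map PowerSeries.constantCoeff)).eval (PowerSeries.constantCoeff z) ≠ 0) :
    y = z := by
  obtain ⟨k, hk⟩ := binomExpansion g z (y - z)
  rw [add_sub_cancel, hy, hz] at hk
  have h1 : (y - z) * ((derivative g).eval z + k * (y - z)) = 0 := by linear_combination -hk
  refine sub_eq_zero.mp ((mul_eq_zero.mp h1).resolve_right fun h2 => h ?_)
  have h3 := congrArg PowerSeries.constantCoeff h2
  rw [map_add, map_mul, map_sub, hyz, sub_self, mul_zero, add_zero, map_zero] at h3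
  rw [derivative_map, eval_map, eval₂_hom, h3]

end PowerSeriesRoots

/-! ### Perturbed maps and power series preimages -/

/-- A perturbation, modulo the square of the uniformizer, of a pair of polynomials. -/
structure IsPerturbation {E : Type*} [Field E] (P₀ Q₀ : E[X]) (P Q : (PowerSeries E)[X])
    (d : ℕ) : Prop where
  natDegree_num₀ : P₀.natDegree = d
  natDegree_den₀ : Q₀.natDegree < d
  isCoprime : IsCoprime P₀ Q₀
  natDegree_num : P.natDegree ≤ d
  natDegree_den : Q.natDegree ≤ d
  num : ∃ P₁, P = P₀.map PowerSeries.C + C (PowerSeries.X ^ 2) * P₁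
  den : ∃ Q₁, Q = Q₀.map PowerSeries.C + C (PowerSeries.X ^ 2) * Q₁

namespace IsPerturbation

variable {E : Type*} [Field E] {P₀ Q₀ : E[X]} {P Q : (PowerSeries E)[X]} {d : ℕ}

theorem den₀_ne_zero (h : IsPerturbation P₀ Q₀ P Q d) {c w : E}
    (hc : P₀.eval c = w * Q₀.eval c) : Q₀.eval c ≠ 0 := by
  intro h0
  obtain ⟨a, b, hab⟩ := h.isCoprime
  have := congrArg (eval c) hab
  rw [h0, mul_zero] at hc
  simp [hc, h0] at this

theorem map_constantCoeff (h : IsPerturbation P₀ Q₀ P Q d) (w : PowerSeries E) :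
    (P - C w * Q).map PowerSeries.constantCoeff =
      P₀ - C (PowerSeries.constantCoeff w) * Q₀ := by
  obtain ⟨P₁, hP⟩ := h.num
  obtain ⟨Q₁, hQ⟩ := h.den
  rw [hP, hQ]
  have : (PowerSeries.constantCoeff (R := E)).comp PowerSeries.C = RingHom.id E := by
    ext; simp
  simp [Polynomial.map_map, this]

theorem coeff_zero (h : IsPerturbation P₀ Q₀ P Q d) {y w : PowerSeries E}
    (hy : P.eval y = w * Q.eval y) :
    P₀.eval (PowerSeries.constantCoeff y) =
      PowerSeries.constantCoeff w * Q₀.eval (PowerSeries.constantCoeff y) := by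
  obtain ⟨P₁, hP⟩ := h.num
  obtain ⟨Q₁, hQ⟩ := h.den
  have := congrArg PowerSeries.constantCoeff hy
  simpa [hP, hQ, constantCoeff_eval_map_C] using this

/-- The perturbation is divisible by `X²`, so to first order the equation is that of the unperturbed
map. Where the derivative factor vanishes, a power series solution forces `coeff 1 w` or `Q₀` to
vanish too. -/
theorem coeff_one (h : IsPerturbation P₀ Q₀ P Q d) {y w : PowerSeries E}
    (hy : P.eval y = w * Q.eval y) :
    ((derivative P₀).eval (PowerSeries.constantCoeff y) - PowerSeries.constantCoeff w *
        (derivative Q₀).eval (PowerSeries.constantCoeff y)) * PowerSeries.coeff 1 y =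
      PowerSeries.coeff 1 w * Q₀.eval (PowerSeries.constantCoeff y) := by
  obtain ⟨P₁, hP⟩ := h.num
  obtain ⟨Q₁, hQ⟩ := h.den
  have := congrArg (PowerSeries.coeff 1) hy
  simp only [hP, hQ, eval_add, eval_mul, eval_C, pow_two, map_add, coeff_one_mul_powerSeries,
    coeff_one_eval_map_C, constantCoeff_eval_map_C, map_mul,
    PowerSeries.constantCoeff_X, zero_mul, mul_zero, add_zero] at this
  linear_combination this

/-- Since `Q₀` has degree less than `d`, the top coefficient reduces to that of `P₀`. This makes
roots integral and lets Hensel's lemma apply. -/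
theorem isUnit_coeff (h : IsPerturbation P₀ Q₀ P Q d) (w : PowerSeries E) :
    IsUnit ((P - C w * Q).coeff d) := by
  refine isUnit_powerSeries_of_ne_zero ?_
  rw [← coeff_map, h.map_constantCoeff, coeff_sub, coeff_C_mul,
    coeff_eq_zero_of_natDegree_lt h.natDegree_den₀, mul_zero, sub_zero, ← h.natDegree_num₀]
  refine leadingCoeff_ne_zero.mpr fun h0 => ?_
  have h1 := h.natDegree_num₀
  have h2 := h.natDegree_den₀
  rw [h0, natDegree_zero] at h1
  omega

theorem natDegree_sub (h : IsPerturbation P₀ Q₀ P Q d) (w : PowerSeries E) :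
    (P - C w * Q).natDegree = d :=
  natDegree_eq_of_le_of_coeff_ne_zero
    ((natDegree_sub_le _ _).trans (max_le h.natDegree_num
      ((natDegree_C_mul_le _ _).trans h.natDegree_den))) (h.isUnit_coeff w).ne_zero

theorem exists_lift (h : IsPerturbation P₀ Q₀ P Q d) (w : PowerSeries E) {c : E}
    (hc : P₀.eval c = PowerSeries.constantCoeff w * Q₀.eval c)
    (hc' : (derivative P₀).eval c ≠ PowerSeries.constantCoeff w * (derivative Q₀).eval c) :
    ∃ y, P.eval y = w * Q.eval y ∧ PowerSeries.constantCoeff y = c := by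
  obtain ⟨y, hy, hyc⟩ := exists_powerSeries_root_of_simple_root (g := P - C w * Q) (c := c)
    (by rw [leadingCoeff, h.natDegree_sub]; exact h.isUnit_coeff w)
    (by rw [h.map_constantCoeff]; simp [hc])
    (by rw [h.map_constantCoeff]; simpa [sub_eq_zero] using hc')
  refine ⟨y, ?_, hyc⟩
  simpa [sub_eq_zero] using hy

theorem eq_of_lift (h : IsPerturbation P₀ Q₀ P Q d) {w y z : PowerSeries E}
    (hy : P.eval y = w * Q.eval y) (hz : P.eval z = w * Q.eval z)
    (hyz : PowerSeries.constantCoeff y = PowerSeries.constantCoeff z)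
    (hc' : (derivative P₀).eval (PowerSeries.constantCoeff z) ≠
      PowerSeries.constantCoeff w * (derivative Q₀).eval (PowerSeries.constantCoeff z)) :
    y = z := by
  refine powerSeries_eq_of_simple_root (g := P - C w * Q) (by simp [hy]) (by simp [hz]) hyz ?_
  rw [h.map_constantCoeff]
  simpa [sub_eq_zero] using hc'

end IsPerturbation

/-- `w` lies over `v` at depth `j` in the backward orbit under `P₀ / Q₀`. -/
def IsOver {E : Type*} [Field E] (P₀ Q₀ : E[X]) (v : E) : ℕ → E → Prop
  | 0, w => w = v
  | j + 1, w => ∃ u, IsOver P₀ Q₀ v j u ∧ P₀.eval w = u * Q₀.eval w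

/-- The backward orbit of `x 0` up to depth `n` contains exactly one critical value, the point
`x n` at depth `n`, above which `0` is the only critical point and is simple. -/
structure HasSimpleCriticalOrbit {E : Type*} [Field E] (P₀ Q₀ : E[X]) (d n : ℕ) (x : ℕ → E) :
    Prop where
  step : ∀ j < n, P₀.eval (x (j + 1)) = x j * Q₀.eval (x (j + 1))
  special : ∃ (a : E) (s : Finset E), a ≠ 0 ∧ 0 ∉ s ∧ s.card + 2 = d ∧
    P₀ - C (x n) * Q₀ = C a * X ^ 2 * ∏ e ∈ s, (X - C e)
  noncritical : ∀ j ≤ n, ∀ w, IsOver P₀ Q₀ (x 0) j w → ∀ c, P₀.eval c = w * Q₀.eval c →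
    (derivative P₀).eval c = w * (derivative Q₀).eval c → j = n ∧ w = x n

section CriticalOrbit

variable {E : Type*} [Field E] {P₀ Q₀ : E[X]} {d n : ℕ} {x : ℕ → E}

theorem HasSimpleCriticalOrbit.eval_zero (h : HasSimpleCriticalOrbit P₀ Q₀ d n x) :
    (derivative P₀).eval 0 = x n * (derivative Q₀).eval 0 := by
  obtain ⟨a, s, -, -, -, hs⟩ := h.special
  have h2 := congrArg (fun p => (derivative p).eval 0) hs
  simpa [sub_eq_zero] using h2

theorem HasSimpleCriticalOrbit.eq_zero_or_mem (h : HasSimpleCriticalOrbit P₀ Q₀ d n x) :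
    ∃ s : Finset E, 0 ∉ s ∧ s.card + 2 = d ∧
      (∀ c, P₀.eval c = x n * Q₀.eval c ↔ c = 0 ∨ c ∈ s) ∧
      ∀ c ∈ s, (derivative P₀).eval c ≠ x n * (derivative Q₀).eval c := by
  classical
  obtain ⟨a, s, ha, h0, hcard, hs⟩ := h.special
  refine ⟨s, h0, hcard, fun c => ?_, fun c hc => ?_⟩
  · have := congrArg (eval c) hs
    simp only [eval_sub, eval_mul, eval_C, eval_pow, eval_X, eval_prod] at this
    rw [← sub_eq_zero, this]
    simp [ha, Finset.prod_eq_zero_iff, sub_eq_zero]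
  · have h2 := congrArg (fun p => (derivative p).eval c) hs
    rw [← Finset.mul_prod_erase s _ hc, ← mul_assoc, mul_right_comm, derivative_mul] at h2
    simp only [derivative_sub, derivative_X, derivative_C, sub_zero, mul_one, eval_add, eval_mul,
      eval_sub, eval_X, eval_C, sub_self, mul_zero, zero_add, derivative_mul, zero_mul] at h2
    have hc0 : c ≠ 0 := fun h => h0 (h ▸ hc)
    intro h3
    rw [h3, sub_self] at h2
    have h4 := h2.symm
    simp only [eval_pow, eval_X, eval_prod, eval_sub, eval_C, mul_eq_zero, ha, hc0,
      pow_eq_zero_iff, ne_eq, OfNat.ofNat_ne_zero, not_false_eq_true, or_self, false_or,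
      Finset.prod_eq_zero_iff, Finset.mem_erase, sub_eq_zero] at h4
    simp at h4

theorem IsPerturbation.card_roots [IsAlgClosed E] [DecidableEq E] {P Q : (PowerSeries E)[X]}
    (h : IsPerturbation P₀ Q₀ P Q d) (w : E)
    (hw : ∀ c, P₀.eval c = w * Q₀.eval c →
      (derivative P₀).eval c ≠ w * (derivative Q₀).eval c) :
    ∃ s : Finset E, s.card = d ∧ ∀ c ∈ s, P₀.eval c = w * Q₀.eval c := by
  have hdeg : (P₀ - C w * Q₀).natDegree = d := by
    rw [natDegree_sub_eq_left_of_natDegree_lt, h.natDegree_num₀]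
    exact (natDegree_C_mul_le _ _).trans_lt (h.natDegree_den₀.trans_eq h.natDegree_num₀.symm)
  have hne : P₀ - C w * Q₀ ≠ 0 := by
    intro h0
    rw [h0, natDegree_zero] at hdeg
    have := h.natDegree_den₀
    omega
  refine ⟨(P₀ - C w * Q₀).roots.toFinset, ?_, fun c hc => ?_⟩
  · rw [Multiset.toFinset_card_of_nodup, ← (IsAlgClosed.splits _).natDegree_eq_card_roots, hdeg]
    rw [Multiset.nodup_iff_count_le_one]
    intro c
    rw [count_roots]
    by_contra! hlt
    obtain ⟨h1, h2⟩ := (one_lt_rootMultiplicity_iff_isRoot hne).mp hlt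
    simp only [IsRoot.def, eval_sub, eval_mul, eval_C, derivative_sub, derivative_mul,
      derivative_C, zero_mul, zero_add, sub_eq_zero] at h1 h2
    exact hw c h1 h2
  · rw [Multiset.mem_toFinset, mem_roots hne, IsRoot.def] at hc
    simpa [sub_eq_zero] using hc

variable [IsAlgClosed E] {K L Ω : Type*} [Field K] [Field L] [Field Ω] [Algebra (PowerSeries E) L]
  [IsFractionRing (PowerSeries E) L] [Algebra K L] [Algebra L Ω] [Algebra K Ω]
  [IsScalarTower K L Ω] [IsAlgClosed Ω] {P Q : K[X]} {P' Q' : (PowerSeries E)[X]}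

/-- An embedding of a power series ring in a field that transforms a perturbation into `P / Q`. -/
structure IsModel (P Q : K[X]) (P' Q' : (PowerSeries E)[X]) (L : Type*) [Field L]
    [Algebra (PowerSeries E) L] [Algebra K L] : Prop where
  num : P.map (algebraMap K L) = P'.map (algebraMap (PowerSeries E) L)
  den : Q.map (algebraMap K L) = Q'.map (algebraMap (PowerSeries E) L)

/-- The embedding of the power series ring. -/
noncomputable def seriesEmb (E L Ω : Type*) [Field E] [Field L] [Field Ω] [Algebra (PowerSeries E) L]
    [Algebra L Ω] : PowerSeries E →+* Ω :=
  (algebraMap L Ω).comp (algebraMap (PowerSeries E) L)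

omit [IsAlgClosed E] [IsAlgClosed Ω] in
theorem seriesEmb_injective : Function.Injective (seriesEmb E L Ω) :=
  (algebraMap L Ω).injective.comp (IsFractionRing.injective (PowerSeries E) L)

omit [IsAlgClosed E] [IsAlgClosed Ω] [IsFractionRing (PowerSeries E) L] in
theorem aeval_seriesEmb {R : K[X]} {R' : (PowerSeries E)[X]}
    (hR : R.map (algebraMap K L) = R'.map (algebraMap (PowerSeries E) L)) (y : PowerSeries E) :
    aeval (seriesEmb E L Ω y) R = seriesEmb E L Ω (R'.eval y) := by
  have h1 : R.map (algebraMap K Ω) = R'.map (seriesEmb E L Ω) := by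
    rw [IsScalarTower.algebraMap_eq K L Ω, ← Polynomial.map_map, hR, Polynomial.map_map]
    rfl
  rw [aeval_def, ← eval_map, h1, eval_map, eval₂_hom]

omit [IsAlgClosed E] [IsAlgClosed Ω] in
theorem IsModel.aeval_eq_iff (hm : IsModel P Q P' Q' L) (y w : PowerSeries E) :
    aeval (seriesEmb E L Ω y) P = seriesEmb E L Ω w * aeval (seriesEmb E L Ω y) Q ↔
      P'.eval y = w * Q'.eval y := by
  rw [aeval_seriesEmb hm.num, aeval_seriesEmb hm.den, ← map_mul, seriesEmb_injective.eq_iff]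

/-- Away from critical values the reduction has `d` simple roots. Their Hensel lifts are distinct
and already exhaust the fibre, which has `d` points. -/
theorem IsModel.exists_seriesEmb_eq (hm : IsModel P Q P' Q' L) (h : IsRatMap P Q d)
    (hp : IsPerturbation P₀ Q₀ P' Q' d) {w : PowerSeries E}
    (hw : ∀ c, P₀.eval c = PowerSeries.constantCoeff w * Q₀.eval c →
      (derivative P₀).eval c ≠ PowerSeries.constantCoeff w * (derivative Q₀).eval c)
    {y z : TransPt K Ω} (hz : z.1 = seriesEmb E L Ω w) (hy : h.toFun y = z) :
    ∃ y' : PowerSeries E, seriesEmb E L Ω y' = y.1 ∧ P'.eval y' = w * Q'.eval y' := by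
  classical
  obtain ⟨s, hs, hroot⟩ := hp.card_roots _ hw
  choose! ℓ hℓ using fun c (hc : c ∈ s) => hp.exists_lift w (hroot c hc) (hw c (hroot c hc))
  have hzt : Transcendental K (seriesEmb E L Ω w) := hz ▸ z.2
  have hsub : s.image (fun c => seriesEmb E L Ω (ℓ c)) ⊆ IsRatMap.fibre P Q (seriesEmb E L Ω w) := by
    intro a ha
    obtain ⟨c, hc, rfl⟩ := Finset.mem_image.mp ha
    rw [h.mem_fibre hzt, hm.aeval_eq_iff]
    exact (hℓ c hc).1
  have heq := Finset.eq_of_subset_of_card_le hsub (by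
    rw [h.card_fibre hzt, Finset.card_image_of_injOn, hs]
    intro a ha b hb hab
    rw [← (hℓ a ha).2, seriesEmb_injective hab, (hℓ b hb).2])
  have hymem : y.1 ∈ IsRatMap.fibre P Q (seriesEmb E L Ω w) := by
    rw [h.mem_fibre hzt, ← hz]
    exact (h.toFun_eq_iff y z).mp hy
  rw [← heq] at hymem
  obtain ⟨c, hc, hcy⟩ := Finset.mem_image.mp hymem
  exact ⟨ℓ c, hcy, (hℓ c hc).1⟩

end CriticalOrbit

/-! ### A sibling transposition from ramification -/

theorem exists_algEquiv_ne_of_isSeparable {L Ω : Type*} [Field L] [Field Ω] [Algebra L Ω]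
    [Normal L Ω] {a : Ω} (ha : IsSeparable L a) (ha' : a ∉ (algebraMap L Ω).range) :
    ∃ g : Ω ≃ₐ[L] Ω, g a ≠ a := by
  classical
  have hint : IsIntegral L a := ha.isIntegral
  have hcard := card_rootSet_eq_natDegree ha (Normal.splits inferInstance a : Splits ((minpoly L a).map (algebraMap L Ω)))
  have hdeg : 1 < (minpoly L a).natDegree := by
    rw [Nat.lt_iff_le_and_ne]
    exact ⟨minpoly.natDegree_pos hint, fun h => ha' (minpoly.natDegree_eq_one_iff.mp h.symm)⟩
  rw [← hcard, Fintype.one_lt_card_iff_nontrivial] at hdeg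
  have hmem : a ∈ (minpoly L a).rootSet Ω := by
    rw [mem_rootSet]
    exact ⟨minpoly.ne_zero hint, minpoly.aeval L a⟩
  obtain ⟨b, hb⟩ := exists_ne (⟨a, hmem⟩ : (minpoly L a).rootSet Ω)
  have hb2 := (mem_rootSet.mp b.2).2
  have hmin := minpoly.eq_of_irreducible_of_monic (minpoly.irreducible hint) hb2
    (minpoly.monic hint)
  obtain ⟨g, hg⟩ := Normal.minpoly_eq_iff_mem_orbit (F := L) (E := Ω) |>.mp hmin
  refine ⟨g⁻¹, fun h => hb (Subtype.ext ?_)⟩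
  simp only [AlgEquiv.smul_def] at hg
  change b.1 = a
  exact (g.symm_apply_apply b.1).symm.trans ((congrArg (g⁻¹ : Ω ≃ₐ[L] Ω) hg).trans h)

section Swap

variable {E : Type*} [Field E] {P₀ Q₀ : E[X]} {d n : ℕ} {x : ℕ → E}
variable {K L Ω : Type*} [Field K] [Field L] [Field Ω] [Algebra (PowerSeries E) L]
  [Algebra K L] [Algebra L Ω] [Algebra K Ω]
  [IsScalarTower K L Ω] {P Q : K[X]} {P' Q' : (PowerSeries E)[X]} {t : TransPt K Ω}

/-- No critical value occurs at depth less than `n`, so points up to depth `n` are power series.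
Their linear terms stay nonzero by `coeff_one`; this is what will force ramification above `x n`. -/
theorem HasSimpleCriticalOrbit.exists_seriesEmb_eq [IsAlgClosed E] [IsAlgClosed Ω]
    [IsFractionRing (PowerSeries E) L] (horb : HasSimpleCriticalOrbit P₀ Q₀ d n x)
    (h : IsRatMap P Q d) (hp : IsPerturbation P₀ Q₀ P' Q' d) (hm : IsModel P Q P' Q' L)
    (ht : t.1 = seriesEmb E L Ω (PowerSeries.C (x 0) + PowerSeries.X)) :
    ∀ j ≤ n, ∀ y : TransPt K Ω, h.toFun^[j] y = t → ∃ w, y.1 = seriesEmb E L Ω w ∧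
      PowerSeries.coeff 1 w ≠ 0 ∧ IsOver P₀ Q₀ (x 0) j (PowerSeries.constantCoeff w) := by
  intro j
  induction j with
  | zero =>
    rintro - y rfl
    refine ⟨_, ht, by simp, ?_⟩
    simp [IsOver]
  | succ j ih =>
    intro hj y hy
    rw [Function.iterate_succ_apply] at hy
    obtain ⟨w, hw, hw1, hw0⟩ := ih (by omega) _ hy
    obtain ⟨a, ha, haw⟩ := hm.exists_seriesEmb_eq h hp
      (fun c hc hc' => by
        have := (horb.noncritical j (by omega) _ hw0 c hc hc').1
        omega) hw rfl
    refine ⟨a, ha.symm, fun h0 => ?_, _, hw0, hp.coeff_zero haw⟩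
    have h1 := hp.coeff_one haw
    rw [h0, mul_zero] at h1
    exact mul_ne_zero hw1 (hp.den₀_ne_zero (hp.coeff_zero haw)) h1.symm

/-- Equal constant terms give equal constant terms of the images, which coincide by induction;
uniqueness in Hensel's lemma then identifies the points. So exactly one point at depth `n` reduces
to the critical value. -/
theorem HasSimpleCriticalOrbit.eq_of_constantCoeff_eq [IsAlgClosed E] [IsAlgClosed Ω]
    [IsFractionRing (PowerSeries E) L] (horb : HasSimpleCriticalOrbit P₀ Q₀ d n x)
    (h : IsRatMap P Q d) (hp : IsPerturbation P₀ Q₀ P' Q' d) (hm : IsModel P Q P' Q' L)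
    (ht : t.1 = seriesEmb E L Ω (PowerSeries.C (x 0) + PowerSeries.X)) :
    ∀ j ≤ n, ∀ y z : TransPt K Ω, h.toFun^[j] y = t → h.toFun^[j] z = t →
      ∀ a b, y.1 = seriesEmb E L Ω a → z.1 = seriesEmb E L Ω b →
      PowerSeries.constantCoeff a = PowerSeries.constantCoeff b → y = z := by
  intro j
  induction j with
  | zero =>
    rintro - y z rfl h2 a b - - -
    exact h2.symm
  | succ j ih =>
    intro hj y z hy hz a b ha hb hab
    rw [Function.iterate_succ_apply] at hy hz
    obtain ⟨v, hv, -, hv0⟩ := horb.exists_seriesEmb_eq h hp hm ht j (by omega) _ hy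
    obtain ⟨w, hw, -, hw0⟩ := horb.exists_seriesEmb_eq h hp hm ht j (by omega) _ hz
    have hav : P'.eval a = v * Q'.eval a := by
      rw [← hm.aeval_eq_iff (Ω := Ω), ← ha, ← hv]
      exact (h.toFun_eq_iff _ _).mp rfl
    have hbw : P'.eval b = w * Q'.eval b := by
      rw [← hm.aeval_eq_iff (Ω := Ω), ← hb, ← hw]
      exact (h.toFun_eq_iff _ _).mp rfl
    have h1 := hp.coeff_zero hav
    have h2 := hp.coeff_zero hbw
    have h3 := hp.den₀_ne_zero h2
    rw [hab, h2] at h1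
    have h4 := ih (by omega) _ _ hy hz v w hv hw (mul_right_cancel₀ h3 h1).symm
    have h5 : v = w := seriesEmb_injective (L := L) (Ω := Ω) (by rw [← hv, ← hw, h4])
    subst h5
    have h6 := hp.eq_of_lift hav hbw hab fun hc => by
      have := (horb.noncritical j (by omega) _ hv0 _ h2 hc).1
      omega
    exact Subtype.ext (by rw [ha, hb, h6])

theorem HasSimpleCriticalOrbit.exists_iterate_eq [IsAlgClosed E] [IsAlgClosed Ω]
    [IsFractionRing (PowerSeries E) L] (horb : HasSimpleCriticalOrbit P₀ Q₀ d n x)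
    (h : IsRatMap P Q d) (hp : IsPerturbation P₀ Q₀ P' Q' d) (hm : IsModel P Q P' Q' L)
    (ht : t.1 = seriesEmb E L Ω (PowerSeries.C (x 0) + PowerSeries.X)) :
    ∀ j ≤ n, ∃ (y : TransPt K Ω) (a : PowerSeries E), h.toFun^[j] y = t ∧
      y.1 = seriesEmb E L Ω a ∧ PowerSeries.constantCoeff a = x j := by
  intro j
  induction j with
  | zero => exact fun _ => ⟨t, _, rfl, ht, by simp⟩
  | succ j ih =>
    intro hj
    obtain ⟨y, a, hy, hya, ha⟩ := ih (by omega)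
    obtain ⟨a', ha', -, hover⟩ := horb.exists_seriesEmb_eq h hp hm ht j (by omega) _ hy
    obtain rfl : a = a' := seriesEmb_injective (L := L) (Ω := Ω) (by rw [← ha', ← hya])
    have hstep := horb.step j (by omega)
    rw [← ha] at hstep
    obtain ⟨b, hb, hb0⟩ := hp.exists_lift a hstep fun hc => by
      have := (horb.noncritical j (by omega) _ hover _ hstep hc).1
      omega
    have hb' := (hm.aeval_eq_iff (Ω := Ω) b a).mpr hb
    rw [← hya] at hb'
    refine ⟨⟨_, h.transcendental_of_eq y.2 hb'⟩, b, ?_, rfl, hb0⟩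
    rw [Function.iterate_succ_apply, (h.toFun_eq_iff _ y).mpr hb', hy]

/-- A Laurent series solving the equation is integral over the power series ring, as the leading
coefficient is a unit, and that ring is integrally closed. -/
theorem IsPerturbation.mem_range_of_algebraMap [IsFractionRing (PowerSeries E) L]
    (hp : IsPerturbation P₀ Q₀ P' Q' d) (hm : IsModel P Q P' Q' L) {z : L} {w : PowerSeries E}
    (hz : aeval z P = algebraMap (PowerSeries E) L w * aeval z Q) :
    ∃ a, algebraMap (PowerSeries E) L a = z := by
  refine IsIntegrallyClosed.algebraMap_eq_of_integral (R := PowerSeries E) ?_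
  have hroot : aeval z (P' - C w * Q') = 0 := by
    rw [aeval_def, eval₂_sub, eval₂_mul, eval₂_C, ← eval_map, ← eval_map, ← hm.num, ← hm.den,
      eval_map_algebraMap, eval_map_algebraMap, hz, sub_self]
  obtain ⟨u, hu⟩ : IsUnit (P' - C w * Q').leadingCoeff := by
    rw [leadingCoeff, hp.natDegree_sub]
    exact hp.isUnit_coeff w
  refine ⟨C (↑u⁻¹ : PowerSeries E) * (P' - C w * Q'), ?_, ?_⟩
  · rw [Monic.def, leadingCoeff_mul, leadingCoeff_C, ← hu, Units.inv_mul]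
  · rw [← aeval_def, map_mul, hroot, mul_zero]

/-- Over the special point there are two preimages that are exchanged by an automorphism over the
field of Laurent series, which fixes the other preimages. -/
theorem HasSimpleCriticalOrbit.exists_exchange [IsAlgClosed E] [IsAlgClosed Ω] [Normal L Ω]
    [IsFractionRing (PowerSeries E) L] (horb : HasSimpleCriticalOrbit P₀ Q₀ d n x)
    (h : IsRatMap P Q d) (hp : IsPerturbation P₀ Q₀ P' Q' d) (hm : IsModel P Q P' Q' L)
    {w : TransPt K Ω} {W : PowerSeries E} (hwW : w.1 = seriesEmb E L Ω W)
    (hW : PowerSeries.constantCoeff W = x n) (hW1 : PowerSeries.coeff 1 W ≠ 0) :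
    ∃ a b : TransPt K Ω, a ≠ b ∧ h.toFun a = w ∧ h.toFun b = w ∧
      ∃ g : Ω ≃ₐ[L] Ω, g • a = b ∧ g • b = a ∧
        ∀ y, h.toFun y = w → y ≠ a → y ≠ b → g • y = y := by
  classical
  have hfix (g : Ω ≃ₐ[L] Ω) (a : PowerSeries E) : g (seriesEmb E L Ω a) = seriesEmb E L Ω a :=
    g.commutes _
  obtain ⟨s, hs0, hscard, hsmem, hsder⟩ := horb.eq_zero_or_mem
  rw [← hW] at hsmem hsder
  choose! ℓ hℓ using fun c (hc : c ∈ s) =>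
    hp.exists_lift W ((hsmem c).mpr (Or.inr hc)) (hsder c hc)
  have hF (y : TransPt K Ω) : y.1 ∈ IsRatMap.fibre P Q w.1 ↔ h.toFun y = w := by
    rw [h.mem_fibre w.2, h.toFun_eq_iff]
  set R : Finset Ω := s.image (fun c => seriesEmb E L Ω (ℓ c)) with hR
  have hsub : R ⊆ IsRatMap.fibre P Q w.1 := by
    intro a ha
    obtain ⟨c, hc, rfl⟩ := Finset.mem_image.mp ha
    rw [h.mem_fibre w.2, hwW, hm.aeval_eq_iff]
    exact (hℓ c hc).1
  have hRcard : R.card = s.card := Finset.card_image_of_injOn fun a ha b hb hab => by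
    rw [← (hℓ a ha).2, seriesEmb_injective hab, (hℓ b hb).2]
  have hRfix (g : Ω ≃ₐ[L] Ω) (r : Ω) (hr : r ∈ R) : g r = r := by
    obtain ⟨c, -, rfl⟩ := Finset.mem_image.mp hr
    exact hfix g _
  -- A power series in the fibre cannot reduce to the critical point `0`: to first order the left
  -- side vanishes, while `coeff 1 W` and `Q₀(0)` do not. So it is one of the `d - 2` lifts
  -- collected in `R`.
  have hseries (a : PowerSeries E) (ha : seriesEmb E L Ω a ∈ IsRatMap.fibre P Q w.1) :
      seriesEmb E L Ω a ∈ R := by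
    rw [h.mem_fibre w.2, hwW, hm.aeval_eq_iff] at ha
    have hc0 := hp.coeff_zero ha
    rcases (hsmem _).mp hc0 with h0 | hs
    · have h1 := hp.coeff_one ha
      have h2 := horb.eval_zero
      rw [← hW] at h2
      rw [h0, h2, sub_self, zero_mul] at h1
      rw [h0] at hc0
      exact absurd h1.symm (mul_ne_zero hW1 (hp.den₀_ne_zero hc0))
    · exact Finset.mem_image.mpr ⟨_, hs, congrArg _
        (hp.eq_of_lift (hℓ _ hs).1 ha (hℓ _ hs).2 (hsder _ hs))⟩
  have hcard2 : (IsRatMap.fibre P Q w.1 \ R).card = 2 := by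
    rw [Finset.card_sdiff_of_subset hsub, h.card_fibre w.2, hRcard]
    omega
  obtain ⟨α, β, hαβ, hset⟩ := Finset.card_eq_two.mp hcard2
  have hα : α ∈ IsRatMap.fibre P Q w.1 \ R := by simp [hset]
  have hβ : β ∈ IsRatMap.fibre P Q w.1 \ R := by simp [hset]
  rw [Finset.mem_sdiff] at hα hβ
  have hmapsdiff (g : Ω ≃ₐ[L] Ω) (y : Ω) (hy : y ∈ IsRatMap.fibre P Q w.1 \ R) :
      g y ∈ IsRatMap.fibre P Q w.1 \ R := by
    rw [Finset.mem_sdiff] at hy ⊢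
    refine ⟨?_, fun hg => hy.2 ?_⟩
    · obtain ⟨y, rfl⟩ : ∃ y' : TransPt K Ω, y'.1 = y :=
        ⟨⟨y, h.transcendental_of_eq w.2 ((h.mem_fibre w.2).mp hy.1)⟩, rfl⟩
      have h2 := h.toFun_smul g y
      have h3 : g • w = w := Subtype.ext (by rw [IsRatMap.coe_smul, hwW]; exact hfix g _)
      rw [(hF y).mp hy.1, h3, ← hF, IsRatMap.coe_smul] at h2
      exact h2
    · have h1 := hRfix g⁻¹ _ hg
      have h2 : g⁻¹ (g y) = y := g.symm_apply_apply y
      rw [← h2, h1]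
      exact hg
  obtain ⟨α, rfl⟩ : ∃ y : TransPt K Ω, y.1 = α :=
    ⟨⟨α, h.transcendental_of_eq w.2 ((h.mem_fibre w.2).mp hα.1)⟩, rfl⟩
  obtain ⟨β, rfl⟩ : ∃ y : TransPt K Ω, y.1 = β :=
    ⟨⟨β, h.transcendental_of_eq w.2 ((h.mem_fibre w.2).mp hβ.1)⟩, rfl⟩
  have hαw : h.toFun α = w := (hF _).mp hα.1
  have hβw : h.toFun β = w := (hF _).mp hβ.1
  obtain ⟨W₁, hW₁⟩ : ∃ z : L, algebraMap L Ω z = w.1 := ⟨_, hwW.symm⟩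
  have hsep (y : TransPt K Ω) (hy : h.toFun y = w) : IsSeparable L y.1 :=
    h.isSeparable_of_mem_range hy hW₁
  -- A Laurent series root would be a power series, hence in `R`; so `α` is not one. Being
  -- separable, `α` is moved by some `g`, and `β` is the only place left for it.
  obtain ⟨g, hg⟩ := exists_algEquiv_ne_of_isSeparable (hsep _ hαw) (by
    rintro ⟨z, hz⟩
    have h1 := (h.mem_fibre w.2).mp hα.1
    rw [← hz, aeval_algebraMap_apply, aeval_algebraMap_apply, hwW, seriesEmb, RingHom.comp_apply,
      ← map_mul] at h1
    obtain ⟨a, ha⟩ := hp.mem_range_of_algebraMap hm ((algebraMap L Ω).injective h1)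
    have h2 : seriesEmb E L Ω a = α.1 := by rw [← hz, ← ha]; rfl
    exact hα.2 (h2 ▸ hseries a (h2 ▸ hα.1)))
  have hgα : g α.1 = β.1 := by
    have := hmapsdiff g α.1 (Finset.mem_sdiff.mpr hα)
    rw [hset, Finset.mem_insert, Finset.mem_singleton] at this
    exact this.resolve_left hg
  have hgβ : g β.1 = α.1 := by
    have := hmapsdiff g β.1 (Finset.mem_sdiff.mpr hβ)
    rw [hset, Finset.mem_insert, Finset.mem_singleton] at this
    exact this.resolve_right fun h1 => hαβ (g.injective (hgα.trans h1.symm))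
  refine ⟨α, β, fun h1 => hαβ (congrArg Subtype.val h1), hαw, hβw,
    g, Subtype.ext hgα, Subtype.ext hgβ, fun y hyw hyα hyβ => Subtype.ext (hRfix g _ ?_)⟩
  by_contra hyR
  have h1 := Finset.mem_sdiff.mpr ⟨(hF y).mpr hyw, hyR⟩
  rw [hset, Finset.mem_insert, Finset.mem_singleton] at h1
  rcases h1 with h1 | h1
  · exact hyα (Subtype.ext h1)
  · exact hyβ (Subtype.ext h1)

/-- An automorphism over the field of Laurent series acts on the preimages of `t` as a
transposition of two siblings. -/
theorem HasSimpleCriticalOrbit.exists_swap [IsAlgClosed E] [IsAlgClosed Ω] [Normal L Ω]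
    [DecidableEq (TransPt K Ω)]
    [IsFractionRing (PowerSeries E) L] (horb : HasSimpleCriticalOrbit P₀ Q₀ d n x)
    (h : IsRatMap P Q d) (hp : IsPerturbation P₀ Q₀ P' Q' d) (hm : IsModel P Q P' Q' L)
    (ht : t.1 = seriesEmb E L Ω (PowerSeries.C (x 0) + PowerSeries.X)) :
    ∃ a b : TransPt K Ω, a ≠ b ∧ h.toFun a = h.toFun b ∧ h.toFun^[n + 1] a = t ∧
      ∃ g : Ω ≃ₐ[L] Ω, ∀ y, h.toFun^[n + 1] y = t → g • y = Equiv.swap a b y := by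
  obtain ⟨w, W, hw, hwW, hW⟩ := horb.exists_iterate_eq h hp hm ht n le_rfl
  obtain ⟨W', hW', hW1, -⟩ := horb.exists_seriesEmb_eq h hp hm ht n le_rfl w hw
  obtain rfl : W = W' := seriesEmb_injective (L := L) (Ω := Ω) (by rw [← hW', ← hwW])
  obtain ⟨α, β, hαβ, hα, hβ, g, hgα, hgβ, hg⟩ := horb.exists_exchange h hp hm hwW hW hW1
  refine ⟨α, β, hαβ, hα.trans hβ.symm, ?_, g, fun y hy => ?_⟩
  · rw [Function.iterate_succ_apply, hα, hw]
  rcases eq_or_ne y α with rfl | hyα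
  · rw [Equiv.swap_apply_left, hgα]
  rcases eq_or_ne y β with rfl | hyβ
  · rw [Equiv.swap_apply_right, hgβ]
  rw [Equiv.swap_apply_of_ne_of_ne hyα hyβ]
  rw [Function.iterate_succ_apply] at hy
  rcases eq_or_ne (h.toFun y) w with hyw | hyw
  · exact hg y hyw hyα hyβ
  -- The image of `y` differs from `w`, so its reduction differs from `x n` and is not critical;
  -- thus `y` is a power series and fixed by `g`.
  · obtain ⟨v, hv, -, hvo⟩ := horb.exists_seriesEmb_eq h hp hm ht n le_rfl _ hy
    obtain ⟨a, ha, -⟩ := hm.exists_seriesEmb_eq h hp (fun c hc hc' => by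
      have h1 := (horb.noncritical n le_rfl _ hvo c hc hc').2
      exact hyw (horb.eq_of_constantCoeff_eq h hp hm ht n le_rfl _ _ hy hw v W hv hwW
        (h1.trans hW.symm))) hv rfl
    refine Subtype.ext ?_
    rw [IsRatMap.coe_smul, ← ha]
    exact g.commutes _

end Swap

/-! ### Polynomials with a simple critical orbit -/

section CriticalOrbitExistence

variable {k E : Type*} [Field k] [Field E] [Algebra k E] {l : E} {d : ℕ}

theorem exists_forall_eval_ne_zero [Infinite k] (s : Finset k[X]) (hs : ∀ p ∈ s, p ≠ 0) :
    ∃ a, ∀ p ∈ s, p.eval a ≠ 0 := by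
  classical
  obtain ⟨a, ha⟩ := Infinite.exists_notMem_finset (∏ p ∈ s, p).roots.toFinset
  rw [Multiset.mem_toFinset, mem_roots (Finset.prod_ne_zero_iff.mpr hs), IsRoot.def,
    eval_prod, Finset.prod_eq_zero_iff] at ha
  push Not at ha
  exact ⟨a, ha⟩

theorem exists_algebraMap_eq_of_aeval_eq_zero [IsAlgClosed k] {p : k[X]} (hp : p ≠ 0) {c : E}
    (hc : aeval c p = 0) : ∃ c₀, algebraMap k E c₀ = c := by
  have hint : IsIntegral k c := isAlgebraic_iff_isIntegral.mp ⟨p, hp, hc⟩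
  exact minpoly.mem_range_of_degree_eq_one k c
    (IsAlgClosed.degree_eq_one_of_irreducible k (minpoly.irreducible hint))

theorem natDegree_X_mul_comp {A V : k[X]} (hA : A.natDegree = d) (hV : 0 < V.natDegree)
    (hd : 0 < d) : (X * A.comp V).natDegree = d * V.natDegree + 1 := by
  have h0 : A.comp V ≠ 0 := by
    intro h
    have := natDegree_comp (p := A) (q := V)
    rw [h, natDegree_zero, hA] at this
    exact (Nat.mul_pos hd hV).ne this
  rw [natDegree_X_mul h0, natDegree_comp, hA]

theorem leadingCoeff_X_mul_comp {A V : k[X]} (hV : 0 < V.natDegree) :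
    (X * A.comp V).leadingCoeff = A.leadingCoeff * V.leadingCoeff ^ A.natDegree := by
  rw [leadingCoeff_mul, leadingCoeff_X, one_mul, leadingCoeff_comp hV.ne']

theorem natDegree_iterate_X_mul_comp {A : k[X]} (hA : A.natDegree = d)
    (hd : 0 < d) (n : ℕ) {V W : k[X]} (hV : 0 < V.natDegree) (hVW : V.natDegree = W.natDegree) :
    n < ((fun V => X * A.comp V)^[n] V).natDegree ∧
      ((fun V => X * A.comp V)^[n] V).natDegree = ((fun V => X * A.comp V)^[n] W).natDegree := by
  induction n with
  | zero => exact ⟨hV, hVW⟩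
  | succ n ih =>
    rw [Function.iterate_succ_apply', Function.iterate_succ_apply',
      natDegree_X_mul_comp hA (by omega) hd, natDegree_X_mul_comp hA (by omega) hd, ← ih.2]
    exact ⟨by nlinarith [ih.1], rfl⟩

theorem strictMono_natDegree_iterate_X_mul_comp {A : k[X]} (hA : A.natDegree = d)
    (hd : 0 < d) {V : k[X]} (hV : 0 < V.natDegree) :
    StrictMono fun n => ((fun V => X * A.comp V)^[n] V).natDegree := by
  refine strictMono_nat_of_lt_succ fun n => ?_
  have := (natDegree_iterate_X_mul_comp hA hd n hV rfl).1
  rw [Function.iterate_succ_apply', natDegree_X_mul_comp hA (by omega) hd]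
  nlinarith

/-- Each step raises the ratio of leading coefficients to the power `d`. -/
theorem leadingCoeff_iterate_X_mul_comp {A : k[X]} (hA : A.natDegree = d)
    (hd : 0 < d) (n : ℕ) {V W : k[X]} {a : k} (hV : 0 < V.natDegree)
    (hVW : V.natDegree = W.natDegree) (hlead : W.leadingCoeff = a * V.leadingCoeff) :
    ((fun V => X * A.comp V)^[n] W).leadingCoeff =
      a ^ d ^ n * ((fun V => X * A.comp V)^[n] V).leadingCoeff := by
  induction n with
  | zero => simpa using hlead
  | succ n ih =>
    have h1 := natDegree_iterate_X_mul_comp hA hd n hV hVW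
    rw [Function.iterate_succ_apply', Function.iterate_succ_apply',
      leadingCoeff_X_mul_comp (by omega), leadingCoeff_X_mul_comp (by omega), ih, hA, mul_pow,
      pow_succ, pow_mul]
    ring

/-- On values at `l` of polynomials `V`, the map `l A` acts as `V ↦ X · A(V)`. Membership in a
backward orbit thus becomes a statement on forward orbits in `k[X]`. -/
theorem isOver_iterate {A : k[X]} {V : k[X]} (j : ℕ) {v w : E} (hw : w = aeval l V)
    (h : IsOver (C l * A.map (algebraMap k E)) 1 v j w) :
    v = aeval l ((fun V => X * A.comp V)^[j] V) := by
  induction j generalizing w V with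
  | zero => exact (h : w = v).symm.trans hw
  | succ j ih =>
    obtain ⟨u, hu, hwu⟩ := h
    rw [Function.iterate_succ_apply]
    refine ih ?_ hu
    rw [eval_one, mul_one, hw] at hwu
    rw [← hwu, map_mul, aeval_X, aeval_comp, eval_mul, eval_C, eval_map_algebraMap]

/-- Each `e` is a nonzero simple root, so the derivative does not vanish there. Without any `e` the
polynomial is `X²`, whence the condition on the characteristic. -/
theorem derivative_sq_mul_prod_ne_zero (s : Finset k) (h0 : 0 ∉ s)
    (hchar : s.card = 0 → (2 : k) ≠ 0) :
    (∀ e ∈ s, (derivative (X ^ 2 * ∏ e ∈ s, (X - C e))).eval e ≠ 0) ∧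
      derivative (X ^ 2 * ∏ e ∈ s, (X - C e)) ≠ 0 := by
  classical
  have key : ∀ e ∈ s, (derivative (X ^ 2 * ∏ e ∈ s, (X - C e))).eval e ≠ 0 := by
    intro c hc
    rw [← Finset.mul_prod_erase s _ hc, mul_left_comm, derivative_mul]
    have hc0 : c ≠ 0 := fun h => h0 (h ▸ hc)
    simp only [derivative_sub, derivative_X, derivative_C, sub_zero, one_mul, eval_add, eval_mul,
      eval_sub, eval_X, eval_C, sub_self, zero_mul, add_zero]
    simp only [eval_pow, eval_X, eval_prod, eval_sub, eval_C, mul_ne_zero_iff, ne_eq,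
      pow_eq_zero_iff, hc0, OfNat.ofNat_ne_zero, not_false_eq_true, true_and,
      Finset.prod_eq_zero_iff, Finset.mem_erase, sub_eq_zero]
    rintro ⟨b, ⟨hb, -⟩, h⟩
    exact hb h.symm
  refine ⟨key, ?_⟩
  rcases s.eq_empty_or_nonempty with rfl | ⟨e, he⟩
  · intro h
    apply hchar Finset.card_empty
    have := congrArg (eval 1) h
    simpa [one_add_one_eq_two] using this
  · intro h
    exact key e he (by rw [h, eval_zero])

/-- The map is `l A` with `A = 1 + m X² ∏ (X - e)`, and `x j` is the `(n - j)`-th iterate of the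
critical value `l` of `0`. All critical points are in `k`. If the orbit of a critical value `l A(c)`
reaches `x 0` after `j` steps, degrees in `l` give `j = n`, and leading coefficients then give `c =
0`. -/
theorem exists_hasSimpleCriticalOrbit [IsAlgClosed k] (hl : Transcendental k l) (hd : 2 ≤ d)
    (hchar : d = 2 → (2 : k) ≠ 0) (n : ℕ) :
    ∃ (p : E[X]) (x : ℕ → E), p.natDegree = d ∧
      (∀ i, p.coeff i ∈ IntermediateField.adjoin k {l}) ∧
      x 0 ∈ IntermediateField.adjoin k {l} ∧ HasSimpleCriticalOrbit p 1 d n x := by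
  classical
  have : Infinite k := IsAlgClosed.instInfinite
  obtain ⟨s, hs, hscard⟩ := Infinite.exists_superset_card_eq ({0} : Finset k) (d - 1)
    (by simp; omega)
  set r := s.erase 0 with hr
  have hr0 : (0 : k) ∉ r := Finset.notMem_erase 0 s
  have hrcard : r.card + 2 = d := by
    rw [hr, Finset.card_erase_of_mem (by simpa using hs)]
    omega
  obtain ⟨hder, hder0⟩ := derivative_sq_mul_prod_ne_zero r hr0 (fun h => hchar (by omega))
  set A₁ : k[X] := X ^ 2 * ∏ e ∈ r, (X - C e) with hA₁
  have hA₁m : A₁.Monic := (monic_X_pow 2).mul (monic_prod_of_monic _ _ fun e _ => monic_X_sub_C e)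
  have hA₁d : A₁.natDegree = d := by
    rw [hA₁, Monic.natDegree_mul (monic_X_pow 2)
      (monic_prod_of_monic _ _ fun e _ => monic_X_sub_C e), natDegree_X_pow,
      natDegree_prod_of_monic _ _ fun e _ => monic_X_sub_C e]
    simp
    omega
  have hA₁0 : ∀ c, c ≠ 0 → (derivative A₁).eval c = 0 → A₁.eval c ≠ 0 := by
    intro c hc hc' h
    simp only [hA₁, eval_mul, eval_pow, eval_X, eval_prod, eval_sub, eval_C, mul_eq_zero,
      pow_eq_zero_iff, ne_eq, OfNat.ofNat_ne_zero, not_false_eq_true, hc, false_or,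
      Finset.prod_eq_zero_iff, sub_eq_zero] at h
    obtain ⟨e, he, rfl⟩ := h
    exact hder c he hc'
  -- Choose `m ≠ 0` such that `A(c) = 1 + m A₁(c)` is neither `0` nor a root of unity of order
  -- dividing `d ^ n`, for every nonzero critical point `c`. As `A₁(c) ≠ 0`, only finitely many `m`
  -- are excluded.
  obtain ⟨m, hm⟩ := exists_forall_eval_ne_zero
    (insert X ((((derivative A₁).roots.toFinset.filter (· ≠ 0)).image fun c =>
      (1 + C (A₁.eval c) * X) * ((1 + C (A₁.eval c) * X) ^ d ^ n - 1)))) (by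
    intro p hp
    rcases Finset.mem_insert.mp hp with rfl | hp
    · exact X_ne_zero
    obtain ⟨c, hc, rfl⟩ := Finset.mem_image.mp hp
    rw [Finset.mem_filter, Multiset.mem_toFinset, mem_roots hder0, IsRoot.def] at hc
    have hc1 := hA₁0 c hc.2 hc.1
    have hdeg : (1 + C (A₁.eval c) * X : k[X]).natDegree = 1 := by
      rw [add_comm, ← C_1, natDegree_linear hc1]
    refine mul_ne_zero (fun h => by rw [h] at hdeg; simp at hdeg) fun h => ?_
    have h1 := congrArg natDegree (sub_eq_zero.mp h)
    rw [natDegree_pow, hdeg, natDegree_one, mul_one] at h1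
    exact (pow_pos (by omega) n).ne' h1)
  have hm0 : m ≠ 0 := by simpa using hm X (Finset.mem_insert_self _ _)
  set A : k[X] := 1 + C m * A₁ with hA
  have hmA : (C m * A₁).natDegree = d := by rw [natDegree_C_mul hm0, hA₁d]
  have hAd : A.natDegree = d := by
    rw [hA, natDegree_add_eq_right_of_natDegree_lt, hmA]
    rw [hmA, natDegree_one]
    omega
  have hA0 : A.eval 0 = 1 := by simp [hA, hA₁]
  have hAc : ∀ c, c ≠ 0 → (derivative A₁).eval c = 0 → A.eval c ≠ 0 ∧ A.eval c ^ d ^ n ≠ 1 := by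
    intro c hc hc'
    have h1 := hm _ (Finset.mem_insert_of_mem (Finset.mem_image_of_mem _ (Finset.mem_filter.mpr
      ⟨Multiset.mem_toFinset.mpr ((mem_roots hder0).mpr hc'), hc⟩)))
    simp only [eval_mul, eval_add, eval_one, eval_C, eval_X, eval_sub, eval_pow, ne_eq,
      mul_eq_zero, not_or, sub_eq_zero] at h1
    simpa [hA, mul_comm] using h1
  have hl0 : l ≠ 0 := fun h => hl (h ▸ isAlgebraic_zero)
  have hlinj : Function.Injective (aeval l : k[X] →ₐ[k] E) :=
    transcendental_iff_injective.mp hl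
  have hmem : l ∈ IntermediateField.adjoin k {l} := IntermediateField.mem_adjoin_simple_self k l
  set T : k[X] → k[X] := fun V => X * A.comp V with hT
  refine ⟨C l * A.map (algebraMap k E), fun j => aeval l (T^[n - j] X), ?_, fun i => ?_, ?_, ?_⟩
  · rw [natDegree_C_mul hl0, natDegree_map, hAd]
  · rw [coeff_C_mul, coeff_map]
    exact mul_mem hmem (IntermediateField.algebraMap_mem _ _)
  · exact IntermediateField.algebra_adjoin_le_adjoin k _ (aeval_mem_adjoin_singleton k l)
  · refine ⟨fun j hj => ?_, ⟨l * algebraMap k E m, r.map ⟨_, (algebraMap k E).injective⟩, ?_, ?_,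
      ?_, ?_⟩, fun j hj w hw c hc hc' => ?_⟩
    · have : n - j = (n - (j + 1)) + 1 := by omega
      simp only [this, Function.iterate_succ_apply', eval_mul, eval_C, eval_map_algebraMap,
        eval_one, mul_one]
      rw [hT]
      simp [aeval_comp]
    · exact mul_ne_zero hl0 (by simpa using hm0)
    · simpa using hr0
    · rw [Finset.card_map, hrcard]
    · simp only [Nat.sub_self, Function.iterate_zero, id, aeval_X, mul_one, Finset.prod_map,
        Function.Embedding.coeFn_mk]
      simp [hA, hA₁, Polynomial.map_prod]
      ring
    · simp only [derivative_one, eval_zero, mul_zero, eval_one, mul_one] at hc hc'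
      rw [derivative_C_mul, derivative_map, eval_mul, eval_C, eval_map_algebraMap, mul_eq_zero,
        or_iff_right hl0] at hc'
      have hderA : derivative A = C m * derivative A₁ := by simp [hA]
      rw [hderA, map_mul, aeval_C, mul_eq_zero, or_iff_right (by simpa using hm0)] at hc'
      obtain ⟨c, rfl⟩ := exists_algebraMap_eq_of_aeval_eq_zero hder0 hc'
      rw [aeval_algebraMap_apply, map_eq_zero, ← eval_map_algebraMap] at hc'
      simp only [Algebra.algebraMap_self, Polynomial.map_id] at hc'
      have hw' : w = aeval l (C (A.eval c) * X : k[X]) := by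
        rw [← hc, eval_mul, eval_C, eval_map_algebraMap, aeval_algebraMap_apply, map_mul, aeval_C,
          aeval_X, mul_comm, coe_aeval_eq_eval]
      -- As `l` is transcendental, the orbit relation is an identity between the `n`-th `T`-iterate
      -- of `X` and the `j`-th of `A(c) X`.
      have hover := hlinj (isOver_iterate j hw' hw)
      rw [Nat.sub_zero] at hover
      have hAc0 : A.eval c ≠ 0 := by
        rcases eq_or_ne c 0 with rfl | hc0
        · rw [hA0]; exact one_ne_zero
        · exact (hAc c hc0 hc').1
      have hXd : 0 < (X : k[X]).natDegree := by simp
      have hdd : (X : k[X]).natDegree = (C (A.eval c) * X : k[X]).natDegree := by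
        rw [natDegree_C_mul hAc0]
      have hd0 : 0 < d := by omega
      have hjn : j = n := by
        refine (strictMono_natDegree_iterate_X_mul_comp hAd hd0 hXd).injective ?_
        change (T^[j] X).natDegree = (T^[n] X).natDegree
        rw [hover]
        exact (natDegree_iterate_X_mul_comp hAd hd0 j hXd hdd).2
      refine ⟨hjn, ?_⟩
      subst hjn
      rw [hw', Nat.sub_self, Function.iterate_zero, id]
      rcases eq_or_ne c 0 with rfl | hc0
      · rw [hA0, C_1, one_mul]
      -- The leading coefficients differ by the factor `A(c) ^ d ^ n`, which is not `1` by the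
      -- choice of `m`.
      · exfalso
        have h1 := leadingCoeff_iterate_X_mul_comp (a := A.eval c) hAd hd0 j hXd hdd (by simp)
        refine (hAc c hc0 hc').2 ?_
        change (T^[j] _).leadingCoeff = _ * (T^[j] _).leadingCoeff at h1
        rw [← hover] at h1
        refine mul_right_cancel₀ (leadingCoeff_ne_zero.mpr ?_) (h1.symm.trans (one_mul _).symm)
        intro h2
        have h3 := (natDegree_iterate_X_mul_comp hAd hd0 j hXd hdd).1
        change _ < (T^[j] _).natDegree at h3
        rw [h2, natDegree_zero] at h3
        omega

end CriticalOrbitExistence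

/-! ### Degree two in characteristic two -/

section QuadraticOrbit

variable {k E : Type*} [Field k] [Field E] [Algebra k E] {l : E}

/-- The element `w` is a quotient of values at `l` of monic polynomials whose degrees differ
by `i`. -/
def HasMonicRatio (k : Type*) {E : Type*} [Field k] [Field E] [Algebra k E] (l : E) (i : ℕ)
    (w : E) : Prop :=
  ∃ N D : k[X], N.Monic ∧ D.Monic ∧ N.natDegree = D.natDegree + i ∧ w * aeval l D = aeval l N

theorem aeval_ne_zero_of_monic (hl : Transcendental k l) {p : k[X]} (hp : p.Monic) :
    aeval l p ≠ 0 := fun h => hp.ne_zero ((transcendental_iff.mp hl) p h)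

/-- Cross-multiplication gives an identity of polynomials in the transcendental `l`. The index is
therefore an invariant of `w`, and it will measure depth in the orbit. -/
theorem HasMonicRatio.unique (hl : Transcendental k l) {i j : ℕ} {w : E}
    (hi : HasMonicRatio k l i w) (hj : HasMonicRatio k l j w) : i = j := by
  obtain ⟨N, D, hN, hD, hND, hw⟩ := hi
  obtain ⟨N', D', hN', hD', hND', hw'⟩ := hj
  have h : N * D' = N' * D := by
    apply transcendental_iff_injective.mp hl
    simp only [map_mul, ← hw, ← hw']
    ring
  have := congrArg natDegree h
  rw [hN.natDegree_mul hD', hN'.natDegree_mul hD] at this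
  omega

theorem HasMonicRatio.self (k : Type*) {E : Type*} [Field k] [Field E] [Algebra k E] (l : E) :
    HasMonicRatio k l 1 l :=
  ⟨X, 1, monic_X, monic_one, by simp, by simp⟩

theorem HasMonicRatio.add_one_ne_zero (hl : Transcendental k l) {i : ℕ} {w : E}
    (h : HasMonicRatio k l i w) (hi : 0 < i) : w + 1 ≠ 0 := by
  obtain ⟨N, D, hN, hD, hND, hw⟩ := h
  intro h0
  have hm : (N + D).Monic :=
    hN.add_of_left (degree_lt_degree (by omega))
  apply aeval_ne_zero_of_monic hl hm
  rw [map_add, ← hw]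
  linear_combination h0 * aeval l D

/-- For `w = N / D` the image is `X (N² + N D + D²) / (D (N + D))`; both parts stay monic because
`N` has larger degree than `D`. -/
theorem HasMonicRatio.step {i : ℕ} {w u : E}
    (h : HasMonicRatio k l i w) (hi : 0 < i) (hu : l * (w ^ 2 + w + 1) = u * (w + 1)) :
    HasMonicRatio k l (i + 1) u := by
  obtain ⟨N, D, hN, hD, hND, hw⟩ := h
  have hm : (N + D).Monic := hN.add_of_left (degree_lt_degree (by omega))
  have hmd : (N + D).natDegree = N.natDegree :=
    natDegree_add_eq_left_of_natDegree_lt (by omega)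
  have hlt : (D * D).natDegree < (N * (N + D)).natDegree := by
    rw [hD.natDegree_mul hD, hN.natDegree_mul hm, hmd]
    omega
  have hm2 : (N * (N + D) + D * D).Monic :=
    (hN.mul hm).add_of_left (degree_lt_degree hlt)
  refine ⟨X * (N * (N + D) + D * D), D * (N + D), monic_X.mul hm2, hD.mul hm, ?_, ?_⟩
  · rw [monic_X.natDegree_mul hm2, natDegree_add_eq_left_of_natDegree_lt hlt,
      hN.natDegree_mul hm, hD.natDegree_mul hm, hmd, natDegree_X]
    omega
  · simp only [map_mul, map_add, aeval_X, ← hw]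
    linear_combination -(aeval l D) ^ 2 * hu

/-- The orbit of `l` under `l (X² + X + 1) / (X + 1)`. -/
noncomputable def quadOrbit (l : E) (n : ℕ) : E :=
  (fun w => l * (w ^ 2 + w + 1) / (w + 1))^[n] l

theorem quadOrbit_succ (l : E) (n : ℕ) : quadOrbit l (n + 1) =
    l * (quadOrbit l n ^ 2 + quadOrbit l n + 1) / (quadOrbit l n + 1) := by
  rw [quadOrbit, Function.iterate_succ_apply', ← quadOrbit]

theorem hasMonicRatio_quadOrbit (hl : Transcendental k l) (n : ℕ) :
    HasMonicRatio k l (n + 1) (quadOrbit l n) := by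
  induction n with
  | zero => exact HasMonicRatio.self k l
  | succ n ih =>
    refine ih.step n.succ_pos ?_
    rw [quadOrbit_succ,
      div_mul_cancel₀ _ (ih.add_one_ne_zero hl n.succ_pos)]

theorem quadOrbit_mem (k : Type*) {E : Type*} [Field k] [Field E] [Algebra k E] (l : E) (n : ℕ) :
    quadOrbit l n ∈ IntermediateField.adjoin k {l} := by
  have hmem : l ∈ IntermediateField.adjoin k {l} := IntermediateField.mem_adjoin_simple_self k l
  induction n with
  | zero => exact hmem
  | succ n ih =>
    rw [quadOrbit_succ]
    exact div_mem (mul_mem hmem (add_mem (add_mem (pow_mem ih 2) ih) (one_mem _)))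
      (add_mem ih (one_mem _))

theorem HasMonicRatio.of_isOver (j : ℕ) {i : ℕ} {v w : E}
    (hi : 0 < i) (hw : HasMonicRatio k l i w)
    (h : IsOver (C l * (X ^ 2 + X + 1)) (X + 1) v j w) : HasMonicRatio k l (i + j) v := by
  induction j generalizing w i with
  | zero => exact (h : w = v) ▸ hw
  | succ j ih =>
    obtain ⟨u, hu, hwu⟩ := h
    have := ih i.succ_pos (hw.step hi (by simpa using hwu)) hu
    rwa [Nat.succ_eq_add_one, add_assoc, add_comm 1 j] at this

/-- In characteristic two the derivatives of numerator and denominator are `l` and `1`, so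
criticality over `w` forces `w = l`, and then `c = 0`. The index of `l` is `1` and that of `x 0` is
`n + 1`, so the depth is `n`. -/
theorem hasSimpleCriticalOrbit_quadOrbit (hl : Transcendental k l) (h2 : (2 : k) = 0) (n : ℕ) :
    HasSimpleCriticalOrbit (C l * (X ^ 2 + X + 1)) (X + 1) 2 n fun j => quadOrbit l (n - j) := by
  have hl0 : l ≠ 0 := fun h => hl (h ▸ isAlgebraic_zero)
  have h2E : (2 : E) = 0 := by
    rw [← map_ofNat (algebraMap k E) 2, h2, map_zero]
  refine ⟨fun j hj => ?_, ⟨l, ∅, hl0, by simp, by simp, ?_⟩, fun j hj w hw c hc hc' => ?_⟩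
  · have : n - j = (n - (j + 1)) + 1 := by omega
    have hq := hasMonicRatio_quadOrbit (k := k) hl (n - (j + 1))
    simp only [this]
    rw [quadOrbit_succ]
    simp only [eval_mul, eval_C, eval_add, eval_pow, eval_X, eval_one]
    rw [div_mul_cancel₀ _ (hq.add_one_ne_zero hl (Nat.succ_pos _))]
  · simp only [Nat.sub_self, quadOrbit, Function.iterate_zero, id, Finset.prod_empty, mul_one]
    ring
  · simp only [eval_mul, eval_C, eval_add, eval_pow, eval_X, eval_one, derivative_mul,
      derivative_C, derivative_add, derivative_X, derivative_one, derivative_X_pow] at hc hc'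
    simp [h2E] at hc'
    subst hc'
    refine ⟨?_, by simp [quadOrbit]⟩
    have h1 := (HasMonicRatio.self k l).of_isOver j one_pos hw
    have h3 := h1.unique hl (hasMonicRatio_quadOrbit hl _)
    omega

theorem exists_hasSimpleCriticalOrbit_rat {d : ℕ} [IsAlgClosed k] (hl : Transcendental k l)
    (hd : 2 ≤ d) (n : ℕ) :
    ∃ (p q : E[X]) (x : ℕ → E), p.natDegree = d ∧ q.natDegree < d ∧ IsCoprime p q ∧
      (∀ i, p.coeff i ∈ IntermediateField.adjoin k {l}) ∧
      (∀ i, q.coeff i ∈ IntermediateField.adjoin k {l}) ∧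
      x 0 ∈ IntermediateField.adjoin k {l} ∧ HasSimpleCriticalOrbit p q d n x := by
  by_cases h : d = 2 ∧ (2 : k) = 0
  · obtain ⟨rfl, h2⟩ := h
    have hl0 : l ≠ 0 := fun h => hl (h ▸ isAlgebraic_zero)
    have hq : (X + 1 : E[X]).natDegree = 1 := by rw [← C_1, natDegree_X_add_C]
    have hmem : l ∈ IntermediateField.adjoin k {l} :=
      IntermediateField.mem_adjoin_simple_self k l
    refine ⟨C l * (X ^ 2 + X + 1), X + 1, _, ?_, ?_, ?_, fun i => ?_, fun i => ?_, ?_,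
      hasSimpleCriticalOrbit_quadOrbit hl h2 n⟩
    · rw [natDegree_C_mul hl0]
      compute_degree!
    · rw [hq]; norm_num
    · refine (isCoprime_mul_unit_left_left (isUnit_C.mpr hl0.isUnit) _ _).mpr ⟨1, -X, ?_⟩
      ring
    · rw [coeff_C_mul]
      refine mul_mem hmem ?_
      simp only [coeff_add, coeff_X_pow, coeff_X, coeff_one]
      refine add_mem (add_mem ?_ ?_) ?_ <;> split_ifs <;> first | exact one_mem _ | exact zero_mem _
    · simp only [coeff_add, coeff_X, coeff_one]
      refine add_mem ?_ ?_ <;> split_ifs <;> first | exact one_mem _ | exact zero_mem _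
    · exact quadOrbit_mem k l _
  · obtain ⟨p, x, h1, h2, h3, h4⟩ := exists_hasSimpleCriticalOrbit hl hd
      (fun hd h2 => h ⟨hd, h2⟩) n
    refine ⟨p, 1, x, h1, by rw [natDegree_one]; omega, isCoprime_one_right, h2, fun i => ?_, h3, h4⟩
    rw [coeff_one]
    split_ifs
    · exact one_mem _
    · exact zero_mem _

end QuadraticOrbit

/-! ### Passing to a larger algebraically closed field -/

section Transfer

variable {K Ω Ω' : Type*} [Field K] [Field Ω] [Field Ω'] [Algebra K Ω] [Algebra K Ω']
  [Algebra Ω Ω'] [IsScalarTower K Ω Ω'] {P Q : K[X]} {d : ℕ}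

/-- A transcendental element, viewed in an extension field. -/
def TransPt.map (Ω' : Type*) [Field Ω'] [Algebra K Ω'] [Algebra Ω Ω'] [IsScalarTower K Ω Ω']
    (y : TransPt K Ω) : TransPt K Ω' :=
  ⟨algebraMap Ω Ω' y.1, fun h => y.2
    ((isAlgebraic_algebraMap_iff (algebraMap Ω Ω').injective).mp h)⟩

theorem TransPt.map_injective :
    Function.Injective (TransPt.map Ω' : TransPt K Ω → TransPt K Ω') := fun _ _ h =>
  Subtype.ext ((algebraMap Ω Ω').injective (congrArg Subtype.val h))

theorem IsRatMap.toFun_map (h : IsRatMap P Q d) (y : TransPt K Ω) :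
    h.toFun (y.map Ω') = (h.toFun y).map Ω' := by
  apply Subtype.ext
  simp [toFun, TransPt.map, aeval_algebraMap_apply]

theorem IsRatMap.iterate_toFun_map (h : IsRatMap P Q d) (n : ℕ) (y : TransPt K Ω) :
    h.toFun^[n] (y.map Ω') = (h.toFun^[n] y).map Ω' := by
  induction n generalizing y with
  | zero => rfl
  | succ n ih => rw [Function.iterate_succ_apply, Function.iterate_succ_apply, toFun_map, ih]

/-- A fibre over a transcendental point has `d` elements in either field, so enlarging the field
creates no new preimages. -/
theorem IsRatMap.exists_map_eq [IsAlgClosed Ω] [IsAlgClosed Ω'] (h : IsRatMap P Q d) (n : ℕ)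
    {t : TransPt K Ω} (y : TransPt K Ω') (hy : h.toFun^[n] y = t.map Ω') :
    ∃ z : TransPt K Ω, z.map Ω' = y := by
  classical
  induction n generalizing y with
  | zero => exact ⟨t, hy.symm⟩
  | succ n ih =>
    rw [Function.iterate_succ_apply] at hy
    obtain ⟨w, hw⟩ := ih _ hy
    have hsub : (IsRatMap.fibre P Q w.1).image (algebraMap Ω Ω') ⊆
        IsRatMap.fibre P Q (w.map Ω').1 := by
      intro a ha
      obtain ⟨b, hb, rfl⟩ := Finset.mem_image.mp ha
      rw [h.mem_fibre w.2] at hb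
      rw [h.mem_fibre (w.map Ω').2, TransPt.map]
      simp only [aeval_algebraMap_apply, hb, map_mul]
    have heq := Finset.eq_of_subset_of_card_le hsub (by
      rw [h.card_fibre (w.map Ω').2, Finset.card_image_of_injective _ (algebraMap Ω Ω').injective,
        h.card_fibre w.2])
    have hymem : y.1 ∈ IsRatMap.fibre P Q (w.map Ω').1 := by
      rw [h.mem_fibre (w.map Ω').2, ← h.toFun_eq_iff, hw]
    rw [← heq] at hymem
    obtain ⟨b, hb, hby⟩ := Finset.mem_image.mp hymem
    exact ⟨⟨b, h.transcendental_of_eq w.2 ((h.mem_fibre w.2).mp hb)⟩, Subtype.ext hby⟩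

theorem IsRatMap.exists_swap_of_map [IsAlgClosed Ω] [IsAlgClosed Ω'] {F : Type*} [Field F]
    [Algebra K F] [Algebra F Ω] [Algebra F Ω'] [IsScalarTower K F Ω] [IsScalarTower K F Ω']
    [IsScalarTower F Ω Ω'] [Normal F Ω] [DecidableEq (TransPt K Ω)] [DecidableEq (TransPt K Ω')]
    (h : IsRatMap P Q d) (n : ℕ) {t : TransPt K Ω}
    (hswap : ∃ a b : TransPt K Ω', a ≠ b ∧ h.toFun a = h.toFun b ∧
      h.toFun^[n + 1] a = t.map Ω' ∧
      ∃ g : Ω' ≃ₐ[F] Ω', ∀ y, h.toFun^[n + 1] y = t.map Ω' → g • y = Equiv.swap a b y) :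
    ∃ a b : TransPt K Ω, a ≠ b ∧ h.toFun a = h.toFun b ∧ h.toFun^[n + 1] a = t ∧
      ∃ g : Ω ≃ₐ[F] Ω, ∀ y, h.toFun^[n + 1] y = t → g • y = Equiv.swap a b y := by
  obtain ⟨a, b, hab, hfab, ha, g, hg⟩ := hswap
  have hb : h.toFun^[n + 1] b = t.map Ω' := by
    rw [Function.iterate_succ_apply, ← hfab, ← Function.iterate_succ_apply, ha]
  obtain ⟨a, rfl⟩ := h.exists_map_eq (n + 1) a ha
  obtain ⟨b, rfl⟩ := h.exists_map_eq (n + 1) b hb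
  rw [h.toFun_map, h.toFun_map] at hfab
  rw [h.iterate_toFun_map] at ha
  refine ⟨a, b, fun h => hab (h ▸ rfl), TransPt.map_injective hfab, TransPt.map_injective ha,
    g.restrictNormal Ω, fun y hy => TransPt.map_injective (Ω' := Ω') ?_⟩
  have h1 := hg (y.map Ω') (by rw [h.iterate_toFun_map, hy])
  have h2 : (g.restrictNormal Ω • y).map Ω' = g • y.map Ω' :=
    Subtype.ext (g.restrictNormal_commutes Ω y.1)
  rw [h2, h1]
  exact (TransPt.map_injective.swap_apply a b y)

end Transfer

/-! ### From one sibling transposition to all of them -/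

section Conjugation

variable {k K Ω σ : Type*} [Field k] [Field K] [Field Ω] [Algebra k K] [Algebra K Ω] [Algebra k Ω]
  [IsScalarTower k K Ω] {P Q : K[X]} {d : ℕ} {c : σ → K} {i₀ i₁ : σ}

omit [Algebra k K] [IsScalarTower k K Ω] in
theorem IsRatMap.mem_of_iterate_toFun (h : IsRatMap P Q d) (L : IntermediateField k Ω)
    (hL : ∀ z, algebraMap K Ω z ∈ L) (n : ℕ) {w : TransPt K Ω} (hw : w.1 ∈ L) :
    (h.toFun^[n] w).1 ∈ L := by
  induction n with
  | zero => exact hw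
  | succ n ih =>
    rw [Function.iterate_succ_apply']
    have key (R : K[X]) : aeval (h.toFun^[n] w).1 R ∈ L := by
      rw [aeval_eq_sum_range]
      refine sum_mem fun i _ => ?_
      rw [Algebra.smul_def]
      exact mul_mem (hL _) (pow_mem ih i)
    exact div_mem (key P) (key Q)

/-- The `K`-automorphism moving one sibling pair to the other fixes `t`, the common iterate of both
pairs, hence fixes `K(t)`. Conjugating the given transposition by it yields the required one. -/
theorem IsRatMap.exists_swap_of_exists [Finite σ] [IsAlgClosed Ω] [Algebra (RatFunc K) Ω]
    [IsScalarTower K (RatFunc K) Ω] [Algebra.IsAlgebraic (RatFunc K) Ω]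
    [DecidableEq (TransPt K Ω)] (h : IsRatMap P Q d)
    (hg : IsGenericMap k P Q c i₀ i₁) (n : ℕ) {t : TransPt K Ω}
    (ht : t.1 = algebraMap (RatFunc K) Ω RatFunc.X)
    (hswap : ∃ a b : TransPt K Ω, a ≠ b ∧ h.toFun a = h.toFun b ∧ h.toFun^[n + 1] a = t ∧
      ∃ g : Ω ≃ₐ[RatFunc K] Ω, ∀ y, h.toFun^[n + 1] y = t → g • y = Equiv.swap a b y)
    {a' b' : TransPt K Ω} (hab' : a' ≠ b') (hfab' : h.toFun a' = h.toFun b')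
    (ha' : h.toFun^[n + 1] a' = t) :
    ∃ g : Ω ≃ₐ[RatFunc K] Ω, ∀ y, h.toFun^[n + 1] y = t → g • y = Equiv.swap a' b' y := by
  obtain ⟨a, b, hab, hfab, ha, g, hg'⟩ := hswap
  have htb : IsTranscendenceBasis K fun _ : Unit => t.1 := by
    have h1 : IsTranscendenceBasis K fun _ : Unit => (X : K[X]) :=
      IsTranscendenceBasis.polynomial Unit K
    have : Algebra.IsAlgebraic K[X] (RatFunc K) := IsLocalization.isAlgebraic _
      (nonZeroDivisors K[X])
    have h2 := (h1.algebraMap_comp (A := RatFunc K)).algebraMap_comp (A := Ω)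
    rwa [show (algebraMap (RatFunc K) Ω ∘ algebraMap K[X] (RatFunc K) ∘ fun _ : Unit => X) =
      fun _ : Unit => t.1 by
        funext; simp [ht, RatFunc.algebraMap_X]] at h2
  have hw {a b : TransPt K Ω} (hfab : h.toFun a = h.toFun b) (ha : h.toFun^[n + 1] a = t) :
      aeval a.1 P = (h.toFun a).1 * aeval a.1 Q ∧ aeval b.1 P = (h.toFun a).1 * aeval b.1 Q ∧
      ∀ L : IntermediateField k Ω, (∀ z, algebraMap K Ω z ∈ L) → (h.toFun a).1 ∈ L → t.1 ∈ L := by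
    refine ⟨(h.toFun_eq_iff _ _).mp rfl, (h.toFun_eq_iff _ _).mp hfab.symm, fun L hL hwL => ?_⟩
    rw [← ha, Function.iterate_succ_apply]
    exact h.mem_of_iterate_toFun L hL n hwL
  obtain ⟨h1, h2, h3⟩ := hw hfab ha
  obtain ⟨h1', h2', h3'⟩ := hw hfab' ha'
  obtain ⟨Φ, hΦa, hΦb, hΦw⟩ := hg.exists_algEquiv htb (fun h => hab (Subtype.ext h)) h1 h2 h3
    (fun h => hab' (Subtype.ext h)) h1' h2' h3'
  have hΦa' : Φ • a = a' := Subtype.ext hΦa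
  have hΦb' : Φ • b = b' := Subtype.ext hΦb
  have hΦit (m : ℕ) (y : TransPt K Ω) : h.toFun^[m] (Φ • y) = Φ • h.toFun^[m] y := by
    induction m generalizing y with
    | zero => rfl
    | succ m ih => rw [Function.iterate_succ_apply, Function.iterate_succ_apply, h.toFun_smul, ih]
  have hΦt : Φ • t = t := by
    rw [← ha, ← hΦit, hΦa', ha', ha]
  have hΦF (z : RatFunc K) : Φ (algebraMap (RatFunc K) Ω z) = algebraMap (RatFunc K) Ω z := by
    have : (Φ : Ω →+* Ω).comp (algebraMap (RatFunc K) Ω) = algebraMap (RatFunc K) Ω := by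
      refine IsLocalization.ringHom_ext (nonZeroDivisors K[X]) (Polynomial.ringHom_ext ?_ ?_)
      · intro z
        simp only [RingHom.comp_apply, ← Polynomial.algebraMap_eq, RingHom.coe_coe]
        rw [← IsScalarTower.algebraMap_apply K K[X] (RatFunc K),
          ← IsScalarTower.algebraMap_apply K (RatFunc K) Ω]
        exact Φ.commutes z
      · simp only [RingHom.comp_apply, RatFunc.algebraMap_X, ← ht]
        exact congrArg Subtype.val hΦt
    exact congrArg (fun φ : RatFunc K →+* Ω => φ z) this
  let Ψ : Ω ≃ₐ[RatFunc K] Ω := AlgEquiv.ofRingEquiv (f := (Φ : Ω ≃+* Ω)) hΦF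
  have hΨ (y : TransPt K Ω) : Ψ • y = Φ • y := rfl
  refine ⟨Ψ * g * Ψ⁻¹, fun y hy => ?_⟩
  obtain ⟨y, rfl⟩ : ∃ z, Φ • z = y := ⟨Φ⁻¹ • y, smul_inv_smul Φ y⟩
  have hy' : h.toFun^[n + 1] y = t := by
    rw [hΦit] at hy
    exact smul_left_cancel Φ (hy.trans hΦt.symm)
  rw [mul_smul, mul_smul, ← hΨ y, inv_smul_smul, hg' y hy', hΨ, hΨ, ← hΦa', ← hΦb']
  exact ((MulAction.injective Φ).swap_apply a b y).symm

end Conjugation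

/-- If the roots of `p` are the preimages of `t` under an iterate of `P / Q`, and the Galois group
contains all sibling transpositions on all levels, then it is the full iterated wreath product. -/
theorem IsRatMap.galois_of_exists_swap {K F Ω : Type u} [Field K] [Field F] [Field Ω] [Algebra K F]
    [Algebra K Ω] [Algebra F Ω] [IsScalarTower K F Ω] [IsAlgClosed Ω] [Normal F Ω]
    [DecidableEq (TransPt K Ω)] {P Q : K[X]} {d : ℕ} (h : IsRatMap P Q d) (hd : 2 ≤ d)
    {t : TransPt K Ω} (ht : ∃ t₀ : F, algebraMap F Ω t₀ = t.1)
    (hswap : ∀ (n : ℕ) (a b : TransPt K Ω), a ≠ b → h.toFun a = h.toFun b →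
      h.toFun^[n + 1] a = t →
      ∃ g : Ω ≃ₐ[F] Ω, ∀ y, h.toFun^[n + 1] y = t → g • y = Equiv.swap a b y)
    (n : ℕ) (p : F[X])
    (hroots : ∀ y, y ∈ p.rootSet Ω ↔ ∃ z : TransPt K Ω, h.toFun^[n + 1] z = t ∧ z.1 = y) :
    IsGalois F p.SplittingField ∧
      Nonempty ((p.SplittingField ≃ₐ[F] p.SplittingField) ≃*
        iterWreath (Equiv.Perm (Fin d)) (Fin d) (n + 1)) ∧
      fixProp p ≤ 2 / (((n + 1 : ℕ) : ℚ) + 2) ∧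
      ((d, n + 1) ≠ (3, 1) → fixProp p < 2 / (((n + 1 : ℕ) : ℚ) + 2)) := by
  classical
  let e : ∀ w : TransPt K Ω, Fin d ≃ {y // h.toFun y = w} := fun w =>
    (h.nonempty_fibre_equiv w).some
  have hne : Nonempty (Fin d) := ⟨⟨0, by omega⟩⟩
  have hgt (g : Ω ≃ₐ[F] Ω) : g • t = t := by
    obtain ⟨t₀, ht₀⟩ := ht
    refine Subtype.ext ?_
    rw [coe_smul, ← ht₀]
    exact g.commutes t₀
  have hlev := levelStabilizer_eq_range (e := e) (G := Ω ≃ₐ[F] Ω) (f := h.toFun)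
    (fun g y => h.toFun_smul g y) hgt hswap n
  have hinj := treeLabel_injective e n t
  obtain ⟨hiso, hfix⟩ := galois_of_range_eq (S := Fin d) p n (fun v => (treeLabel e n t v).1)
    (fun v w hvw => hinj.1 (Subtype.ext hvw))
    (fun y => by
      rw [hroots]
      constructor
      · rintro ⟨z, hz, rfl⟩
        obtain ⟨v, rfl⟩ := exists_treeLabel_eq e n t z hz
        exact ⟨v, rfl⟩
      · rintro ⟨v, rfl⟩
        exact ⟨_, hinj.2 v, rfl⟩)
    (fun π => by
      rw [← hlev]
      exact exists_congr fun g => forall_congr' fun v =>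
        ⟨fun hv => Subtype.ext hv, fun hv => congrArg Subtype.val hv⟩)
  have hbound := one_sub_derangeProp_iterWreathHom (S := Fin d) (by simpa using hd) n
  rw [← hfix, Fintype.card_fin] at hbound
  have hcast : ((n + 1 : ℕ) : ℚ) + 2 = (n : ℚ) + 3 := by push_cast; ring
  rw [hcast]
  refine ⟨isGalois_splittingField_of_isSeparable (Ω := Ω) p fun y hy => ?_, hiso, hbound.1,
    fun hdn => hbound.2 fun h => hdn ?_⟩
  · obtain ⟨z, hz, rfl⟩ := (hroots y).mp hy
    exact h.isSeparable_of_iterate ht (n + 1) z hz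
  · simp only [Prod.mk.injEq] at h ⊢
    omega

/-! ### Embedding the field of generic coefficients and `t` in Laurent series -/

theorem transcendental_powerSeries_X (E : Type*) [Field E] :
    Transcendental E (PowerSeries.X : PowerSeries E) := by
  rw [transcendental_iff_injective]
  have : (aeval (PowerSeries.X : PowerSeries E) : E[X] →ₐ[E] PowerSeries E) = (Polynomial.coeToPowerSeries.algHom E) := by
    apply Polynomial.algHom_ext
    simp [Polynomial.coeToPowerSeries.algHom_apply]
  rw [this]
  intro p q h
  simpa [Polynomial.coeToPowerSeries.algHom_apply] using h

/-- Algebraically independent elements define an embedding of the rational function field over the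
field of fractions of a polynomial ring. -/
theorem AlgebraicIndependent.exists_ratFunc_ringHom {k L σ : Type*} [Field k] [Field L] [Algebra k L]
    {x : σ → L} {t : L} (h : AlgebraicIndependent k (Sum.elim (fun _ : Unit => t) x)) :
    ∃ ψ : RatFunc (FractionRing (MvPolynomial σ k)) →+* L,
      (∀ i, ψ (RatFunc.C (algebraMap (MvPolynomial σ k) _ (MvPolynomial.X i))) = x i) ∧
      ψ RatFunc.X = t := by
  obtain ⟨hx, ht⟩ := AlgebraicIndependent.sumElim_iff.mp h
  rw [algebraicIndependent_unique_type_iff] at ht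
  let K := FractionRing (MvPolynomial σ k)
  let φ : K →+* L := IsFractionRing.lift (K := K) (g := (MvPolynomial.aeval x : MvPolynomial σ k →ₐ[k] L).toRingHom) hx
  have hφ (p) : φ (algebraMap _ K p) = MvPolynomial.aeval x p := IsFractionRing.lift_algebraMap hx p
  let : Algebra K L := φ.toAlgebra
  let : Algebra (MvPolynomial σ k) L := (MvPolynomial.aeval x : MvPolynomial σ k →ₐ[k] L).toAlgebra
  have : IsScalarTower (MvPolynomial σ k) K L := IsScalarTower.of_algebraMap_eq fun p => (hφ p).symm
  have htK : Transcendental K t := by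
    rw [Transcendental, ← IsFractionRing.isAlgebraic_iff (MvPolynomial σ k) K L]
    refine (transcendental_ringHom_iff_of_comp_eq hx.aevalEquiv (RingHom.id L)
      Function.injective_id ?_).mp ht
    ext p <;> simp [RingHom.algebraMap_toAlgebra]
  refine ⟨IsFractionRing.lift (K := RatFunc K) (g := (aeval t : K[X] →ₐ[K] L).toRingHom)
    (transcendental_iff_injective.mp htK), fun i => ?_, ?_⟩
  · rw [← RatFunc.algebraMap_C, IsFractionRing.lift_algebraMap]
    simp only [AlgHom.toRingHom_eq_coe, RingHom.coe_coe, ← Polynomial.algebraMap_eq]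
    exact ((aeval t : K[X] →ₐ[K] L).commutes _).trans ((hφ _).trans (by simp))
  · rw [← RatFunc.algebraMap_X, IsFractionRing.lift_algebraMap]
    simp

section LocalModel

variable {k E₁ E σ : Type*} [Field k] [Field E₁] [Field E] [Algebra k E₁] [Algebra E₁ E]
  [Finite σ] {l : E} {ξ : σ → E}

/-- The elements `X`, `l`, `ξ i` are independent and can be recovered from `v + X`, `l`, `p i + X² ξ
i`: subtract `v` to get `X`, then subtract `p i` and divide by `X²`. So the `ξ i` make the
coefficients independent while leaving the first-order behaviour alone. -/
theorem AlgebraicIndependent.powerSeries_perturbation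
    (h : AlgebraicIndependent E₁ fun o : Option σ => o.elim l ξ) {p : σ → E} {v : E}
    (hp : ∀ i, p i ∈ IntermediateField.adjoin E₁ {l}) (hv : v ∈ IntermediateField.adjoin E₁ {l})
    [Algebra k (FractionRing (PowerSeries E))] [IsScalarTower k E₁ (FractionRing (PowerSeries E))] :
    AlgebraicIndependent k (Sum.elim
      (fun _ : Unit => algebraMap (PowerSeries E) (FractionRing (PowerSeries E))
        (PowerSeries.C v + PowerSeries.X))
      fun i => algebraMap (PowerSeries E) (FractionRing (PowerSeries E))
        (PowerSeries.C (p i) + PowerSeries.X ^ 2 * PowerSeries.C (ξ i))) := by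
  let L := FractionRing (PowerSeries E)
  have hX : AlgebraicIndependent E
      (fun _ : Unit => algebraMap (PowerSeries E) L PowerSeries.X) := by
    rw [algebraicIndependent_unique_type_iff]
    exact (transcendental_algebraMap_iff (IsFractionRing.injective (PowerSeries E) L)).mpr
      (transcendental_powerSeries_X E)
  have h0 := h.sumElim_comp hX
  have hEL (z : E) : algebraMap E L z = algebraMap (PowerSeries E) L (PowerSeries.C z) :=
    IsScalarTower.algebraMap_apply E (PowerSeries E) L z
  -- `l` stays in the family so that `v` and `p i` can be subtracted and the index sets match; it is
  -- dropped at the end.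
  let y : Unit ⊕ Option σ → L := Sum.elim
    (fun _ => algebraMap (PowerSeries E) L (PowerSeries.C v + PowerSeries.X))
    (fun o => o.elim (algebraMap E L l) fun i => algebraMap (PowerSeries E) L
        (PowerSeries.C (p i) + PowerSeries.X ^ 2 * PowerSeries.C (ξ i)))
  let A := IntermediateField.adjoin E₁ (Set.range y)
  have hyA (o) : y o ∈ A := IntermediateField.subset_adjoin E₁ _ ⟨o, rfl⟩
  have hl : ∀ z ∈ IntermediateField.adjoin E₁ {l}, algebraMap E L z ∈ A := by
    intro z hz
    refine algebraMap_mem_adjoin (L := A) ?_ hz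
    rintro _ rfl
    exact hyA (Sum.inr none)
  have hXA : algebraMap (PowerSeries E) L PowerSeries.X ∈ A := by
    have h1 := sub_mem (hyA (Sum.inl ())) (hl v hv)
    simpa [y, hEL] using h1
  have hX0 : algebraMap (PowerSeries E) L PowerSeries.X ≠ 0 := by
    rw [ne_eq, IsFractionRing.to_map_eq_zero_iff]
    exact PowerSeries.X_ne_zero
  have h1 : AlgebraicIndependent E₁ y := by
    refine h0.of_mem_adjoin ?_
    rintro (_ | _ | i)
    · exact hXA
    · exact hyA (Sum.inr none)
    · have h2 := div_mem (sub_mem (hyA (Sum.inr (some i))) (hl _ (hp i))) (pow_mem hXA 2)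
      have h3 : (y (Sum.inr (some i)) - algebraMap E L (p i)) /
          algebraMap (PowerSeries E) L PowerSeries.X ^ 2 = algebraMap E L (ξ i) := by
        rw [div_eq_iff (pow_ne_zero 2 hX0)]
        simp [y, hEL, mul_comm]
      rw [h3] at h2
      exact h2
  have h2 := h1.comp (Sum.map id some : Unit ⊕ σ → Unit ⊕ Option σ)
    (Sum.map_injective.mpr ⟨Function.injective_id, Option.some_injective σ⟩)
  have h3 := h2.restrictScalars (R := k) (algebraMap k E₁).injective
  convert h3 using 1
  ext (i | i) <;> rfl

end LocalModel

theorem algebraicIndependent_algHom_X {k E σ : Type*} [Field k] [Field E] [Algebra k E]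
    (g : MvPolynomial (Option σ) k →ₐ[k] E) (hg : Function.Injective g) :
    AlgebraicIndependent k fun o : Option σ =>
      o.elim (g (MvPolynomial.X none)) fun i => g (MvPolynomial.X (some i)) := by
  convert (MvPolynomial.algebraicIndependent_X (Option σ) k).map' (f := g) hg using 1
  ext (_ | i) <;> rfl

theorem exists_isAlgClosed_algebraicIndependent (k : Type u) (σ : Type v) [Field k] :
    ∃ (E : Type (max u v)) (_ : Field E) (_ : Algebra k E) (_ : IsAlgClosed E) (l : E) (ξ : σ → E),
      AlgebraicIndependent k fun o : Option σ => o.elim l ξ := by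
  let R := MvPolynomial (Option σ) k
  let E := AlgebraicClosure (FractionRing R)
  let f : R →+* E := (algebraMap (FractionRing R) E).comp (algebraMap R (FractionRing R))
  have hf : Function.Injective f :=
    (algebraMap (FractionRing R) E).injective.comp (IsFractionRing.injective R (FractionRing R))
  let : Algebra k E := (f.comp MvPolynomial.C).toAlgebra
  let g : R →ₐ[k] E := { f with commutes' := fun _ => rfl }
  refine ⟨E, inferInstance, inferInstance, inferInstance, g (MvPolynomial.X none),
    fun i => g (MvPolynomial.X (some i)), algebraicIndependent_algHom_X g hf⟩

theorem AlgebraicIndependent.exists_ratFunc_powerSeries_ringHom (k : Type*) {E₁ E σ : Type*}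
    [Field k] [Field E₁] [Field E] [Algebra k E₁] [Algebra E₁ E] [Finite σ] {l : E} {ξ : σ → E}
    (h : AlgebraicIndependent E₁ fun o : Option σ => o.elim l ξ) {p : σ → E} {v : E}
    (hp : ∀ i, p i ∈ IntermediateField.adjoin E₁ {l})
    (hv : v ∈ IntermediateField.adjoin E₁ {l}) :
    ∃ ψ : RatFunc (FractionRing (MvPolynomial σ k)) →+* FractionRing (PowerSeries E),
      (∀ i, ψ (RatFunc.C (algebraMap (MvPolynomial σ k) _ (MvPolynomial.X i))) =
        algebraMap (PowerSeries E) _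
          (PowerSeries.C (p i) + PowerSeries.X ^ 2 * PowerSeries.C (ξ i))) ∧
      ψ RatFunc.X = algebraMap (PowerSeries E) _ (PowerSeries.C v + PowerSeries.X) := by
  let : Algebra k (FractionRing (PowerSeries E)) :=
    ((algebraMap E₁ (FractionRing (PowerSeries E))).comp (algebraMap k E₁)).toAlgebra
  have : IsScalarTower k E₁ (FractionRing (PowerSeries E)) :=
    IsScalarTower.of_algebraMap_eq fun _ => rfl
  exact (h.powerSeries_perturbation (k := k) hp hv).exists_ratFunc_ringHom

/-- An embedding of `K(t)` in a field of Laurent series that maps `P / Q` to a perturbation of a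
map with a simple critical orbit yields a sibling transposition. -/
theorem IsRatMap.exists_swap_of_ringHom {K E Ω : Type u} [Field K] [Field E] [IsAlgClosed E]
    [Field Ω] [IsAlgClosed Ω] [Algebra K Ω] [Algebra (RatFunc K) Ω]
    [IsScalarTower K (RatFunc K) Ω] [Algebra.IsAlgebraic (RatFunc K) Ω]
    [DecidableEq (TransPt K Ω)] {P Q : K[X]} {P₀ Q₀ : E[X]} {P' Q' : (PowerSeries E)[X]}
    {d n : ℕ} {x : ℕ → E} (h : IsRatMap P Q d) (hp : IsPerturbation P₀ Q₀ P' Q' d)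
    (horb : HasSimpleCriticalOrbit P₀ Q₀ d n x)
    (ψ : RatFunc K →+* FractionRing (PowerSeries E))
    (hP : P.map (ψ.comp RatFunc.C) = P'.map (algebraMap (PowerSeries E) _))
    (hQ : Q.map (ψ.comp RatFunc.C) = Q'.map (algebraMap (PowerSeries E) _))
    (hX : ψ RatFunc.X = algebraMap (PowerSeries E) _ (PowerSeries.C (x 0) + PowerSeries.X))
    {t : TransPt K Ω} (ht : t.1 = algebraMap (RatFunc K) Ω RatFunc.X) :
    ∃ a b : TransPt K Ω, a ≠ b ∧ h.toFun a = h.toFun b ∧ h.toFun^[n + 1] a = t ∧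
      ∃ g : Ω ≃ₐ[RatFunc K] Ω, ∀ y, h.toFun^[n + 1] y = t → g • y = Equiv.swap a b y := by
  classical
  let L := FractionRing (PowerSeries E)
  let Ω' := AlgebraicClosure L
  let : Algebra (RatFunc K) L := ψ.toAlgebra
  let : Algebra K L := (ψ.comp RatFunc.C).toAlgebra
  have : IsScalarTower K (RatFunc K) L := IsScalarTower.of_algebraMap_eq fun _ => rfl
  let ι : Ω →ₐ[RatFunc K] Ω' := IsAlgClosed.lift
  let : Algebra Ω Ω' := ι.toRingHom.toAlgebra
  have : IsScalarTower (RatFunc K) Ω Ω' := IsScalarTower.of_algebraMap_eq fun z =>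
    (ι.commutes z).symm
  have : IsScalarTower K (RatFunc K) Ω' := inferInstance
  have : IsScalarTower K Ω Ω' := IsScalarTower.of_algebraMap_eq fun z => by
    rw [IsScalarTower.algebraMap_apply K (RatFunc K) Ω, ← IsScalarTower.algebraMap_apply _ Ω Ω',
      ← IsScalarTower.algebraMap_apply K (RatFunc K) Ω']
  have : Normal (RatFunc K) Ω := normal_iff.mpr fun z =>
    ⟨Algebra.IsIntegral.isIntegral z, IsAlgClosed.splits _⟩
  refine h.exists_swap_of_map (Ω' := Ω') (F := RatFunc K) n ?_
  obtain ⟨a, b, hab, hfab, ha, g, hg⟩ := horb.exists_swap (K := K) (L := L) (Ω := Ω')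
    (t := t.map Ω') h hp ⟨hP, hQ⟩ (by
      change algebraMap Ω Ω' t.1 = algebraMap L Ω' (algebraMap _ L _)
      rw [ht, ← IsScalarTower.algebraMap_apply, ← hX]
      exact IsScalarTower.algebraMap_apply (RatFunc K) L Ω' _)
  exact ⟨a, b, hab, hfab, ha, g.restrictScalars (RatFunc K), hg⟩

/-! ### Specializing the generic maps -/

section Coefficients

variable {K : Type u} [Field K] {d : ℕ}

theorem coeff_polyOfCoeffs (c : Fin (d + 1) → K) (n : ℕ) :
    (polyOfCoeffs c).coeff n = if h : n < d + 1 then c ⟨n, h⟩ else 0 := by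
  simp only [polyOfCoeffs, finsetSum_coeff, coeff_C_mul, coeff_X_pow]
  split_ifs with h
  · rw [Finset.sum_eq_single ⟨n, h⟩]
    · simp
    · intro i _ hi
      rw [if_neg, mul_zero]
      rintro rfl
      exact hi rfl
    · simp
  · refine Finset.sum_eq_zero fun i _ => ?_
    rw [if_neg (by have := i.2; omega), mul_zero]

theorem natDegree_polyOfCoeffs_le (c : Fin (d + 1) → K) : (polyOfCoeffs c).natDegree ≤ d := by
  rw [natDegree_le_iff_coeff_eq_zero]
  intro n hn
  rw [coeff_polyOfCoeffs, dif_neg (by omega)]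

theorem map_polyOfCoeffs_eq {E L : Type u} [Field E] [Field L] [Algebra (PowerSeries E) L]
    (c : Fin (d + 1) → K) (ξ : Fin (d + 1) → E) (φ : K →+* L) {p : E[X]} (hp : p.natDegree ≤ d)
    (h : ∀ i, φ (c i) = algebraMap (PowerSeries E) L
      (PowerSeries.C (p.coeff i) + PowerSeries.X ^ 2 * PowerSeries.C (ξ i))) :
    (polyOfCoeffs c).map φ = (p.map PowerSeries.C + C (PowerSeries.X ^ 2) *
      (polyOfCoeffs ξ).map PowerSeries.C).map (algebraMap (PowerSeries E) L) := by
  ext n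
  rw [coeff_map, coeff_map, coeff_add, coeff_C_mul, coeff_map, coeff_map, coeff_polyOfCoeffs,
    coeff_polyOfCoeffs]
  split_ifs with hn
  · exact h ⟨n, hn⟩
  · rw [coeff_eq_zero_of_natDegree_lt (by omega)]
    simp

theorem natDegree_perturbation_le {E : Type u} [Field E] (ξ : Fin (d + 1) → E) {p : E[X]}
    (hp : p.natDegree ≤ d) : (p.map PowerSeries.C + C (PowerSeries.X ^ 2) *
      (polyOfCoeffs ξ).map PowerSeries.C).natDegree ≤ d :=
  (natDegree_add_le _ _).trans (max_le (natDegree_map_le.trans hp)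
    ((natDegree_C_mul_le _ _).trans (natDegree_map_le.trans (natDegree_polyOfCoeffs_le ξ))))

end Coefficients

section Generic

variable {k : Type u} [Field k] {d : ℕ}

/-- The special polynomial depends on `n` and is defined over the algebraic closure of `k` with a
transcendental `l` adjoined. Excluding degree two in characteristic two is what makes it available.
-/
theorem exists_swap_genericPoly (hd : 2 ≤ d) (hchar : (d, ringChar k) ≠ (2, 2)) {Ω : Type u}
    [Field Ω] [IsAlgClosed Ω] [Algebra (PolyCoeffField k d) Ω]
    [Algebra (RatFunc (PolyCoeffField k d)) Ω]
    [IsScalarTower (PolyCoeffField k d) (RatFunc (PolyCoeffField k d)) Ω]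
    [Algebra.IsAlgebraic (RatFunc (PolyCoeffField k d)) Ω]
    [DecidableEq (TransPt (PolyCoeffField k d) Ω)] (h : IsRatMap (genericPoly k d) 1 d) (n : ℕ)
    {t : TransPt (PolyCoeffField k d) Ω}
    (ht : t.1 = algebraMap (RatFunc (PolyCoeffField k d)) Ω RatFunc.X) :
    ∃ a b : TransPt (PolyCoeffField k d) Ω, a ≠ b ∧ h.toFun a = h.toFun b ∧
      h.toFun^[n + 1] a = t ∧
      ∃ g : Ω ≃ₐ[RatFunc (PolyCoeffField k d)] Ω, ∀ y, h.toFun^[n + 1] y = t →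
        g • y = Equiv.swap a b y := by
  obtain ⟨E, _, _, _, l, ξ, hind⟩ :=
    exists_isAlgClosed_algebraicIndependent (AlgebraicClosure k) (Fin (d + 1))
  have hl : Transcendental (AlgebraicClosure k) l :=
    (algebraicIndependent_unique_type_iff (ι := Unit)).mp
      (hind.comp (fun _ => none) fun _ _ _ => rfl)
  obtain ⟨p, x, hp, hpc, hx, horb⟩ := exists_hasSimpleCriticalOrbit hl hd (by
    rintro rfl h2
    refine hchar ?_
    have h3 : (2 : k) = 0 := by
      apply (algebraMap k (AlgebraicClosure k)).injective
      rw [map_ofNat, h2, map_zero]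
    rw [ringChar.eq_iff.mpr (CharTwo.of_one_ne_zero_of_two_eq_zero one_ne_zero h3)]) n
  obtain ⟨ψ, hψ, hψX⟩ := hind.exists_ratFunc_powerSeries_ringHom k
    (p := fun i => p.coeff i) (fun i => hpc i) hx
  refine h.exists_swap_of_ringHom (P₀ := p) (Q₀ := 1) (P' := p.map PowerSeries.C +
    C (PowerSeries.X ^ 2) * (polyOfCoeffs ξ).map PowerSeries.C) (Q' := 1) ?_ horb ψ ?_ ?_ hψX ht
  · exact ⟨hp, by rw [natDegree_one]; omega, isCoprime_one_right,
      natDegree_perturbation_le ξ hp.le, by simp, ⟨_, rfl⟩, ⟨0, by simp⟩⟩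
  · exact map_polyOfCoeffs_eq _ ξ _ hp.le hψ
  · simp

theorem exists_swap_genericRat (hd : 2 ≤ d) {Ω : Type u} [Field Ω] [IsAlgClosed Ω]
    [Algebra (RatCoeffField k d) Ω] [Algebra (RatFunc (RatCoeffField k d)) Ω]
    [IsScalarTower (RatCoeffField k d) (RatFunc (RatCoeffField k d)) Ω]
    [Algebra.IsAlgebraic (RatFunc (RatCoeffField k d)) Ω]
    [DecidableEq (TransPt (RatCoeffField k d) Ω)]
    (h : IsRatMap
      (polyOfCoeffs fun i : Fin (d + 1) =>
        algebraMap (MvPolynomial (Fin (d + 1) ⊕ Fin (d + 1)) k) (RatCoeffField k d)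
          (MvPolynomial.X (Sum.inl i)))
      (polyOfCoeffs fun i : Fin (d + 1) =>
        algebraMap (MvPolynomial (Fin (d + 1) ⊕ Fin (d + 1)) k) (RatCoeffField k d)
          (MvPolynomial.X (Sum.inr i))) d) (n : ℕ)
    {t : TransPt (RatCoeffField k d) Ω}
    (ht : t.1 = algebraMap (RatFunc (RatCoeffField k d)) Ω RatFunc.X) :
    ∃ a b : TransPt (RatCoeffField k d) Ω, a ≠ b ∧ h.toFun a = h.toFun b ∧
      h.toFun^[n + 1] a = t ∧
      ∃ g : Ω ≃ₐ[RatFunc (RatCoeffField k d)] Ω, ∀ y, h.toFun^[n + 1] y = t →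
        g • y = Equiv.swap a b y := by
  obtain ⟨E, _, _, _, l, ξ, hind⟩ :=
    exists_isAlgClosed_algebraicIndependent (AlgebraicClosure k) (Fin (d + 1) ⊕ Fin (d + 1))
  have hl : Transcendental (AlgebraicClosure k) l :=
    (algebraicIndependent_unique_type_iff (ι := Unit)).mp
      (hind.comp (fun _ => none) fun _ _ _ => rfl)
  obtain ⟨p, q, x, hp, hq, hpq, hpc, hqc, hx, horb⟩ :=
    exists_hasSimpleCriticalOrbit_rat hl hd n
  obtain ⟨ψ, hψ, hψX⟩ := hind.exists_ratFunc_powerSeries_ringHom k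
    (p := Sum.elim (fun i => p.coeff i) fun i => q.coeff i)
    (by rintro (i | i); exacts [hpc i, hqc i]) hx
  refine h.exists_swap_of_ringHom (P₀ := p) (Q₀ := q)
    (P' := p.map PowerSeries.C + C (PowerSeries.X ^ 2) *
      (polyOfCoeffs fun i => ξ (Sum.inl i)).map PowerSeries.C)
    (Q' := q.map PowerSeries.C + C (PowerSeries.X ^ 2) *
      (polyOfCoeffs fun i => ξ (Sum.inr i)).map PowerSeries.C) ?_ horb ψ ?_ ?_ hψX ht
  · exact ⟨hp, hq, hpq, natDegree_perturbation_le _ hp.le, natDegree_perturbation_le _ hq.le,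
      ⟨_, rfl⟩, ⟨_, rfl⟩⟩
  · exact map_polyOfCoeffs_eq _ _ _ hp.le fun i => hψ (Sum.inl i)
  · exact map_polyOfCoeffs_eq _ _ _ hq.le fun i => hψ (Sum.inr i)

end Generic

/-! ### The generic maps are generic, coprime and separable -/

section FractionRingBasis

variable (k σ : Type*) [Field k]

theorem isTranscendenceBasis_fractionRing_X :
    IsTranscendenceBasis k fun i : σ => algebraMap (MvPolynomial σ k)
      (FractionRing (MvPolynomial σ k)) (MvPolynomial.X i) := by
  have : Algebra.IsAlgebraic (MvPolynomial σ k) (FractionRing (MvPolynomial σ k)) :=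
    IsLocalization.isAlgebraic _ (nonZeroDivisors _)
  exact (IsTranscendenceBasis.mvPolynomial σ k).algebraMap_comp

theorem adjoin_fractionRing_X_eq_top :
    IntermediateField.adjoin k (Set.range fun i : σ => algebraMap (MvPolynomial σ k)
      (FractionRing (MvPolynomial σ k)) (MvPolynomial.X i)) = ⊤ := by
  rw [eq_top_iff]
  rintro z -
  have key (p : MvPolynomial σ k) : algebraMap _ (FractionRing (MvPolynomial σ k)) p ∈
      IntermediateField.adjoin k (Set.range fun i : σ => algebraMap (MvPolynomial σ k)
        (FractionRing (MvPolynomial σ k)) (MvPolynomial.X i)) := by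
    induction p using MvPolynomial.induction_on with
    | C a =>
      rw [← MvPolynomial.algebraMap_eq, ← IsScalarTower.algebraMap_apply]
      exact IntermediateField.algebraMap_mem _ a
    | add p q hp hq => rw [map_add]; exact add_mem hp hq
    | mul_X p i hp =>
      rw [map_mul]
      exact mul_mem hp (IntermediateField.subset_adjoin _ _ ⟨i, rfl⟩)
  obtain ⟨a, b, -, rfl⟩ := IsFractionRing.div_surjective (A := MvPolynomial σ k) z
  exact div_mem (key a) (key b)

end FractionRingBasis

section Generic

variable {k : Type u} [Field k] {d : ℕ}

theorem coeff_rest_mem_adjoin {K : Type u} {τ : Type*} [Field K] [Algebra k K] (hd : 1 ≤ d)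
    (c : τ → K) (e : Fin (d + 1) → τ) (he : Function.Injective e) (n : ℕ) :
    (polyOfCoeffs (fun i => c (e i)) - C (c (e 1)) * X - C (c (e 0))).coeff n ∈
      Algebra.adjoin k (c '' {e 0, e 1}ᶜ) := by
  rw [coeff_sub, coeff_sub, coeff_polyOfCoeffs, coeff_C_mul, coeff_X, coeff_C]
  have h1 : ((1 : Fin (d + 1)) : ℕ) = 1 := by
    rw [Fin.val_one']; exact Nat.mod_eq_of_lt (by omega)
  by_cases hn : n < d + 1
  · rw [dif_pos hn]
    rcases n with _ | _ | n
    · simp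
    · have : (⟨1, hn⟩ : Fin (d + 1)) = 1 := Fin.ext h1.symm
      simp [this]
    · have hmem : c (e ⟨n + 1 + 1, hn⟩) ∈ Algebra.adjoin k (c '' {e 0, e 1}ᶜ) := by
        refine Algebra.subset_adjoin ⟨_, ?_, rfl⟩
        simp only [Set.mem_compl_iff, Set.mem_insert_iff, Set.mem_singleton_iff, he.eq_iff, not_or,
          Fin.ext_iff, h1, Fin.val_zero]
        omega
      simpa using hmem
  · rw [dif_neg hn, if_neg (by omega), if_neg (by omega)]
    simp

theorem isGenericMap_genericPoly (hd : 1 ≤ d) :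
    IsGenericMap k (genericPoly k d) 1 (fun i : Fin (d + 1) =>
      algebraMap (MvPolynomial (Fin (d + 1)) k) (PolyCoeffField k d) (MvPolynomial.X i)) 0 1 where
  ne := by
    intro h
    have := congrArg Fin.val h
    rw [Fin.val_one', Nat.mod_eq_of_lt (by omega)] at this
    simp at this
  isTranscendenceBasis := isTranscendenceBasis_fractionRing_X k _
  adjoin_eq_top := adjoin_fractionRing_X_eq_top k _
  coeff_num := coeff_rest_mem_adjoin hd _ id Function.injective_id
  coeff_den n := by
    rw [coeff_one]
    split_ifs
    · exact one_mem _
    · exact zero_mem _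

theorem isGenericMap_genericRat (hd : 1 ≤ d) :
    IsGenericMap k
      (polyOfCoeffs fun i : Fin (d + 1) =>
        algebraMap (MvPolynomial (Fin (d + 1) ⊕ Fin (d + 1)) k) (RatCoeffField k d)
          (MvPolynomial.X (Sum.inl i)))
      (polyOfCoeffs fun i : Fin (d + 1) =>
        algebraMap (MvPolynomial (Fin (d + 1) ⊕ Fin (d + 1)) k) (RatCoeffField k d)
          (MvPolynomial.X (Sum.inr i)))
      (fun i : Fin (d + 1) ⊕ Fin (d + 1) =>
        algebraMap (MvPolynomial (Fin (d + 1) ⊕ Fin (d + 1)) k) (RatCoeffField k d)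
          (MvPolynomial.X i)) (Sum.inl 0) (Sum.inl 1) where
  ne := by
    intro h
    have := congrArg Fin.val (Sum.inl_injective h)
    rw [Fin.val_one', Nat.mod_eq_of_lt (by omega)] at this
    simp at this
  isTranscendenceBasis := isTranscendenceBasis_fractionRing_X k _
  adjoin_eq_top := adjoin_fractionRing_X_eq_top k _
  coeff_num := coeff_rest_mem_adjoin hd (fun i : Fin (d + 1) ⊕ Fin (d + 1) =>
        algebraMap (MvPolynomial (Fin (d + 1) ⊕ Fin (d + 1)) k) (RatCoeffField k d)
          (MvPolynomial.X i)) Sum.inl Sum.inl_injective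
  coeff_den n := by
    rw [coeff_polyOfCoeffs]
    split_ifs
    · exact Algebra.subset_adjoin ⟨Sum.inr _, by simp, rfl⟩
    · exact zero_mem _

theorem fractionRing_X_ne_zero {σ : Type*} (i : σ) : algebraMap (MvPolynomial σ k)
    (FractionRing (MvPolynomial σ k)) (MvPolynomial.X i) ≠ 0 := by
  rw [ne_eq, IsFractionRing.to_map_eq_zero_iff]
  exact MvPolynomial.X_ne_zero i

theorem isRatMap_genericPoly (hd : 1 ≤ d) : IsRatMap (genericPoly k d) 1 d where
  pos := hd
  natDegree_num := by
    refine natDegree_eq_of_le_of_coeff_ne_zero (natDegree_polyOfCoeffs_le _) ?_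
    rw [genericPoly, coeff_polyOfCoeffs, dif_pos d.lt_succ_self]
    exact fractionRing_X_ne_zero _
  natDegree_den := by simp
  isCoprime := isCoprime_one_right
  wronskian_ne_zero := by
    intro h
    have := congrArg (fun p => p.coeff 0) h
    simp only [derivative_one, mul_zero, sub_zero, mul_one, coeff_derivative, coeff_zero, zero_add,
      Nat.cast_zero] at this
    rw [genericPoly, coeff_polyOfCoeffs, dif_pos (by omega)] at this
    exact fractionRing_X_ne_zero _ this

theorem isRatMap_genericRat (hd : 1 ≤ d) : IsRatMap
    (polyOfCoeffs fun i : Fin (d + 1) =>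
      algebraMap (MvPolynomial (Fin (d + 1) ⊕ Fin (d + 1)) k) (RatCoeffField k d)
        (MvPolynomial.X (Sum.inl i)))
    (polyOfCoeffs fun i : Fin (d + 1) =>
      algebraMap (MvPolynomial (Fin (d + 1) ⊕ Fin (d + 1)) k) (RatCoeffField k d)
        (MvPolynomial.X (Sum.inr i))) d where
  pos := hd
  natDegree_num := by
    refine natDegree_eq_of_le_of_coeff_ne_zero (natDegree_polyOfCoeffs_le _) ?_
    rw [coeff_polyOfCoeffs, dif_pos d.lt_succ_self]
    exact fractionRing_X_ne_zero _
  natDegree_den := natDegree_polyOfCoeffs_le _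
  isCoprime := (isGenericMap_genericRat hd).isCoprime fun h => by
    have := congrArg (fun p => p.coeff 0) h
    simp only [coeff_zero] at this
    rw [coeff_polyOfCoeffs, dif_pos (by omega)] at this
    exact fractionRing_X_ne_zero _ this
  wronskian_ne_zero := by
    intro h
    have := congrArg (fun p => p.coeff 0) h
    simp only [coeff_sub, mul_coeff_zero, coeff_derivative, zero_add, Nat.cast_zero, mul_one,
      coeff_zero] at this
    rw [coeff_polyOfCoeffs, coeff_polyOfCoeffs, coeff_polyOfCoeffs, coeff_polyOfCoeffs,
      dif_pos (by omega), dif_pos (by omega), dif_pos (by omega), dif_pos (by omega), ← map_mul,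
      ← map_mul, ← map_sub, IsFractionRing.to_map_eq_zero_iff] at this
    -- The constant coefficient of the Wronskian is `r₁ s₀ - r₀ s₁`; this specialization gives it
    -- the value `1`.
    have h2 := congrArg (MvPolynomial.eval (Sum.elim
      (fun i : Fin (d + 1) => if (i : ℕ) = 1 then (1 : k) else 0)
      fun i : Fin (d + 1) => if (i : ℕ) = 1 then (0 : k) else 1)) this
    simp at h2

end Generic

/-! ### Zeros of the iterate minus `t` as iterated preimages -/

section Evaluation

variable {K Ω : Type u} [Field K] [Field Ω] [Algebra K Ω] {d : ℕ}

theorem IsRatMap.coe_iterate_toFun {P : K[X]} (h : IsRatMap P 1 d) (n : ℕ) (y : TransPt K Ω) :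
    (h.toFun^[n] y).1 = aeval y.1 (P.comp^[n] X) := by
  induction n with
  | zero => simp
  | succ n ih =>
    rw [Function.iterate_succ_apply', Function.iterate_succ_apply', aeval_comp, ← ih]
    simp [toFun]

/-- Evaluation of rational functions at a transcendental element. -/
noncomputable def TransPt.eval (y : TransPt K Ω) : RatFunc K →+* Ω :=
  IsFractionRing.lift (A := K[X]) (g := (aeval y.1 : K[X] →ₐ[K] Ω).toRingHom)
    (transcendental_iff_injective.mp y.2)

theorem TransPt.eval_algebraMap (y : TransPt K Ω) (p : K[X]) :
    y.eval (algebraMap K[X] (RatFunc K) p) = aeval y.1 p :=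
  IsFractionRing.lift_algebraMap _ p

theorem TransPt.eval_div (y : TransPt K Ω) (p q : K[X]) :
    y.eval (algebraMap K[X] (RatFunc K) p / algebraMap K[X] (RatFunc K) q) =
      aeval y.1 p / aeval y.1 q := by
  rw [map_div₀, eval_algebraMap, eval_algebraMap]

theorem TransPt.eval_eq (y : TransPt K Ω) (r : RatFunc K) :
    y.eval r = aeval y.1 r.num / aeval y.1 r.denom := by
  rw [← eval_div, RatFunc.num_div_denom]

/-- Evaluation at a transcendental point is a field embedding of `K(X)`, so no denominator vanishes
and substitution becomes composition of maps on points. -/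
theorem TransPt.eval_ratComp (y w : TransPt K Ω) (φ ψ : RatFunc K) (hw : y.eval ψ = w.1) :
    y.eval (ratComp φ ψ) = w.eval φ := by
  have h (p : K[X]) : y.eval (p.eval₂ RatFunc.C ψ) = aeval w.1 p := by
    rw [hom_eval₂, hw, aeval_def]
    congr 1
    ext z
    rw [RingHom.comp_apply, ← RatFunc.algebraMap_C, eval_algebraMap, aeval_C]
  rw [ratComp, RatFunc.eval, map_div₀, h, h, eval_eq]

theorem IsRatMap.eval_ratIter {P Q : K[X]} (h : IsRatMap P Q d) (n : ℕ) (y : TransPt K Ω) :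
    y.eval (ratIter (algebraMap K[X] (RatFunc K) P / algebraMap K[X] (RatFunc K) Q) n) =
      (h.toFun^[n] y).1 := by
  induction n with
  | zero =>
    rw [ratIter, Function.iterate_zero, id, ← RatFunc.algebraMap_X, TransPt.eval_algebraMap,
      aeval_X]
    rfl
  | succ n ih =>
    rw [ratIter, Function.iterate_succ_apply', ← ratIter, TransPt.eval_ratComp _ _ _ _ ih,
      TransPt.eval_div, Function.iterate_succ_apply']
    rfl

theorem mem_rootSet_num_div {F Ω : Type*} [Field F] [Field Ω] [Algebra F Ω] {a b : F[X]}
    (hab : IsCoprime a b) (hb : b ≠ 0) (y : Ω) :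
    aeval y (algebraMap F[X] (RatFunc F) a / algebraMap F[X] (RatFunc F) b).num = 0 ↔
      aeval y a = 0 := by
  set r := algebraMap F[X] (RatFunc F) a / algebraMap F[X] (RatFunc F) b with hr
  have hcop {p q : F[X]} (hpq : IsCoprime p q) (hp : aeval y p = 0) : aeval y q ≠ 0 := by
    intro hq
    obtain ⟨u, v, huv⟩ := hpq
    have := congrArg (aeval y) huv
    simp [hp, hq] at this
  have h : r.num * b = a * r.denom := by
    have h1 := RatFunc.num_div_denom r
    rw [hr, div_eq_div_iff (RatFunc.algebraMap_ne_zero (RatFunc.denom_ne_zero _))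
      (RatFunc.algebraMap_ne_zero hb), ← map_mul, ← map_mul] at h1
    exact IsFractionRing.injective F[X] (RatFunc F) h1
  have h2 := congrArg (aeval y) h
  rw [map_mul, map_mul] at h2
  constructor
  · intro h3
    rw [h3, zero_mul, eq_comm, mul_eq_zero] at h2
    exact h2.resolve_right (hcop (RatFunc.isCoprime_num_denom r) h3)
  · intro h3
    rw [h3, zero_mul, mul_eq_zero] at h2
    exact h2.resolve_right (hcop hab h3)

theorem ratIterSubT_eq (φ : RatFunc K) (n : ℕ) :
    ratIterSubT φ n = algebraMap (RatFunc K)[X] (RatFunc (RatFunc K))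
        ((ratIter φ n).num.map RatFunc.C - C RatFunc.X * (ratIter φ n).denom.map RatFunc.C) /
      algebraMap (RatFunc K)[X] (RatFunc (RatFunc K)) ((ratIter φ n).denom.map RatFunc.C) := by
  have h (p : K[X]) : p.eval₂ ((RatFunc.C : RatFunc K →+* RatFunc (RatFunc K)).comp
      (RatFunc.C : K →+* RatFunc K)) RatFunc.X =
      algebraMap (RatFunc K)[X] (RatFunc (RatFunc K)) (p.map RatFunc.C) := by
    rw [← eval₂_map, ← RatFunc.algebraMap_X]
    have : (RatFunc.C : RatFunc K →+* RatFunc (RatFunc K)) =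
        (algebraMap (RatFunc K)[X] (RatFunc (RatFunc K))).comp C := by
      ext z; rw [RingHom.comp_apply, RatFunc.algebraMap_C]
    rw [this, ← hom_eval₂, eval₂_C_X]
  have hD : algebraMap (RatFunc K)[X] (RatFunc (RatFunc K))
      ((ratIter φ n).denom.map RatFunc.C) ≠ 0 :=
    RatFunc.algebraMap_ne_zero ((Polynomial.map_ne_zero_iff (RatFunc.C : K →+* _).injective).mpr
      (RatFunc.denom_ne_zero _))
  rw [ratIterSubT, RatFunc.eval, h, h, map_sub, map_mul, sub_div, mul_div_cancel_right₀ _ hD,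
    RatFunc.algebraMap_C]

end Evaluation

section Roots

variable {K Ω : Type u} [Field K] [Field Ω] [Algebra K Ω] [Algebra (RatFunc K) Ω]
  [IsScalarTower K (RatFunc K) Ω] {d : ℕ} {t : TransPt K Ω}

theorem aeval_map_ratFunc_C (q : K[X]) (y : Ω) :
    aeval y (q.map (RatFunc.C : K →+* RatFunc K)) = aeval y q := by
  rw [← RatFunc.algebraMap_eq_C, aeval_map_algebraMap]

theorem IsRatMap.mem_rootSet_polyIterSubT {P : K[X]} (h : IsRatMap P 1 d)
    (ht : t.1 = algebraMap (RatFunc K) Ω RatFunc.X) (n : ℕ) (y : Ω) :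
    y ∈ (polyIterSubT P n).rootSet Ω ↔ ∃ z : TransPt K Ω, h.toFun^[n] z = t ∧ z.1 = y := by
  have hev (y : Ω) : aeval y (polyIterSubT P n) = aeval y (P.comp^[n] X) - t.1 := by
    rw [polyIterSubT, map_sub, aeval_map_ratFunc_C, aeval_C, ht]
  have halg (y : Ω) (hy : aeval y (polyIterSubT P n) = 0) : Transcendental K y := by
    intro hy'
    rw [hev, sub_eq_zero] at hy
    exact t.2 (hy ▸ isAlgebraic_aeval hy' _)
  have hne : polyIterSubT P n ≠ 0 := fun h0 =>
    halg 0 (by rw [h0, map_zero]) isAlgebraic_zero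
  rw [mem_rootSet, and_iff_right hne]
  constructor
  · intro hy
    refine ⟨⟨y, halg y hy⟩, Subtype.ext ?_, rfl⟩
    rw [hev, sub_eq_zero] at hy
    rw [h.coe_iterate_toFun, hy]
  · rintro ⟨z, hz, rfl⟩
    rw [hev, ← h.coe_iterate_toFun, hz, sub_self]

/-- With `R` the iterate in lowest terms, the zeros are those of `R.num - t R.denom`. An algebraic
zero would make `t` algebraic, so all zeros are transcendental, and there `R` evaluates to the
iterated map. The degree of `R` is never needed. -/
theorem IsRatMap.mem_rootSet_ratIterSubT {P Q : K[X]} (h : IsRatMap P Q d)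
    (ht : t.1 = algebraMap (RatFunc K) Ω RatFunc.X) (n : ℕ) (y : Ω) :
    y ∈ (ratIterSubT (algebraMap K[X] (RatFunc K) P / algebraMap K[X] (RatFunc K) Q)
      n).num.rootSet Ω ↔ ∃ z : TransPt K Ω, h.toFun^[n] z = t ∧ z.1 = y := by
  set φ := algebraMap K[X] (RatFunc K) P / algebraMap K[X] (RatFunc K) Q with hφ
  set R := ratIter φ n with hR
  have hcop := RatFunc.isCoprime_num_denom R
  have hev (y : Ω) : aeval y (ratIterSubT φ n).num = 0 ↔
      aeval y R.num = t.1 * aeval y R.denom := by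
    rw [ratIterSubT_eq, mem_rootSet_num_div, map_sub, map_mul, aeval_map_ratFunc_C,
      aeval_map_ratFunc_C, aeval_C, ← ht, sub_eq_zero]
    · have h1 := hcop.map (mapRingHom (RatFunc.C : K →+* RatFunc K))
      rw [sub_eq_add_neg, ← neg_mul]
      exact h1.add_mul_right_left _
    · exact (Polynomial.map_ne_zero_iff (RatFunc.C : K →+* _).injective).mpr
        (RatFunc.denom_ne_zero _)
  have hD (y : Ω) (hy : aeval y R.num = t.1 * aeval y R.denom) : aeval y R.denom ≠ 0 := by
    intro h0
    rw [h0, mul_zero] at hy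
    obtain ⟨u, v, huv⟩ := hcop
    have := congrArg (aeval y) huv
    simp [hy, h0] at this
  have htr (y : Ω) (hy : aeval y R.num = t.1 * aeval y R.denom) : Transcendental K y := by
    intro hy'
    rw [← div_eq_iff (hD y hy)] at hy
    refine t.2 ?_
    rw [← hy, div_eq_mul_inv]
    exact (isAlgebraic_aeval hy' _).mul (isAlgebraic_aeval hy' _).inv
  -- Were the numerator zero, the algebraic element `0` would be one of its zeros.
  have hne : (ratIterSubT φ n).num ≠ 0 := fun h0 =>
    htr 0 ((hev 0).mp (by rw [h0, map_zero])) isAlgebraic_zero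
  rw [mem_rootSet, and_iff_right hne, hev]
  constructor
  · intro hy
    refine ⟨⟨y, htr y hy⟩, Subtype.ext ?_, rfl⟩
    rw [← h.eval_ratIter, TransPt.eval_eq, div_eq_iff (hD y hy)]
    exact hy
  · rintro ⟨z, hz, rfl⟩
    have h1 := h.eval_ratIter n z
    rw [hz, TransPt.eval_eq, div_eq_iff] at h1
    · exact h1
    · exact fun h0 => RatFunc.denom_ne_zero R ((transcendental_iff.mp z.2) _ h0)

end Roots

/-! ### The two generic cases -/

theorem transcendental_algebraMap_ratFunc_X (K Ω : Type*) [Field K] [Field Ω] [Algebra K Ω]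
    [Algebra (RatFunc K) Ω] [IsScalarTower K (RatFunc K) Ω] :
    Transcendental K (algebraMap (RatFunc K) Ω RatFunc.X) := by
  rw [transcendental_algebraMap_iff (algebraMap (RatFunc K) Ω).injective, ← RatFunc.algebraMap_X,
    transcendental_algebraMap_iff (RatFunc.algebraMap_injective K)]
  exact Polynomial.transcendental_X K

theorem galois_ratIterSubT_genericRat (k : Type u) [Field k] {d : ℕ} (hd : 2 ≤ d) (n : ℕ) :
    IsGalois (RatFunc (RatCoeffField k d))
        (ratIterSubT (genericRat k d) (n + 1)).num.SplittingField ∧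
      Nonempty (((ratIterSubT (genericRat k d) (n + 1)).num.SplittingField
          ≃ₐ[RatFunc (RatCoeffField k d)]
          (ratIterSubT (genericRat k d) (n + 1)).num.SplittingField) ≃*
        iterWreath (Equiv.Perm (Fin d)) (Fin d) (n + 1)) ∧
      fixProp (ratIterSubT (genericRat k d) (n + 1)).num ≤ 2 / (((n + 1 : ℕ) : ℚ) + 2) ∧
      ((d, n + 1) ≠ (3, 1) →
        fixProp (ratIterSubT (genericRat k d) (n + 1)).num < 2 / (((n + 1 : ℕ) : ℚ) + 2)) := by
  classical
  let K := RatCoeffField k d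
  let Ω := AlgebraicClosure (RatFunc K)
  let t : TransPt K Ω := ⟨_, transcendental_algebraMap_ratFunc_X K Ω⟩
  have h := isRatMap_genericRat (k := k) (d := d) (by omega)
  refine h.galois_of_exists_swap (Ω := Ω) hd (t := t) ⟨_, rfl⟩ (fun m a b hab hfab ha => ?_) n _
    (h.mem_rootSet_ratIterSubT rfl (n + 1))
  exact h.exists_swap_of_exists (isGenericMap_genericRat (by omega)) m rfl
    (exists_swap_genericRat hd h m rfl) hab hfab ha

theorem galois_polyIterSubT_genericPoly (k : Type u) [Field k] {d : ℕ} (hd : 2 ≤ d)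
    (hchar : (d, ringChar k) ≠ (2, 2)) (n : ℕ) :
    IsGalois (RatFunc (PolyCoeffField k d))
        (polyIterSubT (genericPoly k d) (n + 1)).SplittingField ∧
      Nonempty (((polyIterSubT (genericPoly k d) (n + 1)).SplittingField
          ≃ₐ[RatFunc (PolyCoeffField k d)]
          (polyIterSubT (genericPoly k d) (n + 1)).SplittingField) ≃*
        iterWreath (Equiv.Perm (Fin d)) (Fin d) (n + 1)) ∧
      fixProp (polyIterSubT (genericPoly k d) (n + 1)) ≤ 2 / (((n + 1 : ℕ) : ℚ) + 2) ∧
      ((d, n + 1) ≠ (3, 1) →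
        fixProp (polyIterSubT (genericPoly k d) (n + 1)) < 2 / (((n + 1 : ℕ) : ℚ) + 2)) := by
  classical
  let K := PolyCoeffField k d
  let Ω := AlgebraicClosure (RatFunc K)
  let t : TransPt K Ω := ⟨_, transcendental_algebraMap_ratFunc_X K Ω⟩
  have h := isRatMap_genericPoly (k := k) (d := d) (by omega)
  refine h.galois_of_exists_swap (Ω := Ω) hd (t := t) ⟨_, rfl⟩ (fun m a b hab hfab ha => ?_) n _
    (h.mem_rootSet_polyIterSubT rfl (n + 1))
  exact h.exists_swap_of_exists (isGenericMap_genericPoly (by omega)) m rfl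
    (exists_swap_genericPoly hd hchar h m rfl) hab hfab ha

theorem lemma4p1 (k : Type u) [Field k] (d n : ℕ) (hd : 2 ≤ d) (hn : 1 ≤ n) :
    (IsGalois (RatFunc (RatCoeffField k d)) (RatSplittingField (ratIterSubT (genericRat k d) n)) ∧
      Nonempty ((RatSplittingField (ratIterSubT (genericRat k d) n) ≃ₐ[RatFunc (RatCoeffField k d)]
          RatSplittingField (ratIterSubT (genericRat k d) n)) ≃*
        iterWreath (Equiv.Perm (Fin d)) (Fin d) n) ∧
      ratFixProp (ratIterSubT (genericRat k d) n) ≤ 2 / ((n : ℚ) + 2) ∧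
      ((d, n) ≠ (3, 1) →
        ratFixProp (ratIterSubT (genericRat k d) n) < 2 / ((n : ℚ) + 2))) ∧
    ((d, ringChar k) ≠ (2, 2) →
      IsGalois (RatFunc (PolyCoeffField k d))
        (polyIterSubT (genericPoly k d) n).SplittingField ∧
      Nonempty (((polyIterSubT (genericPoly k d) n).SplittingField
          ≃ₐ[RatFunc (PolyCoeffField k d)]
          (polyIterSubT (genericPoly k d) n).SplittingField) ≃*
        iterWreath (Equiv.Perm (Fin d)) (Fin d) n) ∧
      fixProp (polyIterSubT (genericPoly k d) n) ≤ 2 / ((n : ℚ) + 2) ∧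
      ((d, n) ≠ (3, 1) →
        fixProp (polyIterSubT (genericPoly k d) n) < 2 / ((n : ℚ) + 2))) := by
  obtain ⟨m, rfl⟩ : ∃ m, n = m + 1 := ⟨n - 1, by omega⟩
  exact ⟨galois_ratIterSubT_genericRat k hd m,
    fun hchar => galois_polyIterSubT_genericPoly k hd hchar m⟩
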